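/- Let $A,B>0$, let $\mathcal L\subset\mathbb R^2$ be a lattice of rank two, and let $T^3_{\mathcal L}=E(2)/\mathcal L$ be the Bianchi torus: the quotient of $\mathbb R^3\ni(q_0,q_1,q_2)$ by $2\pi\mathbb Z\times\mathcal L$, with the metric (induced by a left-invariant metric on $E(2)$) $$ds^2=A^{-1}dq_0^2+B^{-1}\bigl(dq_1^2+dq_2^2+(B-1)(\sin q_0\,dq_1+\cos q_0\,dq_2)^2\bigr).$$ Let $\omega_1,\omega_2$ be a $\mathbb Z$-basis of $2\pi\mathcal L^*=\{v\in\mathbb R^2:\langle v,\ell\rangle\in2\pi\mathbb Z\ \text{for all}\ \ell\in\mathcal L\}$. For $k=(k_1,k_2)\in\mathbb Z^2$ put $(k,\Omega q)=\langle k_1\omega_1+k_2\omega_2,(q_1,q_2)\rangle$ and $Q(k)=|k_1\omega_1+k_2\omega_2|^2$. For $k\neq0$ put $\mu(k)=\frac{(B-1)Q(k)}{2A}$ and let $\alpha(k)$ be the angle with $k_1\omega_1+k_2\omega_2=\sqrt{Q(k)}\,(\cos\alpha(k),\sin\alpha(k))$. For $\mu\in\mathbb R$ let $\lambda_0(\mu)\le\lambda_1(\mu)\le\dots$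 be the eigenvalues, repeated according to multiplicity, of the Mathieu operator $-\frac{d^2}{dx^2}+\mu\cos2x$ on real $2\pi$-periodic functions, and let $\varphi_l(\cdot,\mu)$ be corresponding nonzero, pairwise orthogonal, real $2\pi$-periodic eigenfunctions (Mathieu functions). Such functions exist for every $\mu$, and for every choice of them the following holds. 1. The Laplace-Beltrami operator of $T^3_{\mathcal L}$ is $$\Delta=A\frac{\partial^2}{\partial q_0^2}+\frac{\partial^2}{\partial q_1^2}+\frac{\partial^2}{\partial q_2^2}+(B-1)\Bigl(\cos q_0\frac{\partial}{\partial q_1}-\sin q_0\frac{\partial}{\partial q_2}\Bigr)^2 .$$ 2. The functions $$\Psi_{0,m}(q)=e^{imq_0}\ (m\in\mathbb Z),\qquad \Psi_{k,l}(q)=e^{i(k,\Omega q)}\varphi_l(q_0+\alpha(k),\mu(k))\ (k\in\mathbb Z^2\setminus\{0\},\ l\ge0)$$ are well-defined smooth functions on $T^3_{\mathcal L}$ and satisfy $-\Delta\Psi_{0,m}=Am^2\,\Psi_{0,m}$ and $-\Delta\Psi_{k,l}=\bigl(A\lambda_l(\mu(k))+\tfrac{(B+1)Q(k)}2\bigr)\Psi_{k,l}$.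 They form a complete orthogonal basis of $L^2(T^3_{\mathcal L})$: divided by their norms, they are an orthonormal (Hilbert) basis. 3. If $B\ne1$, the spectrum of the self-adjoint operator $-\Delta$ in $L^2(T^3_{\mathcal L})$ is $\mathrm{Spec}_0\cup\mathrm{Spec}_M$, where $$\mathrm{Spec}_0=\{Am^2: m\in\mathbb Z_{\ge0}\},\qquad \mathrm{Spec}_M=\Bigl\{A\lambda_l(\mu(k))+\frac{(B+1)Q(k)}2:\ k\in\mathbb Z^2\setminus\{0\},\ l\in\mathbb Z_{\ge0}\Bigr\}.$$ -/

import Mathlib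

open MeasureTheory

noncomputable section

namespace Bianchi

/-! ## The Mathieu operator on the circle -/

/-- The space of real `2π`-periodic solutions `y` of `-y'' + μ cos(2x) y = lam y`, i.e. the
eigenspace of the Mathieu operator `L = -d²/dx² + μ cos 2x` on the circle `ℝ/2πℤ`
(it is `0` when `lam` is not an eigenvalue). -/
def mathieuEigenspace (μ lam : ℝ) : Submodule ℝ (ℝ → ℝ) where
  carrier := {y | ContDiff ℝ 2 y ∧ Function.Periodic y (2 * Real.pi) ∧
    ∀ x, -(iteratedDeriv 2 y x) + μ * Real.cos (2 * x) * y x = lam * y x}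
  zero_mem' := by
    refine ⟨contDiff_const, fun x => rfl, fun x => ?_⟩
    have h : iteratedDeriv 2 (0 : ℝ → ℝ) x = 0 := by
      simp
    simp [h]
  add_mem' := by
    rintro y z ⟨hy, py, ey⟩ ⟨hz, pz, ez⟩
    refine ⟨hy.add hz, py.add pz, fun x => ?_⟩
    rw [iteratedDeriv_add hy.contDiffAt hz.contDiffAt, Pi.add_apply]
    linear_combination ey x + ez x
  smul_mem' := by
    rintro c y ⟨hy, py, ey⟩
    refine ⟨contDiff_const.smul hy, py.smul c, fun x => ?_⟩
    have h : iteratedDeriv 2 (c • y) x = c • iteratedDeriv 2 y x :=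
      iteratedDeriv_const_smul hy.contDiffAt c
    rw [h, Pi.smul_apply, smul_eq_mul, smul_eq_mul]
    linear_combination c * ey x

/-- `λ_l(μ)`: the eigenvalues of the Mathieu operator on the circle in increasing order
`λ_0 ≤ λ_1 ≤ …`, repeated according to multiplicity. That is, `λ_l` is the least `lam` such that
the eigenfunctions with eigenvalue at most `lam` span a space of dimension more than `l`. -/
def mathieuEigenvalue (μ : ℝ) (l : ℕ) : ℝ :=
  sInf {lam : ℝ | (l : Cardinal) <
    Module.rank ℝ (⨆ ν ∈ Set.Iic lam, mathieuEigenspace μ ν : Submodule ℝ (ℝ → ℝ))}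

/-- `φ_0, φ_1, …` are periodic Mathieu functions belonging to `λ_0(μ), λ_1(μ), …`: nonzero
`2π`-periodic solutions of `L φ_l = λ_l(μ) φ_l`, pairwise orthogonal on the circle, with no fixed
normalisation. (For `μ ≠ 0` the eigenvalues are simple and this determines every `φ_l` up to a
factor; for `μ = 0` the functions `1, cos x, sin x, cos 2x, sin 2x, …` are such a system.) -/
def IsMathieuSystem (μ : ℝ) (φ : ℕ → ℝ → ℝ) : Prop :=
  (∀ l, φ l ∈ mathieuEigenspace μ (mathieuEigenvalue μ l) ∧ φ l ≠ 0) ∧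
  ∀ l m, l ≠ m → ∫ x in (0 : ℝ)..(2 * Real.pi), φ l x * φ m x = 0

/-! ## Riemannian metrics in coordinates -/

/-- The partial derivative `∂f/∂q_i`. -/
def partialDeriv (i : Fin 3) (f : (Fin 3 → ℝ) → ℂ) (q : Fin 3 → ℝ) : ℂ :=
  fderiv ℝ f q (Pi.single i 1)

/-- The Riemannian volume density `√(det g)`. -/
def volumeDensity (g : (Fin 3 → ℝ) → Matrix (Fin 3) (Fin 3) ℝ) (q : Fin 3 → ℝ) : ℝ :=
  √((g q).det)

/-- The Laplace-Beltrami operator of the metric `g`: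
`Δ f = (det g)^{-1/2} ∑_{i,j} ∂_i ((det g)^{1/2} g^{ij} ∂_j f)`. -/
def laplaceBeltrami (g : (Fin 3 → ℝ) → Matrix (Fin 3) (Fin 3) ℝ)
    (f : (Fin 3 → ℝ) → ℂ) (q : Fin 3 → ℝ) : ℂ :=
  ((volumeDensity g q)⁻¹ : ℝ) *
    ∑ i, partialDeriv i
      (fun p => ∑ j, ((volumeDensity g p * (g p)⁻¹ i j : ℝ) : ℂ) * partialDeriv j f p) q

/-- The left-invariant metric on `E(2)`
`ds² = A⁻¹ dq_0² + B⁻¹ (dq_1² + dq_2² + (B-1) (sin q_0 dq_1 + cos q_0 dq_2)²)`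
in the coordinates `q = (q_0, q_1, q_2)`. -/
def metric (A B : ℝ) (q : Fin 3 → ℝ) : Matrix (Fin 3) (Fin 3) ℝ :=
  !![A⁻¹, 0, 0;
     0, B⁻¹ * (1 + (B - 1) * Real.sin (q 0) ^ 2),
        B⁻¹ * ((B - 1) * (Real.sin (q 0) * Real.cos (q 0)));
     0, B⁻¹ * ((B - 1) * (Real.sin (q 0) * Real.cos (q 0))),
        B⁻¹ * (1 + (B - 1) * Real.cos (q 0) ^ 2)]

/-! ## The Bianchi torus -/

/-- The lattice `𝓛 ⊂ ℝ²` with basis `b`. -/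
def lattice (b : Module.Basis (Fin 2) ℝ (Fin 2 → ℝ)) : Submodule ℤ (Fin 2 → ℝ) :=
  Submodule.span ℤ (Set.range b)

/-- The group `2πℤ × 𝓛` of translations of `ℝ³ ∋ (q_0, q_1, q_2)`: the angle `q_0` is taken
modulo `2π`, which gives `E(2) = SO(2) ⋉ ℝ²`, and the translation by `ℓ ∈ 𝓛` acts on `E(2)` from
the left by `(q_0, q_1, q_2) ↦ (q_0, (q_1, q_2) + ℓ)`. -/
def periods (b : Module.Basis (Fin 2) ℝ (Fin 2 → ℝ)) : AddSubgroup (Fin 3 → ℝ) where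
  carrier := {v | (∃ n : ℤ, v 0 = 2 * Real.pi * n) ∧ ![v 1, v 2] ∈ lattice b}
  zero_mem' := by
    refine ⟨⟨0, by simp⟩, ?_⟩
    have h : ![(0 : Fin 3 → ℝ) 1, (0 : Fin 3 → ℝ) 2] = 0 := by
      ext i; fin_cases i <;> simp
    rw [h]
    exact Submodule.zero_mem _
  add_mem' := by
    rintro v w ⟨⟨n, hn⟩, hv⟩ ⟨⟨m, hm⟩, hw⟩
    refine ⟨⟨n + m, by rw [Pi.add_apply, hn, hm]; push_cast; ring⟩, ?_⟩
    have h : ![(v + w) 1, (v + w) 2] = ![v 1, v 2] + ![w 1, w 2] := by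
      ext i; fin_cases i <;> simp
    rw [h]
    exact Submodule.add_mem _ hv hw
  neg_mem' := by
    rintro v ⟨⟨n, hn⟩, hv⟩
    refine ⟨⟨-n, by rw [Pi.neg_apply, hn]; push_cast; ring⟩, ?_⟩
    have h : ![(-v) 1, (-v) 2] = -![v 1, v 2] := by
      ext i; fin_cases i <;> simp
    rw [h]
    exact Submodule.neg_mem _ hv

/-- The Bianchi torus `T³_𝓛`, the quotient of `E(2)` by the lattice of translations `𝓛`. -/
abbrev Torus (b : Module.Basis (Fin 2) ℝ (Fin 2 → ℝ)) : Type :=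
  (Fin 3 → ℝ) ⧸ periods b

/-- The point of the torus with coordinates `q`. -/
def proj (b : Module.Basis (Fin 2) ℝ (Fin 2 → ℝ)) (q : Fin 3 → ℝ) : Torus b :=
  QuotientAddGroup.mk q

/-- A fundamental domain of the torus in the coordinate space. -/
def cell (b : Module.Basis (Fin 2) ℝ (Fin 2 → ℝ)) : Set (Fin 3 → ℝ) :=
  {q | q 0 ∈ Set.Ico 0 (2 * Real.pi) ∧ ![q 1, q 2] ∈ ZSpan.fundamentalDomain b}

/-- The Riemannian volume of the torus with the metric `metric A B`. -/
def torusVolume (A B : ℝ) (b : Module.Basis (Fin 2) ℝ (Fin 2 → ℝ)) : Measure (Torus b) :=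
  Measure.map (proj b) ((volume.withDensity
    fun q => ENNReal.ofReal (volumeDensity (metric A B) q)).restrict (cell b))

/-- The Hilbert space `L²(T³_𝓛)`. -/
abbrev TorusL2 (A B : ℝ) (b : Module.Basis (Fin 2) ℝ (Fin 2 → ℝ)) : Type :=
  Lp ℂ 2 (torusVolume A B b)

/-- Smooth complex functions on the torus. -/
def IsSmooth (b : Module.Basis (Fin 2) ℝ (Fin 2 → ℝ)) (f : Torus b → ℂ) : Prop :=
  ContDiff ℝ ((⊤ : ℕ∞) : WithTop ℕ∞) (f ∘ proj b)

/-- The Laplace-Beltrami operator of the torus, acting on smooth functions: it is computed in the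
coordinates `q`, and the representative of the point does not matter because the metric and
`f ∘ proj b` are invariant under the periods. -/
def torusLaplacian (A B : ℝ) (b : Module.Basis (Fin 2) ℝ (Fin 2 → ℝ)) (f : Torus b → ℂ) :
    Torus b → ℂ :=
  fun x => laplaceBeltrami (metric A B) (f ∘ proj b) (Quotient.out x)

/-- The graph of the self-adjoint operator `-Δ` in `L²(T³_𝓛)`: `u` belongs to the domain and
`-Δ u = v`, in the sense of distributions, with `u` and `v` in `L²`. -/
def NegLaplacianGraph (A B : ℝ) (b : Module.Basis (Fin 2) ℝ (Fin 2 → ℝ))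
    (u v : TorusL2 A B b) : Prop :=
  ∀ f : Torus b → ℂ, IsSmooth b f →
    ∫ x, (starRingEnd ℂ) (-(torusLaplacian A B b f x)) * u x ∂(torusVolume A B b) =
      ∫ x, (starRingEnd ℂ) (f x) * v x ∂(torusVolume A B b)

/-- The spectrum of the unbounded operator with graph `G` on a Hilbert space: the complement of
the set of all `z` for which `G - z` has an everywhere defined bounded inverse `R`. -/
def graphSpectrum {H : Type*} [NormedAddCommGroup H] [NormedSpace ℂ H] (G : H → H → Prop) :
    Set ℂ :=
  {z | ¬ ∃ R : H →L[ℂ] H, (∀ w, G (R w) (w + z • R w)) ∧ ∀ u v, G u v → R (v - z • u) = u}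

/-! ## The dual lattice, the quadratic form and the eigenfunctions -/

/-- `ω_1, ω_2` is a `ℤ`-basis of the dual lattice
`2π𝓛* = {v : ⟨v, ℓ⟩ ∈ 2πℤ for all ℓ ∈ 𝓛}`. -/
def IsDualBasis (b : Module.Basis (Fin 2) ℝ (Fin 2 → ℝ)) (ω : Fin 2 → Fin 2 → ℝ) : Prop :=
  LinearIndependent ℤ ω ∧
  ∀ v : Fin 2 → ℝ, v ∈ Submodule.span ℤ (Set.range ω) ↔
    ∀ ℓ ∈ lattice b, ∃ n : ℤ, v ⬝ᵥ ℓ = 2 * Real.pi * n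

/-- The vector `k_1 ω_1 + k_2 ω_2`. -/
def dualVector (ω : Fin 2 → Fin 2 → ℝ) (k : Fin 2 → ℤ) (j : Fin 2) : ℝ :=
  ∑ i, (k i : ℝ) * ω i j

/-- `(k, Ωq)`. -/
def phase (ω : Fin 2 → Fin 2 → ℝ) (k : Fin 2 → ℤ) (q : Fin 3 → ℝ) : ℝ :=
  dualVector ω k 0 * q 1 + dualVector ω k 1 * q 2

/-- The quadratic form of the lattice, `Q(k) = |k_1 ω_1 + k_2 ω_2|²`. -/
def quadForm (ω : Fin 2 → Fin 2 → ℝ) (k : Fin 2 → ℤ) : ℝ :=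
  dualVector ω k 0 ^ 2 + dualVector ω k 1 ^ 2

/-- The angle `α(k)` with `k_1 ω_1 + k_2 ω_2 = √Q(k) (cos α, sin α)`. -/
def shift (ω : Fin 2 → Fin 2 → ℝ) (k : Fin 2 → ℤ) : ℝ :=
  Complex.arg ⟨dualVector ω k 0, dualVector ω k 1⟩

/-- `μ(k) = (B-1) Q(k) / (2A)`. -/
def mathieuParam (A B : ℝ) (ω : Fin 2 → Fin 2 → ℝ) (k : Fin 2 → ℤ) : ℝ :=
  (B - 1) * quadForm ω k / (2 * A)

/-- The labels of the eigenfunctions: `m ∈ ℤ`, and `(k, l)` with `k ∈ ℤ² ∖ {0}`, `l ≥ 0`. -/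
abbrev Label : Type := ℤ ⊕ ({k : Fin 2 → ℤ // k ≠ 0} × ℕ)

/-- The eigenfunctions in the coordinates `q`: `e^{i m q_0}` and
`e^{i (k, Ωq)} φ_l(q_0 + α(k), μ(k))`. -/
def eigenfunction (A B : ℝ) (ω : Fin 2 → Fin 2 → ℝ) (φ : ℝ → ℕ → ℝ → ℝ) :
    Label → (Fin 3 → ℝ) → ℂ
  | Sum.inl m, q => Complex.exp (Complex.I * m * q 0)
  | Sum.inr (k, l), q => Complex.exp (Complex.I * phase ω k q) *
      φ (mathieuParam A B ω k) l (q 0 + shift ω k)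

/-- The eigenvalues: `A m²` and `A λ_l(μ(k)) + (B+1) Q(k) / 2`. -/
def eigenvalue (A B : ℝ) (ω : Fin 2 → Fin 2 → ℝ) : Label → ℝ
  | Sum.inl m => A * (m : ℝ) ^ 2
  | Sum.inr (k, l) => A * mathieuEigenvalue (mathieuParam A B ω k) l +
      (B + 1) * quadForm ω k / 2

/-- `Spec_0 = {A m² : m ≥ 0}`. -/
def spec0 (A : ℝ) : Set ℝ := {E | ∃ m : ℕ, E = A * (m : ℝ) ^ 2}

/-- `Spec_M = {A λ_l(μ) + (B+1) Q(k) / 2 : k ≠ 0, l ≥ 0}` with `μ = (B-1) Q(k) / (2A)`. -/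
def specM (A B : ℝ) (ω : Fin 2 → Fin 2 → ℝ) : Set ℝ :=
  {E | ∃ k : Fin 2 → ℤ, k ≠ 0 ∧ ∃ l : ℕ,
    E = A * mathieuEigenvalue ((B - 1) * quadForm ω k / (2 * A)) l + (B + 1) * quadForm ω k / 2}

/-- The vector field `cos q_0 ∂_1 - sin q_0 ∂_2`. -/
def fieldX1 (f : (Fin 3 → ℝ) → ℂ) (q : Fin 3 → ℝ) : ℂ :=
  (Real.cos (q 0) : ℂ) * partialDeriv 1 f q - (Real.sin (q 0) : ℂ) * partialDeriv 2 f q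

end Bianchi

end

/-!
The metric has constant volume density, so in coordinates the Laplace-Beltrami operator is
`Δ = A ∂₀² + ∂₁² + ∂₂² + (B - 1) X²` with `X = cos q₀ ∂₁ - sin q₀ ∂₂` (`laplaceBeltrami_metric`).
Its coefficients depend on `q₀` only. On a function `e^{i⟨v, (q₁, q₂)⟩} g(q₀)` it therefore acts as
an ordinary differential operator on `g` (`explicitLaplacian_wave`); for `v = k₁ ω₁ + k₂ ω₂` the
potential is `(B - 1) Q(k) cos²(q₀ + α(k))` up to a constant, and `2 cos² = 1 + cos 2` turns the
eigenvalue equation into Mathieu's equation (`explicitLaplacian_eigenfunction`).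

**Mathieu functions.** In the Hartley basis `cas(nx) = cos(nx) + sin(nx)`, `n ∈ ℤ`, of the real
`2π`-periodic functions, Mathieu's equation is the three-term recursion
`n² fₙ + (μ/2) (fₙ₊₂ + fₙ₋₂) = λ fₙ` on `ℓ²(ℤ)`. Its resolvent at `-|μ| - 1` is compact and
symmetric, so there is a Hilbert basis of eigenvectors (`exists_hilbertBasis_isMathieuSeq`), and an
energy estimate shows that only finitely many eigenvalues lie below any bound
(`finite_le_of_isMathieuSeq`). The recursion makes the coefficients of an eigenvector decay so fast
that its Hartley series is a classical solution (`IsMathieuSeq.hartleySum_mem`). The eigenspaces are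
spanned by these solutions, which identifies the eigenvalues with the numbers defined through the
dimensions of the eigenspaces (`IsMathieuBasis.mathieuEigenvalue_eq`). Comparing dimensions, every
system of Mathieu functions spans the same eigenspaces and so is complete
(`IsMathieuSystem.exists_span_near`).

**The basis.** The eigenfunctions are orthogonal: for different frequencies `k` because some
translation of the torus multiplies the integrand by `-1`, for equal frequencies because the Mathieu
functions are orthogonal. The characters of the torus span a dense subspace by the Stone-Weierstrass
theorem, and each of them is an `L²`-limit of combinations of eigenfunctions of the same frequency
(`eq_zero_of_inner_eigenElement_eq_zero`), whence completeness.

**The spectrum.** Integration by parts makes `-Δ`, in the sense of distributions, diagonal in this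
basis (`negLaplacianGraph_iff_repr`). Since `λ_l(μ) ≥ -|μ|`, the eigenvalues of frequency `k` are at
least `min B 1 * Q(k)`, so they do not accumulate (`finite_eigenvalue_le`), and the spectrum is the
set of eigenvalues (`graphSpectrum_eq_image_range`).
-/

noncomputable section

namespace Bianchi

open Filter Topology
open scoped ENNReal

/-! ### Sequence spaces and operators on them -/

section

/-- A function with finite sublevel sets on an infinite type can be listed in increasing order. -/
theorem exists_equiv_nat_monotone {ι : Type*} [Infinite ι] (f : ι → ℝ)
    (hf : ∀ c, {i | f i ≤ c}.Finite) : ∃ σ : ℕ ≃ ι, Monotone (f ∘ σ) := by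
  classical
  have hc : Countable ι := by
    rw [← Set.countable_univ_iff]
    have h : (Set.univ : Set ι) = ⋃ n : ℕ, {i | f i ≤ n} := by
      ext i
      simpa using exists_nat_ge (f i)
    rw [h]
    exact Set.countable_iUnion fun n => (hf n).countable
  obtain ⟨enc, henc⟩ := exists_injective_nat ι
  -- order `ι` by `f`, breaking ties by an enumeration; the result is isomorphic to `ℕ`
  let key : ι → ℝ ×ₗ ℕ := fun i => toLex (f i, enc i)
  have hkey : Function.Injective key := fun i j h =>
    henc (by simpa [key] using congrArg (fun x => (ofLex x).2) h)
  let _ : LinearOrder ι := LinearOrder.lift' key hkey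
  have hle : ∀ {i j : ι}, i ≤ j → f i ≤ f j := fun {i j} h => by
    have h' : key i ≤ key j := h
    rw [Prod.Lex.le_iff] at h'
    rcases h' with h' | h'
    · exact h'.le
    · exact h'.1.le
  have hfin : ∀ j : ι, (Set.Iic j).Finite := fun j => (hf (f j)).subset fun i hi => hle hi
  let _ : LocallyFiniteOrder ι :=
    LocallyFiniteOrder.ofFiniteIcc fun a b => (hfin b).subset fun i hi => hi.2
  let _ : SuccOrder ι := LinearLocallyFiniteOrder.succOrder ι
  let _ : PredOrder ι := LinearLocallyFiniteOrder.predOrder ι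
  have _ : NoMaxOrder ι := ⟨fun a => by
    by_contra! h
    exact Set.infinite_univ ((hfin a).subset fun i _ => h i)⟩
  let _ : OrderBot ι :=
    { bot := (Set.exists_min_image (Set.Iic (Classical.arbitrary ι)) id (hfin _)
        ⟨Classical.arbitrary ι, Set.mem_Iic.2 le_rfl⟩).choose
      bot_le := fun i => by
        obtain ⟨h1, h2⟩ := (Set.exists_min_image (Set.Iic (Classical.arbitrary ι)) id (hfin _)
          ⟨Classical.arbitrary ι, Set.mem_Iic.2 le_rfl⟩).choose_spec
        rcases le_total i (Classical.arbitrary ι) with h | h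
        · exact h2 i h
        · exact h1.trans h }
  exact ⟨orderIsoNatOfLinearSuccPredArch.symm.toEquiv, fun m n h =>
    hle ((orderIsoNatOfLinearSuccPredArch (ι := ι)).symm.monotone h)⟩

/-- The Hilbert space of real square-summable sequences indexed by `ℤ`. -/
abbrev SeqL2 : Type := lp (fun _ : ℤ => ℝ) 2

theorem memℓp_two_iff (f : ℤ → ℝ) : Memℓp f 2 ↔ Summable fun n => f n ^ 2 := by
  rw [memℓp_gen_iff (by simp)]
  simp

theorem SeqL2.hasSum_sq (f : SeqL2) : HasSum (fun n => f n ^ 2) (‖f‖ ^ 2) := by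
  have h := lp.hasSum_norm (p := 2) (by simp) f
  simpa using h

theorem norm_mul_apply_le {ι 𝕜 : Type*} [RCLike 𝕜] {w : ι → 𝕜} {C : ℝ} (hC : 0 ≤ C)
    (hw : ∀ n, ‖w n‖ ≤ C) (f : lp (fun _ : ι => 𝕜) 2) (n : ι) :
    ‖w n * f n‖ ≤ ‖((C : 𝕜) • f) n‖ := by
  rw [lp.coeFn_smul, Pi.smul_apply, norm_mul, norm_smul, RCLike.norm_of_nonneg hC]
  exact mul_le_mul_of_nonneg_right (hw n) (norm_nonneg _)

/-- The operator on `ℓ²(ι, 𝕜)` multiplying the `n`-th coordinate by `w n`, for bounded `w`. -/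
def diagOp {ι 𝕜 : Type*} [RCLike 𝕜] (w : ι → 𝕜) (C : ℝ) (hC : 0 ≤ C) (hw : ∀ n, ‖w n‖ ≤ C) :
    lp (fun _ : ι => 𝕜) 2 →L[𝕜] lp (fun _ : ι => 𝕜) 2 :=
  LinearMap.mkContinuous
    { toFun := fun f =>
        ⟨fun n => w n * f n, (lp.memℓp ((C : 𝕜) • f)).mono' (norm_mul_apply_le hC hw f)⟩
      map_add' := fun f g => by ext n; exact mul_add _ _ _
      map_smul' := fun c f => by ext n; exact mul_left_comm _ _ _ } C fun f => by
    have h : ‖(C : 𝕜) • f‖ = C * ‖f‖ := by rw [norm_smul, RCLike.norm_of_nonneg hC]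
    rw [← h]
    exact lp.norm_mono (by simp) (norm_mul_apply_le hC hw f)

@[simp] theorem diagOp_apply {ι 𝕜 : Type*} [RCLike 𝕜] (w : ι → 𝕜) (C : ℝ) (hC : 0 ≤ C)
    (hw : ∀ n, ‖w n‖ ≤ C) (f : lp (fun _ : ι => 𝕜) 2) (n : ι) :
    diagOp w C hC hw f n = w n * f n := rfl

theorem norm_diagOp_le {ι 𝕜 : Type*} [RCLike 𝕜] (w : ι → 𝕜) (C : ℝ) (hC : 0 ≤ C)
    (hw : ∀ n, ‖w n‖ ≤ C) : ‖diagOp w C hC hw‖ ≤ C := LinearMap.mkContinuous_norm_le _ hC _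

/-- The shift `f ↦ f (· + k)` on `ℓ²(ℤ)`. -/
def shiftOp (k : ℤ) : SeqL2 →L[ℝ] SeqL2 :=
  LinearMap.mkContinuous
    { toFun := fun f => ⟨fun n => f (n + k), (memℓp_two_iff _).2
        ((SeqL2.hasSum_sq f).summable.comp_injective (add_left_injective k))⟩
      map_add' := fun f g => by ext n; rfl
      map_smul' := fun c f => by ext n; rfl } 1 fun f => by
    rw [one_mul]
    refine le_of_eq ?_
    rw [← sq_eq_sq₀ (norm_nonneg _) (norm_nonneg _)]
    refine HasSum.unique (SeqL2.hasSum_sq _) ?_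
    exact (Equiv.addRight k).hasSum_iff.2 f.hasSum_sq

@[simp] theorem shiftOp_apply (k : ℤ) (f : SeqL2) (n : ℤ) : shiftOp k f n = f (n + k) := rfl

theorem norm_shiftOp_le (k : ℤ) : ‖shiftOp k‖ ≤ 1 :=
  LinearMap.mkContinuous_norm_le _ zero_le_one _

theorem SeqL2.hasSum_mul (f g : SeqL2) : HasSum (fun n => f n * g n) (inner ℝ f g) := by
  simpa [mul_comm] using lp.hasSum_inner (𝕜 := ℝ) f g

theorem inner_shiftOp (k : ℤ) (f g : SeqL2) :
    inner ℝ (shiftOp k f) g = inner ℝ f (shiftOp (-k) g) := by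
  refine (SeqL2.hasSum_mul _ _).unique ?_
  have h := (Equiv.addRight k).hasSum_iff.2 (SeqL2.hasSum_mul f (shiftOp (-k) g))
  simpa [Function.comp_def] using h

theorem inner_diagOp (w : ℤ → ℝ) (C : ℝ) (hC : 0 ≤ C) (hw : ∀ n, ‖w n‖ ≤ C) (f g : SeqL2) :
    inner ℝ (diagOp w C hC hw f) g = inner ℝ f (diagOp w C hC hw g) := by
  refine (SeqL2.hasSum_mul _ _).unique ?_
  convert SeqL2.hasSum_mul f (diagOp w C hC hw g) using 2 with n
  simp; ring

/-- Multiplication by `μ cos 2x`, acting on Hartley coefficients. -/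
def potentialOp (μ : ℝ) : SeqL2 →L[ℝ] SeqL2 := (μ / 2) • (shiftOp 2 + shiftOp (-2))

theorem potentialOp_apply (μ : ℝ) (f : SeqL2) (n : ℤ) :
    potentialOp μ f n = μ / 2 * (f (n + 2) + f (n - 2)) := by
  change μ / 2 * (f (n + 2) + f (n + -2)) = _
  rw [sub_eq_add_neg]

theorem norm_potentialOp_le (μ : ℝ) : ‖potentialOp μ‖ ≤ |μ| := by
  rw [potentialOp, norm_smul, Real.norm_eq_abs, abs_div, abs_two]
  have := norm_add_le (shiftOp 2) (shiftOp (-2))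
  have h1 := norm_shiftOp_le 2
  have h2 := norm_shiftOp_le (-2)
  nlinarith [abs_nonneg μ]

theorem inner_potentialOp (μ : ℝ) (f g : SeqL2) :
    inner ℝ (potentialOp μ f) g = inner ℝ f (potentialOp μ g) := by
  simp only [potentialOp, smul_apply, add_apply,
    inner_smul_left, inner_smul_right, inner_add_left, inner_add_right, inner_shiftOp]
  simp [add_comm]

/-- A diagonal operator whose entries tend to `0` is the norm limit of its finite sections. -/
theorem isCompactOperator_diagOp (w : ℤ → ℝ) (C : ℝ) (hC : 0 ≤ C) (hw : ∀ n, ‖w n‖ ≤ C)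
    (hlim : Tendsto w cofinite (𝓝 0)) : IsCompactOperator (diagOp w C hC hw) := by
  classical
  have hfin : ∀ s : Finset ℤ, IsCompactOperator
      (∑ n ∈ s, ((innerSL ℝ (lp.single 2 n (1 : ℝ) : SeqL2)).smulRight
        (lp.single 2 n (w n) : SeqL2)) : SeqL2 →L[ℝ] SeqL2) := by
    intro s
    refine Submodule.sum_mem (compactOperator (RingHom.id ℝ) SeqL2 SeqL2) fun n _ => ?_
    have h : IsCompactOperator (ContinuousLinearMap.smulRight (1 : ℝ →L[ℝ] ℝ)
      (lp.single 2 n (w n) : SeqL2)) := isCompactOperator_of_locallyCompactSpace_rng _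
    have h2 := h.comp_clm (innerSL ℝ (lp.single 2 n (1 : ℝ) : SeqL2))
    change IsCompactOperator _
    convert h2 using 1
    ext f m
    simp
  refine isCompactOperator_of_tendsto (l := atTop) (F := fun s : Finset ℤ =>
      (∑ n ∈ s, ((innerSL ℝ (lp.single 2 n (1 : ℝ) : SeqL2)).smulRight
        (lp.single 2 n (w n) : SeqL2)) : SeqL2 →L[ℝ] SeqL2)) ?_ (Eventually.of_forall hfin)
  rw [Metric.tendsto_atTop]
  intro ε hε
  have hs : {n | ¬ |w n| < ε / 2}.Finite := by
    have := (Metric.tendsto_nhds.1 hlim) (ε / 2) (half_pos hε)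
    rw [Filter.eventually_cofinite] at this
    simpa only [Real.dist_eq, sub_zero] using this
  refine ⟨hs.toFinset, fun s hsub => ?_⟩
  rw [dist_comm, dist_eq_norm]
  refine lt_of_le_of_lt ?_ (half_lt_self hε)
  refine ContinuousLinearMap.opNorm_le_bound _ (half_pos hε).le fun f => ?_
  have h : ‖(ε / 2) • f‖ = ε / 2 * ‖f‖ := by rw [norm_smul, Real.norm_of_nonneg (half_pos hε).le]
  rw [← h]
  refine lp.norm_mono (by simp) fun m => ?_
  have hval : (diagOp w C hC hw - ∑ n ∈ s, ((innerSL ℝ (lp.single 2 n (1 : ℝ) : SeqL2)).smulRight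
        (lp.single 2 n (w n) : SeqL2))) f m = if m ∈ s then 0 else w m * f m := by
    have : (∑ n ∈ s, f n • (lp.single 2 n (w n) : SeqL2)) m = if m ∈ s then f m * w m else 0 := by
      rw [lp.coeFn_sum, Finset.sum_apply]
      simp [lp.single_apply, Pi.single_apply]
    simp only [sub_apply, sum_apply,
      ContinuousLinearMap.smulRight_apply, lp.coeFn_sub, Pi.sub_apply, diagOp_apply,
      innerSL_apply_apply, lp.inner_single_left]
    simp only [RCLike.inner_apply, conj_trivial, mul_one]
    rw [this]
    split_ifs <;> ring
  rw [hval]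
  split_ifs with hm
  · simp only [norm_zero]
    positivity
  · have : |w m| < ε / 2 := by
      by_contra hcon
      exact hm (hsub (by simpa using hcon))
    simpa [abs_mul, abs_of_pos hε] using mul_le_mul_of_nonneg_right this.le (abs_nonneg (f m))

end

/-! ### Compact resolvents and the spectral theorem -/

section

/-- Hilbert bases of closed, mutually orthogonal subspaces with dense sum combine to a Hilbert basis
of the whole space. -/
theorem exists_hilbertBasis_of_orthogonalFamily.{u} {H : Type u} [NormedAddCommGroup H]
    [InnerProductSpace ℝ H] [CompleteSpace H] (G : ℝ → Submodule ℝ H)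
    (hG : OrthogonalFamily ℝ (fun t => G t) fun t => (G t).subtypeₗᵢ)
    (hc : ∀ t, IsClosed (G t : Set H)) (hbot : (⨆ t, G t)ᗮ = ⊥) :
    ∃ (ι : Type u) (e : HilbertBasis ι ℝ H) (τ : ι → ℝ), ∀ i, e i ∈ G (τ i) := by
  have hcs : ∀ t, CompleteSpace (G t) := fun t => (hc t).completeSpace_coe
  choose w b hb using fun t => exists_hilbertBasis ℝ (G t)
  have hon := hG.orthonormal_sigma_orthonormal (fun t => (b t).orthonormal)
  refine ⟨Σ t, w t, HilbertBasis.mkOfOrthogonalEqBot hon ?_, fun a => a.1, fun a => ?_⟩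
  · rw [eq_bot_iff, ← hbot]
    intro u hu
    rw [Submodule.mem_orthogonal] at hu
    rw [← Submodule.iInf_orthogonal, Submodule.mem_iInf]
    intro t
    -- the functional `⟪u, ·⟫` on `G t` vanishes on a Hilbert basis, hence everywhere
    have hz : (G t).subtypeL.adjoint u = 0 := by
      rw [← (b t).repr.map_eq_zero_iff]
      ext i
      rw [HilbertBasis.repr_apply_apply, ContinuousLinearMap.adjoint_inner_right]
      exact hu _ (Submodule.subset_span ⟨⟨t, i⟩, rfl⟩)
    rw [Submodule.mem_orthogonal]
    intro x hx
    have := ContinuousLinearMap.adjoint_inner_right (G t).subtypeL ⟨x, hx⟩ u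
    rw [hz, inner_zero_right] at this
    exact this.symm
  · rw [HilbertBasis.coe_mkOfOrthogonalEqBot]
    exact (b a.1 a.2).2

/-- A compact symmetric operator on a Hilbert space has a Hilbert basis of eigenvectors. -/
theorem exists_hilbertBasis_eigenvectors.{u} {H : Type u} [NormedAddCommGroup H]
    [InnerProductSpace ℝ H] [CompleteSpace H] (T : H →L[ℝ] H) (hT : IsCompactOperator T)
    (hsym : (T : H →ₗ[ℝ] H).IsSymmetric) :
    ∃ (ι : Type u) (e : HilbertBasis ι ℝ H) (τ : ι → ℝ), ∀ i, T (e i) = τ i • e i := by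
  obtain ⟨ι, e, τ, h⟩ := exists_hilbertBasis_of_orthogonalFamily
    (fun t => Module.End.eigenspace (T : H →ₗ[ℝ] H) t) hsym.orthogonalFamily_eigenspaces
    (fun t => ContinuousLinearMap.isClosed_eigenspace T t)
    (ContinuousLinearMap.orthogonalComplement_iSup_eigenspaces_eq_bot hT hsym)
  exact ⟨ι, e, τ, fun i => Module.End.mem_eigenspace_iff.1 (h i)⟩

/-- The sequence space equation `n² f_n + (μ/2) (f_{n+2} + f_{n-2}) = lam f_n` satisfied by the
Hartley coefficients of a solution of the Mathieu equation. -/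
def IsMathieuSeq (μ lam : ℝ) (f : ℤ → ℝ) : Prop :=
  ∀ n : ℤ, (n : ℝ) ^ 2 * f n + μ / 2 * (f (n + 2) + f (n - 2)) = lam * f n

/-- If `R` is the inverse of a symmetric operator `D`, then `T = (1 + R V)⁻¹ R` is the inverse of
`D + V`. It is compact with `R`, and symmetric because it is also equal to `R (1 + V R)⁻¹`. -/
theorem exists_resolvent_add {H : Type*} [NormedAddCommGroup H] [InnerProductSpace ℝ H]
    [CompleteSpace H] (R V : H →L[ℝ] H) (hR : ∀ f g, inner ℝ (R f) g = inner ℝ f (R g))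
    (hV : ∀ f g, inner ℝ (V f) g = inner ℝ f (V g)) (hRV : ‖R * V‖ < 1) (hVR : ‖V * R‖ < 1)
    (hc : IsCompactOperator R) :
    ∃ T : H →L[ℝ] H, IsCompactOperator T ∧ (T : H →ₗ[ℝ] H).IsSymmetric ∧
      ∀ f, T f + R (V (T f)) = R f := by
  let U : (H →L[ℝ] H)ˣ := Units.oneSub (-(R * V)) (by rwa [norm_neg])
  let W : (H →L[ℝ] H)ˣ := Units.oneSub (-(V * R)) (by rwa [norm_neg])
  have hU : (U : H →L[ℝ] H) = 1 + R * V := by simp [U]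
  have hW : (W : H →L[ℝ] H) = 1 + V * R := by simp [W]
  have hUR : (U : H →L[ℝ] H) * R = R * W := by rw [hU, hW]; noncomm_ring
  have hT : (↑U⁻¹ : H →L[ℝ] H) * R = R * (↑W⁻¹ : H →L[ℝ] H) := by
    rw [Units.inv_mul_eq_iff_eq_mul, ← mul_assoc, hUR, mul_assoc, Units.mul_inv, mul_one]
  have hWf : ∀ f, (W : H →L[ℝ] H) ((↑W⁻¹ : H →L[ℝ] H) f) = f := fun f => by
    rw [← mul_apply_eq_comp, Units.mul_inv, one_apply_eq_self]
  refine ⟨(↑U⁻¹ : H →L[ℝ] H) * R, hc.clm_comp _, ?_, ?_⟩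
  · intro f g
    rw [hT]
    change inner ℝ (R ((↑W⁻¹ : H →L[ℝ] H) f)) g = inner ℝ f (R ((↑W⁻¹ : H →L[ℝ] H) g))
    conv_lhs => rw [← hWf g]
    conv_rhs => rw [← hWf f]
    rw [hW]
    simp only [add_apply, one_apply_eq_self, mul_apply_eq_comp, inner_add_left,
      inner_add_right, map_add, hR, hV]
  · intro f
    have : (U : H →L[ℝ] H) * ((↑U⁻¹ : H →L[ℝ] H) * R) = R := by
      rw [← mul_assoc, Units.mul_inv, one_mul]
    have h2 := congrArg (fun S : H →L[ℝ] H => S f) this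
    simpa [hU] using h2

theorem tendsto_inv_sq_add_cofinite (c : ℝ) :
    Tendsto (fun n : ℤ => ((n : ℝ) ^ 2 + c)⁻¹) cofinite (𝓝 0) := by
  refine tendsto_inv_atTop_zero.comp (tendsto_atTop_add_const_right _ c ?_)
  have h : Tendsto (fun n : ℤ => |(n : ℝ)|) cofinite atTop := by
    rw [Int.cofinite_eq]
    refine Tendsto.sup ?_ ?_
    · exact tendsto_abs_atBot_atTop.comp (tendsto_intCast_atBot_iff.2 tendsto_id)
    · exact tendsto_abs_atTop_atTop.comp tendsto_intCast_atTop_atTop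
  simpa only [Function.comp_def, sq_abs] using (tendsto_pow_atTop two_ne_zero).comp h

/-- The sequence space has a Hilbert basis of solutions of the Mathieu recursion. -/
theorem exists_hilbertBasis_isMathieuSeq (μ : ℝ) :
    ∃ (ι : Type) (e : HilbertBasis ι ℝ SeqL2) (a : ι → ℝ), ∀ i, IsMathieuSeq μ (a i) (e i) := by
  -- the potential has norm at most `|μ| < c`, so the Neumann series for the resolvent converges
  set c : ℝ := |μ| + 1 with hc
  have hμ := abs_nonneg μ
  have hc0 : 0 < c := by positivity
  have hpos : ∀ n : ℤ, 0 < (n : ℝ) ^ 2 + c := fun n => by positivity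
  have hw : ∀ n : ℤ, |((n : ℝ) ^ 2 + c)⁻¹| ≤ c⁻¹ := fun n => by
    rw [abs_of_pos (inv_pos.2 (hpos n))]
    exact inv_anti₀ hc0 (by nlinarith [sq_nonneg (n : ℝ)])
  let R := diagOp (fun n : ℤ => ((n : ℝ) ^ 2 + c)⁻¹) c⁻¹ (inv_pos.2 hc0).le hw
  have hRn : ‖R‖ ≤ c⁻¹ := norm_diagOp_le _ _ _ _
  have hVn := norm_potentialOp_le μ
  have hlt : c⁻¹ * |μ| < 1 := by
    rw [inv_mul_lt_iff₀ hc0]; linarith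
  have hprod : ‖R‖ * ‖potentialOp μ‖ < 1 :=
    (mul_le_mul hRn hVn (norm_nonneg _) (inv_pos.2 hc0).le).trans_lt hlt
  obtain ⟨T, hTc, hTs, hT⟩ := exists_resolvent_add R (potentialOp μ) (inner_diagOp _ _ _ _)
    (inner_potentialOp μ) ((norm_mul_le _ _).trans_lt hprod)
    ((norm_mul_le _ _).trans_lt (by rwa [mul_comm]))
    (isCompactOperator_diagOp _ _ _ _ (tendsto_inv_sq_add_cofinite c))
  obtain ⟨ι, e, τ, he⟩ := exists_hilbertBasis_eigenvectors T hTc hTs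
  refine ⟨ι, e, fun i => (τ i)⁻¹ - c, fun i n => ?_⟩
  have h : ∀ m : ℤ, τ i * (e i m) + ((m : ℝ) ^ 2 + c)⁻¹ * (τ i * potentialOp μ (e i) m) =
      ((m : ℝ) ^ 2 + c)⁻¹ * e i m := fun m => by
    have := congrArg (fun x : SeqL2 => x m) (hT (e i))
    rw [he i, map_smul] at this
    exact this
  have hτ : τ i ≠ 0 := by
    intro h0
    have : e i = 0 := by
      ext m
      have hm := h m
      rw [h0] at hm
      simpa [(hpos m).ne'] using hm.symm
    exact (e.orthonormal.ne_zero i) this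
  have hn := h n
  rw [potentialOp_apply] at hn
  have := (hpos n).ne'
  field_simp at hn ⊢
  linear_combination hn

end

/-! ### Eigenvalue asymptotics in the sequence space -/

section

/-- The energy identity `∑ n² f_n² = lam ‖f‖² - ⟪V f, f⟫`. -/
theorem IsMathieuSeq.hasSum_sq_mul_sq {μ lam : ℝ} {f : SeqL2} (h : IsMathieuSeq μ lam f) :
    HasSum (fun n : ℤ => (n : ℝ) ^ 2 * f n ^ 2) (lam * ‖f‖ ^ 2 - inner ℝ (potentialOp μ f) f) := by
  refine (((SeqL2.hasSum_sq f).mul_left lam).sub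
    (SeqL2.hasSum_mul (potentialOp μ f) f)).congr_fun ?_
  intro n
  rw [potentialOp_apply]
  linear_combination f n * h n

theorem abs_inner_potentialOp_le (μ : ℝ) (f : SeqL2) :
    |inner ℝ (potentialOp μ f) f| ≤ |μ| * ‖f‖ ^ 2 := by
  calc |inner ℝ (potentialOp μ f) f| ≤ ‖potentialOp μ f‖ * ‖f‖ := abs_real_inner_le_norm _ _
    _ ≤ (|μ| * ‖f‖) * ‖f‖ := by
      gcongr
      exact (ContinuousLinearMap.le_opNorm _ _).trans (by gcongr; exact norm_potentialOp_le μ)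
    _ = _ := by ring

theorem IsMathieuSeq.neg_abs_le {μ lam : ℝ} {f : SeqL2} (h : IsMathieuSeq μ lam f) (hf : f ≠ 0) :
    -|μ| ≤ lam := by
  have h1 : 0 ≤ lam * ‖f‖ ^ 2 - inner ℝ (potentialOp μ f) f :=
    h.hasSum_sq_mul_sq.nonneg fun n => by positivity
  have h2 := (abs_le.1 (abs_inner_potentialOp_le μ f)).1
  have h3 : 0 < ‖f‖ ^ 2 := by positivity
  by_contra hcon
  nlinarith

/-- Low-energy solutions have at least half of their mass on bounded frequencies. -/
theorem IsMathieuSeq.half_le_sum {μ lam Λ : ℝ} {f : SeqL2} (h : IsMathieuSeq μ lam f)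
    (hf : ‖f‖ = 1) (hΛ : lam ≤ Λ) {N : ℕ} (hN : 2 * (Λ + |μ|) ≤ (N : ℝ)) :
    1 / 2 ≤ ∑ n ∈ Finset.Icc (-(N : ℤ)) N, f n ^ 2 := by
  have hE := h.hasSum_sq_mul_sq
  have h2 := (abs_le.1 (abs_inner_potentialOp_le μ f)).1
  have hS := SeqL2.hasSum_sq f
  rw [hf] at hE h2 hS
  set s := Finset.Icc (-(N : ℤ)) N with hs
  -- off the window, `f n ^ 2` is dominated by `n ^ 2 * f n ^ 2 / (N + 1)`
  have hle : ∀ n : ℤ, f n ^ 2 - (if n ∈ s then f n ^ 2 else 0) ≤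
      (N + 1 : ℝ)⁻¹ * ((n : ℝ) ^ 2 * f n ^ 2) := by
    intro n
    split_ifs with hn
    · rw [sub_self]; positivity
    · have hn' : (N + 1 : ℝ) ≤ (n : ℝ) ^ 2 := by
        have : (N : ℤ) + 1 ≤ n ^ 2 := by
          rw [hs, Finset.mem_Icc, not_and_or] at hn
          rcases hn with hn | hn <;> nlinarith
        exact_mod_cast this
      rw [sub_zero, ← mul_assoc]
      refine le_mul_of_one_le_left (sq_nonneg _) ?_
      rw [inv_mul_eq_div, one_le_div (by positivity)]
      exact hn'
  have hsum : HasSum (fun n => if n ∈ s then f n ^ 2 else 0) (∑ n ∈ s, f n ^ 2) := by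
    rw [← Finset.sum_congr rfl (fun n (hn : n ∈ s) => if_pos (α := ℝ) (e := 0) hn)]
    exact hasSum_sum_of_ne_finset_zero fun n hn => by simp [hn]
  have hfin := hasSum_le hle (hS.sub hsum) (hE.mul_left _)
  have hb : (N + 1 : ℝ)⁻¹ * (lam * 1 ^ 2 - inner ℝ (potentialOp μ f) f) ≤ 1 / 2 := by
    rw [inv_mul_le_iff₀ (by positivity)]
    linarith
  linarith

/-- Orthonormal vectors which have half of their mass in a window of `2N + 1` frequencies number at
most `2 (2N + 1)`, by Bessel's inequality for the unit vectors in the window. -/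
theorem finite_le_of_isMathieuSeq {ι : Type*} {μ : ℝ} {e : ι → SeqL2} (he : Orthonormal ℝ e)
    {a : ι → ℝ} (ha : ∀ i, IsMathieuSeq μ (a i) (e i)) (Λ : ℝ) : {i | a i ≤ Λ}.Finite := by
  obtain ⟨N, hN⟩ := exists_nat_ge (2 * (Λ + |μ|))
  by_contra hinf
  obtain ⟨S, hS, hcard⟩ := Set.Infinite.exists_subset_card_eq hinf (2 * (2 * N + 1) + 1)
  have h1 : (S.card : ℝ) * (1 / 2) ≤ ∑ i ∈ S, ∑ n ∈ Finset.Icc (-(N : ℤ)) N, e i n ^ 2 := by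
    rw [← nsmul_eq_mul]
    exact Finset.card_nsmul_le_sum _ _ _ fun i hi =>
      (ha i).half_le_sum (he.norm_eq_one i) (hS hi) hN
  have h2 : ∑ i ∈ S, ∑ n ∈ Finset.Icc (-(N : ℤ)) N, e i n ^ 2 ≤ (2 * N + 1 : ℝ) := by
    rw [Finset.sum_comm]
    have h3 : ∀ n ∈ Finset.Icc (-(N : ℤ)) N, ∑ i ∈ S, e i n ^ 2 ≤ 1 := fun n _ => by
      have := he.sum_inner_products_le (lp.single 2 n (1 : ℝ) : SeqL2) (s := S)
      simpa [lp.norm_single, lp.inner_single_right] using this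
    refine (Finset.sum_le_card_nsmul _ _ _ h3).trans (le_of_eq ?_)
    have hc : (Finset.Icc (-(N : ℤ)) N).card = 2 * N + 1 := by
      rw [Int.card_Icc]; omega
    rw [hc, nsmul_eq_mul]
    push_cast; ring
  rw [hcard] at h1
  push_cast at h1
  linarith

theorem infinite_of_hilbertBasis_seqL2 {ι : Type*} (e : HilbertBasis ι ℝ SeqL2) : Infinite ι := by
  by_contra hfin
  rw [not_infinite_iff_finite] at hfin
  have := Fintype.ofFinite ι
  have hfd : FiniteDimensional ℝ SeqL2 := e.toOrthonormalBasis.toBasis.finiteDimensional_of_finite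
  have hon : Orthonormal ℝ fun n : ℤ => (lp.single 2 n (1 : ℝ) : SeqL2) := by
    rw [orthonormal_iff_ite]
    intro i j
    rw [lp.inner_single_left]
    simp [lp.single_apply, Pi.single_apply]
  have := hon.linearIndependent.finite
  exact not_finite ℤ

/-- The spectral theorem for the Mathieu operator, in terms of Hartley coefficients. -/
theorem exists_monotone_hilbertBasis_isMathieuSeq (μ : ℝ) :
    ∃ (e : HilbertBasis ℕ ℝ SeqL2) (a : ℕ → ℝ), Monotone a ∧ (∀ c, {l | a l ≤ c}.Finite) ∧
      ∀ l, IsMathieuSeq μ (a l) (e l) := by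
  obtain ⟨ι, e, a, h⟩ := exists_hilbertBasis_isMathieuSeq μ
  have := infinite_of_hilbertBasis_seqL2 e
  have hfin := finite_le_of_isMathieuSeq e.orthonormal h
  obtain ⟨σ, hσ⟩ := exists_equiv_nat_monotone a hfin
  refine ⟨HilbertBasis.mk (v := e ∘ σ) (e.orthonormal.comp σ σ.injective) ?_, a ∘ σ, hσ,
    fun c => (hfin c).preimage σ.injective.injOn, fun l => ?_⟩
  · rw [σ.surjective.range_comp]
    exact e.dense_span.ge
  · rw [HilbertBasis.coe_mk]
    exact h (σ l)

end

/-! ### Hartley series -/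

section

/-- The Hartley function `cas(nx) = cos(nx) + sin(nx)`. For `n ∈ ℤ` these functions form an
orthogonal basis of the real functions on the circle. -/
def cas (n : ℤ) (x : ℝ) : ℝ := Real.cos (n * x) + Real.sin (n * x)

theorem abs_cas_le (n : ℤ) (x : ℝ) : |cas n x| ≤ 2 :=
  (abs_add_le _ _).trans (by linarith [Real.abs_cos_le_one (n * x), Real.abs_sin_le_one (n * x)])

theorem hasDerivAt_cas (n : ℤ) (x : ℝ) : HasDerivAt (cas n) (n * cas (-n) x) x := by
  have h : HasDerivAt (fun x : ℝ => (n : ℝ) * x) n x := by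
    simpa using (hasDerivAt_id x).const_mul (n : ℝ)
  refine (h.cos.add h.sin).congr_deriv ?_
  simp only [cas, Int.cast_neg, neg_mul, Real.cos_neg, Real.sin_neg]
  ring

theorem continuous_cas (n : ℤ) : Continuous (cas n) := by unfold cas; fun_prop

theorem periodic_cas (n : ℤ) : Function.Periodic (cas n) (2 * Real.pi) := fun x => by
  simp only [cas, mul_add, Real.cos_add_int_mul_two_pi, Real.sin_add_int_mul_two_pi]

theorem cos_two_mul_cas (n : ℤ) (x : ℝ) :
    Real.cos (2 * x) * cas n x = (cas (n + 2) x + cas (n - 2) x) / 2 := by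
  simp only [cas, Int.cast_add, Int.cast_sub, Int.cast_ofNat, add_mul, sub_mul, Real.cos_add,
    Real.cos_sub, Real.sin_add, Real.sin_sub]
  ring

theorem integral_cos_int_mul (k : ℤ) :
    ∫ x in (0 : ℝ)..(2 * Real.pi), Real.cos (k * x) = if k = 0 then 2 * Real.pi else 0 := by
  split_ifs with h
  · simp [h]
  · have hk : (k : ℝ) ≠ 0 := by exact_mod_cast h
    rw [intervalIntegral.integral_comp_mul_left (fun x => Real.cos x) hk, integral_cos]
    have := Real.sin_int_mul_pi (k * 2)
    push_cast at this
    simp [← mul_assoc, this]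

theorem integral_sin_int_mul (k : ℤ) :
    ∫ x in (0 : ℝ)..(2 * Real.pi), Real.sin (k * x) = 0 := by
  by_cases h : k = 0
  · simp [h]
  · have hk : (k : ℝ) ≠ 0 := by exact_mod_cast h
    rw [intervalIntegral.integral_comp_mul_left (fun x => Real.sin x) hk, integral_sin]
    simp [Real.cos_int_mul_two_pi]

theorem integral_cas_mul_cas (n m : ℤ) :
    ∫ x in (0 : ℝ)..(2 * Real.pi), cas n x * cas m x = if n = m then 2 * Real.pi else 0 := by
  have h : ∀ x, cas n x * cas m x =
      Real.cos (((n - m : ℤ) : ℝ) * x) + Real.sin (((n + m : ℤ) : ℝ) * x) := fun x => by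
    simp only [cas, Int.cast_add, Int.cast_sub, add_mul, sub_mul, Real.cos_sub, Real.sin_add]
    ring
  simp_rw [h]
  rw [intervalIntegral.integral_add (by apply Continuous.intervalIntegrable; fun_prop)
    (by apply Continuous.intervalIntegrable; fun_prop), integral_cos_int_mul, integral_sin_int_mul,
    add_zero]
  simp [sub_eq_zero]

/-- The function `∑ f_n cas(nx)` with absolutely summable Hartley coefficients `f`. -/
def hartleySum (f : ℤ → ℝ) (x : ℝ) : ℝ := ∑' n, f n * cas n x

theorem norm_mul_cas_le (f : ℤ → ℝ) (n m : ℤ) (x : ℝ) : ‖f n * cas m x‖ ≤ 2 * |f n| := by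
  rw [norm_mul, Real.norm_eq_abs, Real.norm_eq_abs, mul_comm]
  exact mul_le_mul_of_nonneg_right (abs_cas_le m x) (abs_nonneg _)

theorem hasSum_hartleySum {f : ℤ → ℝ} (hf : Summable f) (x : ℝ) :
    HasSum (fun n => f n * cas n x) (hartleySum f x) :=
  (Summable.of_norm_bounded (hf.abs.mul_left 2) fun n => norm_mul_cas_le f n n x).hasSum

theorem continuous_hartleySum {f : ℤ → ℝ} (hf : Summable f) : Continuous (hartleySum f) :=
  continuous_tsum (fun n => continuous_const.mul (continuous_cas n)) (hf.abs.mul_left 2)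
    fun n x => norm_mul_cas_le f n n x

theorem periodic_hartleySum (f : ℤ → ℝ) : Function.Periodic (hartleySum f) (2 * Real.pi) :=
  fun x => by simp only [hartleySum, (periodic_cas _) x]

/-- Since `cas(nx)' = n cas(-nx)`, differentiation replaces the coefficients `f_n` by
`-n f_{-n}`. -/
theorem hasDerivAt_hartleySum {f : ℤ → ℝ} (hf : Summable f)
    (hf' : Summable fun n : ℤ => (n : ℝ) * f n) (x : ℝ) :
    HasDerivAt (hartleySum f) (hartleySum (fun n => ((-n : ℤ) : ℝ) * f (-n)) x) x := by
  have h := hasDerivAt_tsum (g := fun n x => f n * cas n x)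
    (g' := fun n x => ((n : ℝ) * f n) * cas (-n) x) (hf'.abs.mul_left 2)
    (fun n y => ((hasDerivAt_cas n y).const_mul (f n)).congr_deriv (by ring))
    (fun n y => norm_mul_cas_le (fun n : ℤ => (n : ℝ) * f n) n (-n) y)
    (y₀ := 0) (hasSum_hartleySum hf 0).summable x
  refine h.congr_deriv ?_
  rw [hartleySum, ← (Equiv.neg ℤ).tsum_eq]
  simp

theorem integral_hartleySum_mul {f : ℤ → ℝ} (hf : Summable f) {z : ℝ → ℝ} (hz : Continuous z) :
    HasSum (fun n => f n * ∫ x in (0 : ℝ)..(2 * Real.pi), cas n x * z x)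
      (∫ x in (0 : ℝ)..(2 * Real.pi), hartleySum f x * z x) := by
  have h := intervalIntegral.hasSum_integral_of_dominated_convergence (μ := volume) (a := 0)
    (b := 2 * Real.pi) (F := fun n x => f n * cas n x * z x) (f := fun x => hartleySum f x * z x)
    (fun n x => 2 * |f n| * ‖z x‖)
    (fun n => by
      apply Continuous.aestronglyMeasurable
      exact (continuous_const.mul (continuous_cas n)).mul hz)
    (fun n => Eventually.of_forall fun x _ => by
      rw [norm_mul]
      exact mul_le_mul_of_nonneg_right (norm_mul_cas_le f n n x) (norm_nonneg _))
    (Eventually.of_forall fun x _ => (hf.abs.mul_left 2).mul_right _)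
    (by
      simp_rw [tsum_mul_right]
      exact (continuous_const.mul hz.norm).intervalIntegrable _ _)
    (Eventually.of_forall fun x _ => (hasSum_hartleySum hf x).mul_right _)
  simpa only [mul_assoc, intervalIntegral.integral_const_mul] using h

theorem integral_hartleySum_mul_cas {f : ℤ → ℝ} (hf : Summable f) (m : ℤ) :
    ∫ x in (0 : ℝ)..(2 * Real.pi), hartleySum f x * cas m x = 2 * Real.pi * f m := by
  refine (integral_hartleySum_mul hf (continuous_cas m)).unique ?_
  simp_rw [integral_cas_mul_cas]
  convert hasSum_ite_eq m (2 * Real.pi * f m) using 2 with n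
  split_ifs with h
  · rw [h]; ring
  · ring

/-- Parseval's identity for absolutely summable Hartley series. -/
theorem integral_hartleySum_mul_hartleySum (f g : SeqL2) (hf : Summable f) (hg : Summable g) :
    ∫ x in (0 : ℝ)..(2 * Real.pi), hartleySum f x * hartleySum g x =
      2 * Real.pi * inner ℝ f g := by
  refine (integral_hartleySum_mul hf (continuous_hartleySum hg)).unique ?_
  refine ((SeqL2.hasSum_mul f g).mul_left (2 * Real.pi)).congr_fun fun n => ?_
  simp_rw [mul_comm (cas n _), integral_hartleySum_mul_cas hg n]
  ring

theorem contDiff_two_of_hasDerivAt {y y₁ y₂ : ℝ → ℝ} (h₁ : ∀ x, HasDerivAt y (y₁ x) x)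
    (h₂ : ∀ x, HasDerivAt y₁ (y₂ x) x) (hc : Continuous y₂) :
    ContDiff ℝ 2 y ∧ iteratedDeriv 2 y = y₂ := by
  have e₁ : deriv y = y₁ := funext fun x => (h₁ x).deriv
  have e₂ : deriv y₁ = y₂ := funext fun x => (h₂ x).deriv
  constructor
  · rw [show (2 : WithTop ℕ∞) = 1 + 1 by norm_num, contDiff_succ_iff_deriv, e₁]
    refine ⟨fun x => (h₁ x).differentiableAt, by simp, ?_⟩
    rw [contDiff_one_iff_deriv, e₂]
    exact ⟨fun x => (h₂ x).differentiableAt, hc⟩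
  · rw [iteratedDeriv_succ, iteratedDeriv_one, e₁, e₂]

/-- By the recursion `n² f_n` is bounded. -/
theorem IsMathieuSeq.summable {μ lam : ℝ} {f : SeqL2} (h : IsMathieuSeq μ lam f) : Summable f := by
  set K := (|lam| + |μ|) * ‖f‖ with hK
  have hb : ∀ n : ℤ, (n : ℝ) ^ 2 * |f n| ≤ K := fun n => by
    have hn : (n : ℝ) ^ 2 * f n = lam * f n - μ / 2 * (f (n + 2) + f (n - 2)) := by
      linear_combination h n
    have hle : ∀ m, |f m| ≤ ‖f‖ := fun m => by
      simpa using lp.norm_apply_le_norm (by simp) f m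
    rw [← abs_of_nonneg (sq_nonneg (n : ℝ)), ← abs_mul, hn]
    calc _ ≤ |lam * f n| + |μ / 2 * (f (n + 2) + f (n - 2))| := abs_sub _ _
      _ ≤ |lam| * ‖f‖ + |μ| / 2 * (‖f‖ + ‖f‖) := by
        rw [abs_mul, abs_mul, abs_div, abs_two]
        gcongr
        · exact hle n
        · exact (abs_add_le _ _).trans (add_le_add (hle _) (hle _))
      _ = K := by rw [hK]; ring
  have hs : Summable fun n : ℤ => 1 / (n : ℝ) ^ 2 := Real.summable_one_div_int_pow.2 one_lt_two
  refine Summable.of_norm_bounded_eventually (hs.mul_left K) ?_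
  rw [Filter.eventually_cofinite]
  refine (Set.finite_singleton (0 : ℤ)).subset fun n hn => ?_
  by_contra hn0
  have hn0' : (n : ℝ) ≠ 0 := by exact_mod_cast hn0
  apply hn
  rw [mul_one_div, le_div_iff₀ (by positivity), mul_comm]
  exact hb n

theorem IsMathieuSeq.summable_sq_mul {μ lam : ℝ} {f : SeqL2} (h : IsMathieuSeq μ lam f) :
    Summable fun n : ℤ => (n : ℝ) ^ 2 * f n := by
  have hs := h.summable
  have h1 : Summable fun n => lam * f n - μ / 2 * (f (n + 2) + f (n - 2)) := by
    refine (hs.mul_left _).sub (((?_ : Summable _).add ?_).mul_left _)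
    · exact hs.comp_injective (add_left_injective 2)
    · exact hs.comp_injective (sub_left_injective (b := (2 : ℤ)))
  exact h1.congr fun n => by linear_combination - h n

theorem IsMathieuSeq.summable_mul {μ lam : ℝ} {f : SeqL2} (h : IsMathieuSeq μ lam f) :
    Summable fun n : ℤ => (n : ℝ) * f n := by
  refine Summable.of_norm_bounded h.summable_sq_mul.abs fun n => ?_
  rw [Real.norm_eq_abs, abs_mul, abs_mul, abs_of_nonneg (sq_nonneg (n : ℝ))]
  gcongr
  rw [← sq_abs]
  exact_mod_cast Int.le_self_sq |n|

/-- The Hartley series of a solution of the sequence equation solves Mathieu's equation. -/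
theorem IsMathieuSeq.hartleySum_mem {μ lam : ℝ} {f : SeqL2} (h : IsMathieuSeq μ lam f) :
    hartleySum f ∈ mathieuEigenspace μ lam := by
  have hs := h.summable
  have d₁ := hasDerivAt_hartleySum hs h.summable_mul
  have hs₁ : Summable fun n : ℤ => ((-n : ℤ) : ℝ) * f (-n) :=
    h.summable_mul.comp_injective neg_injective
  have hs₂ : Summable fun n : ℤ => (n : ℝ) * (((-n : ℤ) : ℝ) * f (-n)) := by
    have := (h.summable_sq_mul.comp_injective neg_injective).neg
    refine this.congr fun n => ?_
    simp only [Function.comp_apply]; push_cast; ring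
  have d₂ := hasDerivAt_hartleySum hs₁ hs₂
  have e₂ : (fun n : ℤ => ((-n : ℤ) : ℝ) * (((- -n : ℤ) : ℝ) * f (- -n))) =
      fun n : ℤ => -((n : ℝ) ^ 2 * f n) := by
    ext n; simp only [neg_neg]; push_cast; ring
  rw [e₂] at d₂
  obtain ⟨hC, hD⟩ := contDiff_two_of_hasDerivAt d₁ d₂ (continuous_hartleySum h.summable_sq_mul.neg)
  refine ⟨hC, periodic_hartleySum _, fun x => ?_⟩
  rw [hD]
  have t₁ := hasSum_hartleySum h.summable_sq_mul.neg x
  have t₂ := hasSum_hartleySum hs x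
  have t₃ : HasSum (fun n => (f (n + 2) + f (n - 2)) * cas n x)
      (2 * Real.cos (2 * x) * hartleySum f x) := by
    have u := t₂.mul_left (2 * Real.cos (2 * x))
    have hA : Summable fun n : ℤ => f n * cas (n + 2) x :=
      Summable.of_norm_bounded (hs.abs.mul_left 2) fun n => norm_mul_cas_le f n _ x
    have hB : Summable fun n : ℤ => f n * cas (n - 2) x :=
      Summable.of_norm_bounded (hs.abs.mul_left 2) fun n => norm_mul_cas_le f n _ x
    have hA' := (Equiv.subRight (2 : ℤ)).hasSum_iff.2 hA.hasSum
    have hB' := (Equiv.addRight (2 : ℤ)).hasSum_iff.2 hB.hasSum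
    have hAB := hA.hasSum.add hB.hasSum
    have hu := u.unique (hAB.congr_fun fun n => by
      linear_combination 2 * f n * cos_two_mul_cas n x)
    rw [hu, add_comm]
    refine (hB'.add hA').congr_fun fun n => ?_
    simp only [Function.comp_apply, Equiv.coe_addRight, Equiv.subRight_apply,
      add_sub_cancel_right, sub_add_cancel]
    ring
  have t := (t₁.neg.add (t₃.mul_left (μ / 2))).unique ((t₂.mul_left lam).congr_fun fun n => by
    linear_combination cas n x * h n)
  linear_combination t

end

/-! ### Mathieu functions on the circle -/

section

theorem hasDerivAt_of_mem_mathieuEigenspace {μ lam : ℝ} {y : ℝ → ℝ}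
    (h : y ∈ mathieuEigenspace μ lam) (x : ℝ) : HasDerivAt y (deriv y x) x :=
  (h.1.differentiable (by norm_num) x).hasDerivAt

theorem hasDerivAt_deriv_of_mem_mathieuEigenspace {μ lam : ℝ} {y : ℝ → ℝ}
    (h : y ∈ mathieuEigenspace μ lam) (x : ℝ) :
    HasDerivAt (deriv y) ((μ * Real.cos (2 * x) - lam) * y x) x := by
  have h1 : ContDiff ℝ 1 (deriv y) := by
    have := h.1
    rw [show (2 : WithTop ℕ∞) = 1 + 1 by norm_num, contDiff_succ_iff_deriv] at this
    exact this.2.2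
  refine ((h1.differentiable (by norm_num) x).hasDerivAt).congr_deriv ?_
  have e := h.2.2 x
  rw [iteratedDeriv_succ, iteratedDeriv_one] at e
  linear_combination -e

theorem periodic_deriv {y : ℝ → ℝ} {T : ℝ} (h : Function.Periodic y T) :
    Function.Periodic (deriv y) T := fun x => by
  rw [← deriv_comp_add_const]
  exact congrArg (fun g => deriv g x) (funext h)

/-- Integrating the derivative of the Wronskian over a period shows that eigenfunctions with
different eigenvalues are orthogonal. -/
theorem integral_mul_eq_zero_of_mem_mathieuEigenspace {μ lam lam' : ℝ} {y z : ℝ → ℝ}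
    (hy : y ∈ mathieuEigenspace μ lam) (hz : z ∈ mathieuEigenspace μ lam') (hne : lam ≠ lam') :
    ∫ x in (0 : ℝ)..(2 * Real.pi), y x * z x = 0 := by
  have hd : ∀ x, HasDerivAt (fun x => y x * deriv z x - deriv y x * z x)
      ((lam - lam') * (y x * z x)) x := fun x =>
    ((hasDerivAt_of_mem_mathieuEigenspace hy x).mul
      (hasDerivAt_deriv_of_mem_mathieuEigenspace hz x)).sub
      ((hasDerivAt_deriv_of_mem_mathieuEigenspace hy x).mul
        (hasDerivAt_of_mem_mathieuEigenspace hz x)) |>.congr_deriv (by ring)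
  have hi := intervalIntegral.integral_eq_sub_of_hasDerivAt (a := 0) (b := 2 * Real.pi)
    (fun x _ => hd x)
    ((continuous_const.mul (hy.1.continuous.mul hz.1.continuous)).intervalIntegrable _ _)
  have p : ∀ {f : ℝ → ℝ}, Function.Periodic f (2 * Real.pi) → f (2 * Real.pi) = f 0 :=
    fun {f} hf => by simpa using hf 0
  rw [p hy.2.1, p hz.2.1, p (periodic_deriv hy.2.1), p (periodic_deriv hz.2.1), sub_self,
    intervalIntegral.integral_const_mul] at hi
  exact (mul_eq_zero.1 hi).resolve_left (sub_ne_zero.2 hne)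

/-- The Cauchy-Schwarz inequality, from the discriminant of `t ↦ ∫ (t f + g)²`. -/
theorem integral_mul_sq_le {f g : ℝ → ℝ} (hf : Continuous f) (hg : Continuous g) :
    (∫ x in (0 : ℝ)..(2 * Real.pi), f x * g x) ^ 2 ≤
      (∫ x in (0 : ℝ)..(2 * Real.pi), f x ^ 2) * ∫ x in (0 : ℝ)..(2 * Real.pi), g x ^ 2 := by
  have h := discrim_le_zero (a := ∫ x in (0 : ℝ)..(2 * Real.pi), f x ^ 2)
    (b := 2 * ∫ x in (0 : ℝ)..(2 * Real.pi), f x * g x)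
    (c := ∫ x in (0 : ℝ)..(2 * Real.pi), g x ^ 2) fun t => by
    have h0 : 0 ≤ ∫ x in (0 : ℝ)..(2 * Real.pi), (t * f x + g x) ^ 2 :=
      intervalIntegral.integral_nonneg Real.two_pi_pos.le fun x _ => sq_nonneg _
    have e : ∀ x, (t * f x + g x) ^ 2 = (t * t) * f x ^ 2 + (2 * t) * (f x * g x) + g x ^ 2 :=
      fun x => by ring
    simp_rw [e] at h0
    rw [intervalIntegral.integral_add (by apply Continuous.intervalIntegrable; fun_prop)
      (by apply Continuous.intervalIntegrable; fun_prop), intervalIntegral.integral_add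
      (by apply Continuous.intervalIntegrable; fun_prop)
      (by apply Continuous.intervalIntegrable; fun_prop), intervalIntegral.integral_const_mul,
      intervalIntegral.integral_const_mul] at h0
    linarith
  rw [discrim] at h
  linarith

theorem integral_sq_pos {f : ℝ → ℝ} (hf : Continuous f) (hp : Function.Periodic f (2 * Real.pi))
    (h0 : f ≠ 0) : 0 < ∫ x in (0 : ℝ)..(2 * Real.pi), f x * f x := by
  obtain ⟨x, hx⟩ := Function.ne_iff.1 h0
  obtain ⟨y, hy, hxy⟩ := hp.exists_mem_Ico₀ Real.two_pi_pos x
  refine intervalIntegral.integral_pos Real.two_pi_pos (hf.mul hf).continuousOn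
    (fun x _ => mul_self_nonneg _) ⟨y, Set.Ico_subset_Icc_self hy, ?_⟩
  rw [← hxy]
  exact mul_self_pos.2 hx

/-- A continuous periodic function all of whose Hartley coefficients vanish is zero, because its
Fourier coefficients vanish. -/
theorem eq_zero_of_integral_cas_eq_zero {z : ℝ → ℝ} (hz : Continuous z)
    (hp : Function.Periodic z (2 * Real.pi))
    (h : ∀ m : ℤ, ∫ x in (0 : ℝ)..(2 * Real.pi), cas m x * z x = 0) : z = 0 := by
  have : Fact (0 < 2 * Real.pi) := ⟨Real.two_pi_pos⟩
  have hp' : Function.Periodic (fun x => (z x : ℂ)) (2 * Real.pi) := fun x => by simp [hp x]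
  let F : C(AddCircle (2 * Real.pi), ℂ) := ⟨hp'.lift, by
    refine (QuotientAddGroup.isQuotientMap_mk _).continuous_iff.2 ?_
    exact Complex.continuous_ofReal.comp hz⟩
  have hF : ∀ x : ℝ, F (x : AddCircle (2 * Real.pi)) = z x := fun x => hp'.lift_coe x
  have hc : ∀ n, fourierCoeff F n = 0 := fun n => by
    rw [fourierCoeff_eq_intervalIntegral F n 0]
    have e : ∀ x : ℝ, fourier (-n) (x : AddCircle (2 * Real.pi)) • F x =
        ((1 - Complex.I) / 2) * ((cas n x * z x : ℝ) : ℂ) +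
        ((1 + Complex.I) / 2) * ((cas (-n) x * z x : ℝ) : ℂ) := fun x => by
      rw [hF, fourier_coe_apply]
      have : 2 * (Real.pi : ℂ) * Complex.I * ((-n : ℤ) : ℂ) * x / ((2 * Real.pi : ℝ) : ℂ) =
          ((-(n * x) : ℝ) : ℂ) * Complex.I := by
        have := Real.pi_ne_zero
        push_cast
        field_simp
      rw [this, Complex.exp_mul_I, ← Complex.ofReal_cos, ← Complex.ofReal_sin]
      simp only [cas, Int.cast_neg, neg_mul, Real.cos_neg, Real.sin_neg, smul_eq_mul]
      push_cast
      ring_nf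
    simp_rw [e]
    have hcs := continuous_cas
    rw [zero_add, intervalIntegral.integral_add, intervalIntegral.integral_const_mul,
      intervalIntegral.integral_const_mul, intervalIntegral.integral_ofReal,
      intervalIntegral.integral_ofReal, h, h]
    · simp
    · apply Continuous.intervalIntegrable
      have := hcs n
      fun_prop
    · apply Continuous.intervalIntegrable
      have := hcs (-n)
      fun_prop
  have hs := has_pointwise_sum_fourier_series_of_summable (f := F) (by
    simp only [funext hc]; exact summable_zero)
  ext x
  have hx := hs (x : AddCircle (2 * Real.pi))
  simp only [hc, zero_smul, hF] at hx
  simpa using hx.unique hasSum_zero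

theorem linearIndependent_of_integral {ι : Type*} {y : ι → ℝ → ℝ} (hc : ∀ i, Continuous (y i))
    (ho : ∀ i j, i ≠ j → ∫ x in (0 : ℝ)..(2 * Real.pi), y i x * y j x = 0)
    (hp : ∀ i, ∫ x in (0 : ℝ)..(2 * Real.pi), y i x * y i x ≠ 0) : LinearIndependent ℝ y := by
  classical
  rw [linearIndependent_iff']
  intro s g hg j hj
  have h0 : ∫ x in (0 : ℝ)..(2 * Real.pi), (∑ i ∈ s, g i • y i) x * y j x = 0 := by
    rw [hg]; simp
  simp only [Finset.sum_apply, Pi.smul_apply, smul_eq_mul, Finset.sum_mul, mul_assoc] at h0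
  rw [intervalIntegral.integral_finsetSum fun i _ => by
    apply Continuous.intervalIntegrable
    exact continuous_const.mul ((hc i).mul (hc j))] at h0
  simp_rw [intervalIntegral.integral_const_mul] at h0
  rw [Finset.sum_eq_single j (fun i _ hij => by rw [ho i j hij, mul_zero])
    (fun h => absurd hj h)] at h0
  exact (mul_eq_zero.1 h0).resolve_right (hp j)

/-- Hartley functions are `L²`-limits of combinations of the eigenfunctions. -/
theorem exists_span_hartleySum_near (μ : ℝ) (e : HilbertBasis ℕ ℝ SeqL2) (a : ℕ → ℝ)
    (he : ∀ l, IsMathieuSeq μ (a l) (e l)) (m : ℤ) {ε : ℝ} (hε : 0 < ε) :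
    ∃ p ∈ Submodule.span ℝ (Set.range fun l => hartleySum (e l)),
      ∫ x in (0 : ℝ)..(2 * Real.pi), (cas m x - p x) ^ 2 < ε := by
  classical
  let δ : SeqL2 := lp.single 2 m (1 : ℝ)
  have hlim : Tendsto (fun J : Finset ℕ => 2 * Real.pi * ‖δ - ∑ l ∈ J, e.repr δ l • e l‖ ^ 2) atTop
      (𝓝 (2 * Real.pi * ‖δ - δ‖ ^ 2)) :=
    ((tendsto_const_nhds.sub (e.hasSum_repr δ)).norm.pow 2).const_mul _
  rw [sub_self, norm_zero, zero_pow two_ne_zero, mul_zero] at hlim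
  obtain ⟨J, hJ⟩ := (hlim.eventually_lt_const hε).exists
  refine ⟨∑ l ∈ J, e.repr δ l • hartleySum (e l), Submodule.sum_mem _ fun l _ =>
    Submodule.smul_mem _ _ (Submodule.subset_span ⟨l, rfl⟩), ?_⟩
  have hδ : ∀ n, δ n = if n = m then 1 else 0 := fun n => by
    simp [δ, lp.single_apply, Pi.single_apply]
  set f : SeqL2 := δ - ∑ l ∈ J, e.repr δ l • e l with hf
  have hfn : ∀ n, f n = δ n - ∑ l ∈ J, e.repr δ l * e l n := fun n => by
    rw [hf, lp.coeFn_sub, Pi.sub_apply, lp.coeFn_sum, Finset.sum_apply]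
    rfl
  have hfs : Summable f := by
    have : Summable fun n => δ n - ∑ l ∈ J, e.repr δ l * e l n := by
      refine Summable.sub ?_ (summable_sum fun l _ => (he l).summable.mul_left _)
      exact summable_of_ne_finset_zero (s := {m}) fun n hn => by simpa [hδ] using hn
    exact this.congr fun n => (hfn n).symm
  have hsum : ∀ x, hartleySum f x = cas m x - (∑ l ∈ J, e.repr δ l • hartleySum (e l)) x := by
    intro x
    refine (hasSum_hartleySum hfs x).unique ?_
    have h1 : HasSum (fun n => δ n * cas n x) (cas m x) := by
      convert hasSum_ite_eq m (cas m x) using 2 with n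
      rw [hδ]
      split_ifs with h
      · rw [h, one_mul]
      · rw [zero_mul]
    have h2 := h1.sub (hasSum_sum (s := J) fun l _ =>
      (hasSum_hartleySum (he l).summable x).mul_left (e.repr δ l))
    simp only [Finset.sum_apply, Pi.smul_apply, smul_eq_mul]
    refine h2.congr_fun fun n => ?_
    rw [hfn, sub_mul, Finset.sum_mul]
    simp only [mul_assoc]
  simp_rw [← hsum, sq]
  rw [integral_hartleySum_mul_hartleySum f f hfs hfs, real_inner_self_eq_norm_sq]
  exact hJ

end

/-! ### Completeness of periodic Mathieu functions -/

section

/-- An ordered complete system of periodic Mathieu functions `y` with eigenvalues `a`, normalised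
by `∫ y_l² = 2π`. Completeness is expressed as `L²`-approximation of the Hartley functions. -/
structure IsMathieuBasis (μ : ℝ) (a : ℕ → ℝ) (y : ℕ → ℝ → ℝ) : Prop where
  mono : Monotone a
  finite_le : ∀ c, {l | a l ≤ c}.Finite
  neg_abs_le : ∀ l, -|μ| ≤ a l
  mem : ∀ l, y l ∈ mathieuEigenspace μ (a l)
  integral_mul : ∀ i j, ∫ x in (0 : ℝ)..(2 * Real.pi), y i x * y j x =
    if i = j then 2 * Real.pi else 0
  near : ∀ (m : ℤ) (ε : ℝ), 0 < ε → ∃ p ∈ Submodule.span ℝ (Set.range y),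
    ∫ x in (0 : ℝ)..(2 * Real.pi), (cas m x - p x) ^ 2 < ε

theorem exists_isMathieuBasis (μ : ℝ) : ∃ a y, IsMathieuBasis μ a y := by
  obtain ⟨e, a, hmono, hfin, he⟩ := exists_monotone_hilbertBasis_isMathieuSeq μ
  refine ⟨a, fun l => hartleySum (e l), hmono, hfin, fun l => (he l).neg_abs_le
    (e.orthonormal.ne_zero l), fun l => (he l).hartleySum_mem, fun i j => ?_,
    fun m ε hε => exists_span_hartleySum_near μ e a he m hε⟩
  rw [integral_hartleySum_mul_hartleySum _ _ (he i).summable (he j).summable,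
    orthonormal_iff_ite.1 e.orthonormal i j]
  simp

/-- The space of continuous `2π`-periodic functions. -/
def continuousPeriodic : Submodule ℝ (ℝ → ℝ) where
  carrier := {f | Continuous f ∧ Function.Periodic f (2 * Real.pi)}
  zero_mem' := ⟨continuous_const, fun _ => rfl⟩
  add_mem' := fun hf hg => ⟨hf.1.add hg.1, hf.2.add hg.2⟩
  smul_mem' := fun c _ hf => ⟨continuous_const.mul hf.1, hf.2.smul c⟩

theorem mathieuEigenspace_le_continuousPeriodic (μ lam : ℝ) :
    mathieuEigenspace μ lam ≤ continuousPeriodic := fun _ h => ⟨h.1.continuous, h.2.1⟩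

theorem intervalIntegrable_mul {f g : ℝ → ℝ} (hf : Continuous f) (hg : Continuous g) (s t : ℝ) :
    IntervalIntegrable (fun x => f x * g x) volume s t := (hf.mul hg).intervalIntegrable s t

namespace IsMathieuBasis

variable {μ : ℝ} {a : ℕ → ℝ} {y : ℕ → ℝ → ℝ}

theorem span_le (h : IsMathieuBasis μ a y) :
    Submodule.span ℝ (Set.range y) ≤ continuousPeriodic := by
  rw [Submodule.span_le]
  rintro _ ⟨l, rfl⟩
  exact mathieuEigenspace_le_continuousPeriodic _ _ (h.mem l)

theorem linearIndependent (h : IsMathieuBasis μ a y) : LinearIndependent ℝ y :=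
  linearIndependent_of_integral (fun l => (h.mem l).1.continuous)
    (fun i j hij => by rw [h.integral_mul, if_neg hij])
    (fun i => by rw [h.integral_mul, if_pos rfl]; exact Real.two_pi_pos.ne')

/-- A continuous periodic function orthogonal to a complete system is zero. -/
theorem eq_zero (h : IsMathieuBasis μ a y) {z : ℝ → ℝ} (hz : z ∈ continuousPeriodic)
    (ho : ∀ l, ∫ x in (0 : ℝ)..(2 * Real.pi), y l x * z x = 0) : z = 0 := by
  have hs : ∀ p ∈ Submodule.span ℝ (Set.range y),
      ∫ x in (0 : ℝ)..(2 * Real.pi), p x * z x = 0 := by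
    intro p hp
    have hp' := hp
    induction hp using Submodule.span_induction with
    | mem p hp => obtain ⟨l, rfl⟩ := hp; exact ho l
    | zero => simp
    | add p q hp hq ihp ihq =>
      have cp := (h.span_le hp).1
      have cq := (h.span_le hq).1
      have cz := hz.1
      simp only [Pi.add_apply, add_mul]
      rw [intervalIntegral.integral_add (intervalIntegrable_mul cp cz _ _)
        (intervalIntegrable_mul cq cz _ _), ihp hp, ihq hq, add_zero]
    | smul c p hp ihp =>
      simp only [Pi.smul_apply, smul_eq_mul, mul_assoc]
      rw [intervalIntegral.integral_const_mul, ihp hp, mul_zero]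
  refine eq_zero_of_integral_cas_eq_zero hz.1 hz.2 fun m => ?_
  have cz := hz.1
  have cm := continuous_cas m
  rw [← sq_eq_zero_iff]
  refine le_antisymm (le_of_forall_pos_le_add fun ε hε => ?_) (sq_nonneg _)
  set Z := ∫ x in (0 : ℝ)..(2 * Real.pi), z x ^ 2 with hZ
  have hZ0 : 0 ≤ Z := intervalIntegral.integral_nonneg Real.two_pi_pos.le fun x _ => sq_nonneg _
  obtain ⟨p, hp, hpε⟩ := h.near m (ε / (Z + 1)) (by positivity)
  have cp := (h.span_le hp).1
  have e : ∫ x in (0 : ℝ)..(2 * Real.pi), cas m x * z x =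
      ∫ x in (0 : ℝ)..(2 * Real.pi), (cas m x - p x) * z x := by
    simp only [sub_mul]
    rw [intervalIntegral.integral_sub (intervalIntegrable_mul cm cz _ _)
      (intervalIntegrable_mul cp cz _ _), hs p hp, sub_zero]
  rw [e, zero_add]
  refine (integral_mul_sq_le (f := fun x => cas m x - p x) (cm.sub cp) cz).trans ?_
  rw [← hZ]
  rw [lt_div_iff₀ (by positivity)] at hpε
  have : 0 ≤ ∫ x in (0 : ℝ)..(2 * Real.pi), (cas m x - p x) ^ 2 :=
    intervalIntegral.integral_nonneg Real.two_pi_pos.le fun x _ => sq_nonneg _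
  nlinarith

/-- The eigenspace of `ν` is spanned by those `y_l` with `a_l = ν`: the remainder of the orthogonal
projection of an eigenfunction is orthogonal to the whole system. -/
theorem mathieuEigenspace_eq_span (h : IsMathieuBasis μ a y) (ν : ℝ) :
    mathieuEigenspace μ ν = Submodule.span ℝ (y '' {l | a l = ν}) := by
  classical
  refine le_antisymm (fun z hz => ?_) ?_
  · have hfin : {l | a l = ν}.Finite := (h.finite_le ν).subset fun l hl => le_of_eq hl
    set J := hfin.toFinset with hJ
    have hJm : ∀ l, l ∈ J ↔ a l = ν := fun l => by simp [hJ]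
    let c : ℕ → ℝ := fun l => (∫ x in (0 : ℝ)..(2 * Real.pi), y l x * z x) / (2 * Real.pi)
    have hmem : ∀ l ∈ J, c l • y l ∈ mathieuEigenspace μ ν := fun l hl =>
      Submodule.smul_mem _ _ ((hJm l).1 hl ▸ h.mem l)
    have hz0 : z - ∑ l ∈ J, c l • y l = 0 := by
      have hzm : z - ∑ l ∈ J, c l • y l ∈ mathieuEigenspace μ ν :=
        Submodule.sub_mem _ hz (Submodule.sum_mem _ hmem)
      refine h.eq_zero (mathieuEigenspace_le_continuousPeriodic _ _ hzm) fun j => ?_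
      by_cases hj : a j = ν
      · have cy : ∀ l, Continuous (y l) := fun l => (h.mem l).1.continuous
        have cz : Continuous z := hz.1.continuous
        simp only [Pi.sub_apply, Finset.sum_apply, Pi.smul_apply, smul_eq_mul, mul_sub,
          Finset.mul_sum, mul_left_comm _ (c _)]
        rw [intervalIntegral.integral_sub (intervalIntegrable_mul (cy j) cz _ _) (by
            apply Continuous.intervalIntegrable; fun_prop),
          intervalIntegral.integral_finsetSum fun i _ => by
            apply Continuous.intervalIntegrable; fun_prop]
        simp_rw [intervalIntegral.integral_const_mul, h.integral_mul]
        rw [Finset.sum_eq_single j (fun i _ hij => by rw [if_neg (Ne.symm hij), mul_zero])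
          (fun hn => absurd ((hJm j).2 hj) hn), if_pos rfl,
          div_mul_cancel₀ _ Real.two_pi_pos.ne', sub_self]
      · exact integral_mul_eq_zero_of_mem_mathieuEigenspace (h.mem j) hzm hj
    rw [sub_eq_zero.1 hz0]
    exact Submodule.sum_mem _ fun l hl => Submodule.smul_mem _ _
      (Submodule.subset_span ⟨l, (hJm l).1 hl, rfl⟩)
  · rw [Submodule.span_le]
    rintro _ ⟨l, rfl, rfl⟩
    exact h.mem l

theorem iSup_mathieuEigenspace (h : IsMathieuBasis μ a y) (lam : ℝ) :
    ⨆ ν ∈ Set.Iic lam, mathieuEigenspace μ ν = Submodule.span ℝ (y '' {l | a l ≤ lam}) := by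
  simp_rw [h.mathieuEigenspace_eq_span, ← Submodule.span_iUnion, ← Set.image_iUnion]
  congr 2
  ext l
  simp

/-- The eigenfunctions with eigenvalue at most `lam` span a space whose dimension is the number of
`j` with `a j ≤ lam`, and this number exceeds `l` exactly when `a l ≤ lam`. -/
theorem mathieuEigenvalue_eq (h : IsMathieuBasis μ a y) (l : ℕ) : mathieuEigenvalue μ l = a l := by
  have hset : {lam : ℝ | (l : Cardinal) < Module.rank ℝ
      (⨆ ν ∈ Set.Iic lam, mathieuEigenspace μ ν : Submodule ℝ (ℝ → ℝ))} = Set.Ici (a l) := by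
    ext lam
    have hr : Module.rank ℝ (⨆ ν ∈ Set.Iic lam, mathieuEigenspace μ ν : Submodule ℝ (ℝ → ℝ)) =
        Cardinal.mk {l | a l ≤ lam} := by
      rw [h.iSup_mathieuEigenspace, rank_span_set
        (h.linearIndependent.linearIndepOn_id.mono (Set.image_subset_range _ _)),
        Cardinal.mk_image_eq h.linearIndependent.injective]
    rw [Set.mem_ofPred_eq, hr, Set.mem_Ici]
    constructor
    · intro hl
      by_contra! hcon
      have hsub : {l | a l ≤ lam} ⊆ Set.Iio l := fun j hj => by
        by_contra! hlj
        exact absurd (hcon.trans_le (h.mono (not_lt.1 hlj))) (not_lt.2 hj)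
      have := Cardinal.mk_le_mk_of_subset hsub
      rw [Cardinal.mk_fintype (Set.Iio l), Fintype.card_Iio, Nat.card_Iio] at this
      exact absurd hl (not_lt.2 this)
    · intro hl
      have hsub : Set.Iic l ⊆ {l | a l ≤ lam} := fun j hj => (h.mono hj).trans hl
      have := Cardinal.mk_le_mk_of_subset hsub
      rw [Cardinal.mk_fintype (Set.Iic l), Fintype.card_Iic, Nat.card_Iic] at this
      refine lt_of_lt_of_le ?_ this
      exact_mod_cast Nat.lt_succ_self l
  rw [mathieuEigenvalue, hset, csInf_Ici]

theorem isMathieuSystem (h : IsMathieuBasis μ a y) : IsMathieuSystem μ y :=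
  ⟨fun l => ⟨h.mathieuEigenvalue_eq l ▸ h.mem l, h.linearIndependent.ne_zero l⟩,
    fun i j hij => by rw [h.integral_mul, if_neg hij]⟩

/-- Each eigenspace is finite-dimensional and contains as many members of a Mathieu system `φ`
as its dimension, so it is spanned by them. -/
theorem mem_span_range (h : IsMathieuBasis μ a y) {φ : ℕ → ℝ → ℝ} (hφ : IsMathieuSystem μ φ)
    (j : ℕ) : y j ∈ Submodule.span ℝ (Set.range φ) := by
  have hfin : {l | a l = a j}.Finite := (h.finite_le (a j)).subset fun l hl => le_of_eq hl
  have := hfin.fintype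
  let J := {l | a l = a j}
  have hmem : ∀ l, φ l ∈ mathieuEigenspace μ (a l) := fun l => h.mathieuEigenvalue_eq l ▸ (hφ.1 l).1
  have hli : LinearIndependent ℝ φ := linearIndependent_of_integral
    (fun l => (hmem l).1.continuous) hφ.2
    (fun l => (integral_sq_pos (hmem l).1.continuous (hmem l).2.1 (hφ.1 l).2).ne')
  have e₁ := finrank_span_eq_card (hli.comp ((↑) : J → ℕ) Subtype.val_injective)
  have e₂ := finrank_span_eq_card (h.linearIndependent.comp ((↑) : J → ℕ) Subtype.val_injective)
  have hy : Submodule.span ℝ (Set.range (y ∘ ((↑) : J → ℕ))) = mathieuEigenspace μ (a j) := by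
    rw [h.mathieuEigenspace_eq_span, Set.range_comp, Subtype.range_coe]
  have hle : Submodule.span ℝ (Set.range (φ ∘ ((↑) : J → ℕ))) ≤
      Submodule.span ℝ (Set.range (y ∘ ((↑) : J → ℕ))) := by
    rw [hy, Submodule.span_le]
    rintro _ ⟨⟨l, hl⟩, rfl⟩
    have hl' : a l = a j := hl
    exact hl' ▸ hmem l
  have : FiniteDimensional ℝ (Submodule.span ℝ (Set.range (y ∘ ((↑) : J → ℕ)))) :=
    FiniteDimensional.span_of_finite ℝ (Set.finite_range _)
  have heq := Submodule.eq_of_le_of_finrank_eq hle (e₁.trans e₂.symm)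
  refine Submodule.span_mono (Set.range_comp_subset_range ((↑) : J → ℕ) φ) ?_
  rw [heq]
  exact Submodule.subset_span ⟨⟨j, rfl⟩, rfl⟩

end IsMathieuBasis

theorem exists_isMathieuSystem (μ : ℝ) : ∃ φ, IsMathieuSystem μ φ := by
  obtain ⟨a, y, h⟩ := exists_isMathieuBasis μ
  exact ⟨y, h.isMathieuSystem⟩

theorem neg_abs_le_mathieuEigenvalue (μ : ℝ) (l : ℕ) : -|μ| ≤ mathieuEigenvalue μ l := by
  obtain ⟨a, y, h⟩ := exists_isMathieuBasis μ
  rw [h.mathieuEigenvalue_eq]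
  exact h.neg_abs_le l

theorem finite_mathieuEigenvalue_le (μ c : ℝ) : {l | mathieuEigenvalue μ l ≤ c}.Finite := by
  obtain ⟨a, y, h⟩ := exists_isMathieuBasis μ
  simp_rw [h.mathieuEigenvalue_eq]
  exact h.finite_le c

namespace IsMathieuSystem

variable {μ : ℝ} {φ : ℕ → ℝ → ℝ}

theorem mem_continuousPeriodic (hφ : IsMathieuSystem μ φ) (l : ℕ) : φ l ∈ continuousPeriodic :=
  mathieuEigenspace_le_continuousPeriodic _ _ (hφ.1 l).1

/-- Completeness of every system of periodic Mathieu functions, as `L²`-approximation of the Hartley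
functions. -/
theorem exists_span_near (hφ : IsMathieuSystem μ φ) (m : ℤ) {ε : ℝ} (hε : 0 < ε) :
    ∃ p ∈ Submodule.span ℝ (Set.range φ),
      ∫ x in (0 : ℝ)..(2 * Real.pi), (cas m x - p x) ^ 2 < ε := by
  obtain ⟨a, y, h⟩ := exists_isMathieuBasis μ
  obtain ⟨p, hp, hpε⟩ := h.near m ε hε
  refine ⟨p, ?_, hpε⟩
  refine (Submodule.span_le.2 ?_ : Submodule.span ℝ (Set.range y) ≤ _) hp
  rintro _ ⟨j, rfl⟩
  exact h.mem_span_range hφ j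

/-- Mathieu's equation gains two derivatives at a time. -/
theorem contDiff (hφ : IsMathieuSystem μ φ) (l : ℕ) :
    ContDiff ℝ ((⊤ : ℕ∞) : WithTop ℕ∞) (φ l) := by
  have h := (hφ.1 l).1
  have key : ∀ n : ℕ, ContDiff ℝ n (φ l) ∧ ContDiff ℝ n (deriv (φ l)) := by
    intro n
    induction n with
    | zero =>
      refine ⟨contDiff_zero.2 h.1.continuous, contDiff_zero.2 ?_⟩
      exact (h.1.continuous_deriv (by norm_num))
    | succ n ih =>
      constructor
      · rw [Nat.cast_succ, contDiff_succ_iff_deriv]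
        exact ⟨fun x => (hasDerivAt_of_mem_mathieuEigenspace h x).differentiableAt, by simp, ih.2⟩
      · rw [Nat.cast_succ, contDiff_succ_iff_deriv]
        refine ⟨fun x => (hasDerivAt_deriv_of_mem_mathieuEigenspace h x).differentiableAt,
          by simp, ?_⟩
        rw [funext fun x => (hasDerivAt_deriv_of_mem_mathieuEigenspace h x).deriv]
        exact ((contDiff_const.mul (Real.contDiff_cos.comp (contDiff_const.mul contDiff_id))).sub
          contDiff_const).mul ih.1
  exact contDiff_infty.2 fun n => (key n).1

end IsMathieuSystem

end

/-! ### The Laplace-Beltrami operator in coordinates -/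

section

open scoped ContDiff

theorem det_metric {A B : ℝ} (hA : A ≠ 0) (hB : B ≠ 0) (q : Fin 3 → ℝ) :
    (metric A B q).det = A⁻¹ * B⁻¹ := by
  rw [metric, Matrix.det_fin_three]
  simp
  field_simp
  linear_combination (B - 1) * Real.sin_sq_add_cos_sq (q 0)

theorem volumeDensity_metric {A B : ℝ} (hA : A ≠ 0) (hB : B ≠ 0) (q : Fin 3 → ℝ) :
    volumeDensity (metric A B) q = √(A⁻¹ * B⁻¹) := by
  rw [volumeDensity, det_metric hA hB]

theorem inv_metric {A B : ℝ} (hA : A ≠ 0) (hB : B ≠ 0) (q : Fin 3 → ℝ) :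
    (metric A B q)⁻¹ = !![A, 0, 0;
      0, 1 + (B - 1) * Real.cos (q 0) ^ 2, -((B - 1) * (Real.sin (q 0) * Real.cos (q 0)));
      0, -((B - 1) * (Real.sin (q 0) * Real.cos (q 0))), 1 + (B - 1) * Real.sin (q 0) ^ 2] := by
  refine Matrix.inv_eq_right_inv ?_
  have h := Real.sin_sq_add_cos_sq (q 0)
  ext i j
  fin_cases i <;> fin_cases j <;>
    simp [metric, Matrix.mul_apply, Fin.sum_univ_three, hA] <;> field_simp <;>
    first
      | linear_combination (B - 1) * h
      | ring

/-- Smooth functions on `ℝ³`. -/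
abbrev Smooth (f : (Fin 3 → ℝ) → ℂ) : Prop := ContDiff ℝ ∞ f

theorem Smooth.differentiable {f : (Fin 3 → ℝ) → ℂ} (hf : Smooth f) : Differentiable ℝ f :=
  ContDiff.differentiable hf (by simp)

theorem Smooth.partialDeriv {f : (Fin 3 → ℝ) → ℂ} (hf : Smooth f) (i : Fin 3) :
    Smooth (partialDeriv i f) :=
  (hf.fderiv_right (m := ∞) (by simp)).clm_apply contDiff_const

theorem partialDeriv_add {f g : (Fin 3 → ℝ) → ℂ} {q : Fin 3 → ℝ} (i : Fin 3)
    (hf : DifferentiableAt ℝ f q) (hg : DifferentiableAt ℝ g q) :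
    partialDeriv i (fun p => f p + g p) q = partialDeriv i f q + partialDeriv i g q := by
  simp [partialDeriv, fderiv_fun_add hf hg]

theorem partialDeriv_sub {f g : (Fin 3 → ℝ) → ℂ} {q : Fin 3 → ℝ} (i : Fin 3)
    (hf : DifferentiableAt ℝ f q) (hg : DifferentiableAt ℝ g q) :
    partialDeriv i (fun p => f p - g p) q = partialDeriv i f q - partialDeriv i g q := by
  simp [partialDeriv, fderiv_fun_sub hf hg]

theorem partialDeriv_mul {f g : (Fin 3 → ℝ) → ℂ} {q : Fin 3 → ℝ} (i : Fin 3)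
    (hf : DifferentiableAt ℝ f q) (hg : DifferentiableAt ℝ g q) :
    partialDeriv i (fun p => f p * g p) q =
      partialDeriv i f q * g q + f q * partialDeriv i g q := by
  simp [partialDeriv, fderiv_fun_mul hf hg]
  ring

theorem partialDeriv_const_mul {f : (Fin 3 → ℝ) → ℂ} {q : Fin 3 → ℝ} (i : Fin 3) (c : ℂ)
    (hf : DifferentiableAt ℝ f q) :
    partialDeriv i (fun p => c * f p) q = c * partialDeriv i f q := by
  simp [partialDeriv, fderiv_const_mul hf]

theorem partialDeriv_eq_of_hasDerivAt {f : (Fin 3 → ℝ) → ℂ} {q : Fin 3 → ℝ} {i : Fin 3} {d : ℂ}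
    (hf : DifferentiableAt ℝ f q)
    (h : HasDerivAt (fun t : ℝ => f (q + t • Pi.single i 1)) d 0) : partialDeriv i f q = d := by
  rw [partialDeriv, ← hf.lineDeriv_eq_fderiv]
  exact h.deriv

theorem differentiable_coef {r : ℝ → ℝ} (hr : Differentiable ℝ r) :
    Differentiable ℝ fun p : Fin 3 → ℝ => ((r (p 0) : ℝ) : ℂ) :=
  Complex.ofRealCLM.differentiable.comp (hr.comp (differentiable_apply (0 : Fin 3)))

/-- A coefficient depending on `q_0` alone passes through `∂_1` and `∂_2`. -/
theorem partialDeriv_coef_mul {r : ℝ → ℝ} (hr : Differentiable ℝ r) {f : (Fin 3 → ℝ) → ℂ}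
    (hf : Differentiable ℝ f) {i : Fin 3} (hi : i ≠ 0) (q : Fin 3 → ℝ) :
    partialDeriv i (fun p => ((r (p 0) : ℝ) : ℂ) * f p) q =
      ((r (q 0) : ℝ) : ℂ) * partialDeriv i f q := by
  have h0 : partialDeriv i (fun p : Fin 3 → ℝ => ((r (p 0) : ℝ) : ℂ)) q = 0 := by
    refine partialDeriv_eq_of_hasDerivAt (differentiable_coef hr q) ?_
    simpa [Pi.single_eq_of_ne hi.symm] using hasDerivAt_const (0 : ℝ) ((r (q 0) : ℝ) : ℂ)
  rw [partialDeriv_mul i (differentiable_coef hr q) (hf q), h0, zero_mul, zero_add]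

/-- The operator `A ∂_0² + ∂_1² + ∂_2² + (B - 1) (cos q_0 ∂_1 - sin q_0 ∂_2)²`. -/
def explicitLaplacian (A B : ℝ) (f : (Fin 3 → ℝ) → ℂ) (q : Fin 3 → ℝ) : ℂ :=
  A * partialDeriv 0 (partialDeriv 0 f) q + partialDeriv 1 (partialDeriv 1 f) q +
    partialDeriv 2 (partialDeriv 2 f) q + (B - 1) * fieldX1 (fieldX1 f) q

/-- The volume density is constant and cancels, and the coefficients of the inverse metric in the
rows `1` and `2` depend on `q_0` only, so that `∂_1` and `∂_2` do not see them. -/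
theorem laplaceBeltrami_metric {A B : ℝ} (hA : 0 < A) (hB : 0 < B) {f : (Fin 3 → ℝ) → ℂ}
    (hf : Smooth f) (q : Fin 3 → ℝ) :
    laplaceBeltrami (metric A B) f q = explicitLaplacian A B f q := by
  have hρ : √(A⁻¹ * B⁻¹) ≠ 0 := by positivity
  set ρ := √(A⁻¹ * B⁻¹) with hρ'
  have d : ∀ i, Differentiable ℝ (partialDeriv i f) := fun i => (hf.partialDeriv i).differentiable
  have hs : Differentiable ℝ Real.sin := Real.differentiable_sin
  have hc : Differentiable ℝ Real.cos := Real.differentiable_cos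
  have cf : ∀ {r : ℝ → ℝ} {g : (Fin 3 → ℝ) → ℂ}, Differentiable ℝ r → Differentiable ℝ g →
      Differentiable ℝ fun p : Fin 3 → ℝ => ((r (p 0) : ℝ) : ℂ) * g p :=
    fun hr hg => (differentiable_coef hr).mul hg
  have r11 : Differentiable ℝ fun x => ρ * (1 + (B - 1) * Real.cos x ^ 2) := by fun_prop
  have r12 : Differentiable ℝ fun x => ρ * -((B - 1) * (Real.sin x * Real.cos x)) := by fun_prop
  have r22 : Differentiable ℝ fun x => ρ * (1 + (B - 1) * Real.sin x ^ 2) := by fun_prop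
  have e0 : partialDeriv 0 (fun p => ∑ j, ((volumeDensity (metric A B) p *
      (metric A B p)⁻¹ 0 j : ℝ) : ℂ) * partialDeriv j f p) q =
      ρ * A * partialDeriv 0 (partialDeriv 0 f) q := by
    simp only [volumeDensity_metric hA.ne' hB.ne', inv_metric hA.ne' hB.ne', Fin.sum_univ_three]
    simp [← hρ', partialDeriv_const_mul 0 _ (d 0 q)]
  have e1 : partialDeriv 1 (fun p => ∑ j, ((volumeDensity (metric A B) p *
      (metric A B p)⁻¹ 1 j : ℝ) : ℂ) * partialDeriv j f p) q =
      ((ρ * (1 + (B - 1) * Real.cos (q 0) ^ 2) : ℝ) : ℂ) * partialDeriv 1 (partialDeriv 1 f) q +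
      ((ρ * -((B - 1) * (Real.sin (q 0) * Real.cos (q 0))) : ℝ) : ℂ) *
        partialDeriv 1 (partialDeriv 2 f) q := by
    rw [← partialDeriv_coef_mul r11 (d 1) one_ne_zero,
      ← partialDeriv_coef_mul r12 (d 2) one_ne_zero,
      ← partialDeriv_add 1 (cf r11 (d 1) q) (cf r12 (d 2) q)]
    congr 1
    ext p
    simp only [volumeDensity_metric hA.ne' hB.ne', inv_metric hA.ne' hB.ne', Fin.sum_univ_three]
    simp [← hρ']
  have e2 : partialDeriv 2 (fun p => ∑ j, ((volumeDensity (metric A B) p *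
      (metric A B p)⁻¹ 2 j : ℝ) : ℂ) * partialDeriv j f p) q =
      ((ρ * -((B - 1) * (Real.sin (q 0) * Real.cos (q 0))) : ℝ) : ℂ) *
        partialDeriv 2 (partialDeriv 1 f) q +
      ((ρ * (1 + (B - 1) * Real.sin (q 0) ^ 2) : ℝ) : ℂ) * partialDeriv 2 (partialDeriv 2 f) q := by
    rw [← partialDeriv_coef_mul r12 (d 1) (by decide),
      ← partialDeriv_coef_mul r22 (d 2) (by decide),
      ← partialDeriv_add 2 (cf r12 (d 1) q) (cf r22 (d 2) q)]
    congr 1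
    ext p
    simp only [volumeDensity_metric hA.ne' hB.ne', inv_metric hA.ne' hB.ne', Fin.sum_univ_three]
    simp [← hρ']
  have eX : ∀ i : Fin 3, i ≠ 0 → partialDeriv i (fieldX1 f) q =
      (Real.cos (q 0) : ℂ) * partialDeriv i (partialDeriv 1 f) q -
        (Real.sin (q 0) : ℂ) * partialDeriv i (partialDeriv 2 f) q := fun i hi => by
    rw [← partialDeriv_coef_mul hc (d 1) hi, ← partialDeriv_coef_mul hs (d 2) hi,
      ← partialDeriv_sub i (cf hc (d 1) q) (cf hs (d 2) q)]
    rfl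
  have hρc : (ρ : ℂ) ≠ 0 := by exact_mod_cast hρ
  rw [laplaceBeltrami, Fin.sum_univ_three, e0, e1, e2, volumeDensity_metric hA.ne' hB.ne',
    ← hρ', explicitLaplacian, fieldX1, eX 1 one_ne_zero, eX 2 (by decide)]
  push_cast
  field_simp
  ring

theorem partialDeriv_comp_add (i : Fin 3) {f : (Fin 3 → ℝ) → ℂ} {t : Fin 3 → ℝ}
    (h : ∀ q, f (q + t) = f q) (q : Fin 3 → ℝ) : partialDeriv i f (q + t) = partialDeriv i f q := by
  rw [partialDeriv, partialDeriv, ← fderiv_comp_add_right, funext h]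

variable (b : Module.Basis (Fin 2) ℝ (Fin 2 → ℝ))

/-- Functions on `ℝ³` which descend to the torus. -/
def IsPeriodic (f : (Fin 3 → ℝ) → ℂ) : Prop := ∀ t ∈ periods b, ∀ q, f (q + t) = f q

variable {b}

theorem isPeriodic_comp_proj (f : Torus b → ℂ) : IsPeriodic b (f ∘ proj b) := fun t ht q => by
  have : proj b (q + t) = proj b q := (QuotientAddGroup.mk_add_of_mem q ht)
  simp only [Function.comp_apply, this]

theorem IsPeriodic.partialDeriv {f : (Fin 3 → ℝ) → ℂ} (hf : IsPeriodic b f) (i : Fin 3) :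
    IsPeriodic b (partialDeriv i f) := fun t ht q => partialDeriv_comp_add i (hf t ht) q

theorem IsPeriodic.mul {f g : (Fin 3 → ℝ) → ℂ} (hf : IsPeriodic b f) (hg : IsPeriodic b g) :
    IsPeriodic b fun q => f q * g q := fun t ht q => by simp only [hf t ht q, hg t ht q]

theorem IsPeriodic.sub {f g : (Fin 3 → ℝ) → ℂ} (hf : IsPeriodic b f) (hg : IsPeriodic b g) :
    IsPeriodic b fun q => f q - g q := fun t ht q => by simp only [hf t ht q, hg t ht q]

/-- A `2π`-periodic function of `q_0` descends to the torus. -/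
theorem isPeriodic_comp_zero {E : Type*} {r : ℝ → E} (hr : Function.Periodic r (2 * Real.pi))
    (F : E → ℂ) : IsPeriodic b fun q => F (r (q 0)) := fun t ht q => by
  obtain ⟨n, hn⟩ := ht.1
  simp only [Pi.add_apply, hn]
  rw [mul_comm, hr.int_mul n]

theorem isPeriodic_cos : IsPeriodic b fun q => (Real.cos (q 0) : ℂ) :=
  isPeriodic_comp_zero Real.cos_periodic _

theorem isPeriodic_sin : IsPeriodic b fun q => (Real.sin (q 0) : ℂ) :=
  isPeriodic_comp_zero Real.sin_periodic _

theorem IsPeriodic.fieldX1 {f : (Fin 3 → ℝ) → ℂ} (hf : IsPeriodic b f) :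
    IsPeriodic b (fieldX1 f) :=
  (isPeriodic_cos.mul (hf.partialDeriv 1)).sub (isPeriodic_sin.mul (hf.partialDeriv 2))

theorem smooth_coef {r : ℝ → ℝ} (hr : ContDiff ℝ ∞ r) :
    Smooth fun q : Fin 3 → ℝ => ((r (q 0) : ℝ) : ℂ) :=
  Complex.ofRealCLM.contDiff.comp (hr.comp (contDiff_apply ℝ ℝ (0 : Fin 3)))

theorem Smooth.fieldX1 {f : (Fin 3 → ℝ) → ℂ} (hf : Smooth f) : Smooth (fieldX1 f) :=
  ((smooth_coef Real.contDiff_cos).mul (hf.partialDeriv 1)).sub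
    ((smooth_coef Real.contDiff_sin).mul (hf.partialDeriv 2))

theorem fieldX1_mul {f g : (Fin 3 → ℝ) → ℂ} (hf : Smooth f) (hg : Smooth g) (q : Fin 3 → ℝ) :
    fieldX1 (fun p => f p * g p) q = fieldX1 f q * g q + f q * fieldX1 g q := by
  simp only [fieldX1, partialDeriv_mul _ (hf.differentiable q) (hg.differentiable q)]
  ring

theorem IsPeriodic.explicitLaplacian {f : (Fin 3 → ℝ) → ℂ} (hf : IsPeriodic b f) (A B : ℝ) :
    IsPeriodic b (explicitLaplacian A B f) := fun t ht q => by
  simp only [Bianchi.explicitLaplacian]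
  rw [(hf.partialDeriv 0).partialDeriv 0 t ht, (hf.partialDeriv 1).partialDeriv 1 t ht,
    (hf.partialDeriv 2).partialDeriv 2 t ht, hf.fieldX1.fieldX1 t ht]

theorem Smooth.explicitLaplacian {f : (Fin 3 → ℝ) → ℂ} (hf : Smooth f) (A B : ℝ) :
    Smooth (explicitLaplacian A B f) :=
  (((contDiff_const.mul ((hf.partialDeriv 0).partialDeriv 0)).add
    ((hf.partialDeriv 1).partialDeriv 1)).add ((hf.partialDeriv 2).partialDeriv 2)).add
    (contDiff_const.mul hf.fieldX1.fieldX1)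

/-- The value of `torusLaplacian` does not depend on the representative of the point. -/
theorem torusLaplacian_proj {A B : ℝ} (hA : 0 < A) (hB : 0 < B) {f : Torus b → ℂ}
    (hf : IsSmooth b f) (q : Fin 3 → ℝ) :
    torusLaplacian A B b f (proj b q) = explicitLaplacian A B (f ∘ proj b) q := by
  rw [torusLaplacian, laplaceBeltrami_metric hA hB hf]
  have h : -Quotient.out (proj b q) + q ∈ periods b :=
    QuotientAddGroup.eq.1 (Quotient.out_eq (proj b q))
  have := (isPeriodic_comp_proj f).explicitLaplacian A B _ h (Quotient.out (proj b q))
  rw [← this, add_neg_cancel_left]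

theorem partialDeriv_conj (i : Fin 3) (f : (Fin 3 → ℝ) → ℂ) (q : Fin 3 → ℝ) :
    partialDeriv i (fun p => starRingEnd ℂ (f p)) q = starRingEnd ℂ (partialDeriv i f q) := by
  have := Complex.conjCLE.comp_fderiv (f := f) (x := q)
  exact congrArg (fun L => L (Pi.single i 1)) this

theorem fieldX1_conj (f : (Fin 3 → ℝ) → ℂ) (q : Fin 3 → ℝ) :
    fieldX1 (fun p => starRingEnd ℂ (f p)) q = starRingEnd ℂ (fieldX1 f q) := by
  simp only [fieldX1, partialDeriv_conj, map_sub, map_mul, Complex.conj_ofReal]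

theorem explicitLaplacian_conj (A B : ℝ) (f : (Fin 3 → ℝ) → ℂ) (q : Fin 3 → ℝ) :
    explicitLaplacian A B (fun p => starRingEnd ℂ (f p)) q =
      starRingEnd ℂ (explicitLaplacian A B f q) := by
  simp only [explicitLaplacian, funext (partialDeriv_conj _ f), funext (fieldX1_conj f),
    partialDeriv_conj, fieldX1_conj]
  simp

end

/-! ### Separation of variables -/

section

open scoped ContDiff

/-- The function `e^{i ⟨v, (q_1, q_2)⟩} g(q_0)`. -/
def wave (v : Fin 2 → ℝ) (g : ℝ → ℂ) (q : Fin 3 → ℝ) : ℂ :=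
  Complex.exp (Complex.I * ((v 0 * q 1 + v 1 * q 2 : ℝ) : ℂ)) * g (q 0)

theorem contDiff_wave {n : WithTop ℕ∞} (v : Fin 2 → ℝ) {g : ℝ → ℂ} (hg : ContDiff ℝ n g) :
    ContDiff ℝ n (wave v g) := by
  have h : ContDiff ℝ n fun q : Fin 3 → ℝ => v 0 * q 1 + v 1 * q 2 := by fun_prop
  have h2 : ContDiff ℝ n fun q : Fin 3 → ℝ => ((v 0 * q 1 + v 1 * q 2 : ℝ) : ℂ) :=
    Complex.ofRealCLM.contDiff.comp h
  exact (contDiff_const.mul h2).cexp.mul (hg.comp (contDiff_apply ℝ ℝ (0 : Fin 3)))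

theorem partialDeriv_zero_wave (v : Fin 2 → ℝ) {g g' : ℝ → ℂ} (hg : ContDiff ℝ 1 g)
    (h : ∀ x, HasDerivAt g (g' x) x) : partialDeriv 0 (wave v g) = wave v g' := by
  ext q
  refine partialDeriv_eq_of_hasDerivAt ((contDiff_wave v hg).differentiable (by simp) q) ?_
  have h1 : HasDerivAt (fun t : ℝ => g (q 0 + t)) (g' (q 0)) 0 := by
    have := (h (q 0 + 0)).comp_const_add (q 0) 0
    simpa using this
  simpa [wave] using h1.const_mul (Complex.exp (Complex.I * ((v 0 * q 1 + v 1 * q 2 : ℝ) : ℂ)))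

theorem hasDerivAt_exp_phase (c s : ℝ) :
    HasDerivAt (fun t : ℝ => Complex.exp (Complex.I * ((c + s * t : ℝ) : ℂ)))
      (Complex.I * s * Complex.exp (Complex.I * (c : ℂ))) 0 := by
  have h1 : HasDerivAt (fun t : ℝ => c + s * t) s 0 := by
    simpa using ((hasDerivAt_id (0 : ℝ)).const_mul s).const_add c
  have h2 := ((h1.ofReal_comp).const_mul Complex.I).cexp
  refine h2.congr_deriv ?_
  simp
  ring

theorem partialDeriv_one_wave (v : Fin 2 → ℝ) {g : ℝ → ℂ} (hg : ContDiff ℝ 1 g) (q : Fin 3 → ℝ) :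
    partialDeriv 1 (wave v g) q = Complex.I * v 0 * wave v g q := by
  refine partialDeriv_eq_of_hasDerivAt ((contDiff_wave v hg).differentiable (by simp) q) ?_
  have h := (hasDerivAt_exp_phase (v 0 * q 1 + v 1 * q 2) (v 0)).mul_const (g (q 0))
  refine (h.congr_deriv (by simp only [wave]; ring)).congr_of_eventuallyEq
    (Eventually.of_forall fun t => ?_)
  simp only [wave]
  congr 3
  · congr 1
    simp
    ring
  · simp

theorem partialDeriv_two_wave (v : Fin 2 → ℝ) {g : ℝ → ℂ} (hg : ContDiff ℝ 1 g) (q : Fin 3 → ℝ) :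
    partialDeriv 2 (wave v g) q = Complex.I * v 1 * wave v g q := by
  refine partialDeriv_eq_of_hasDerivAt ((contDiff_wave v hg).differentiable (by simp) q) ?_
  have h := (hasDerivAt_exp_phase (v 0 * q 1 + v 1 * q 2) (v 1)).mul_const (g (q 0))
  refine (h.congr_deriv (by simp only [wave]; ring)).congr_of_eventuallyEq
    (Eventually.of_forall fun t => ?_)
  simp only [wave]
  congr 3
  · congr 1
    simp
    ring
  · simp

theorem fieldX1_wave (v : Fin 2 → ℝ) {g : ℝ → ℂ} (hg : ContDiff ℝ 1 g) :
    fieldX1 (wave v g) =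
      wave v fun x => Complex.I * ((Real.cos x * v 0 - Real.sin x * v 1 : ℝ) : ℂ) * g x := by
  ext q
  rw [fieldX1, partialDeriv_one_wave v hg, partialDeriv_two_wave v hg]
  simp only [wave]
  push_cast
  ring

/-- On functions `e^{i ⟨v, (q_1, q_2)⟩} g(q_0)` the Laplacian acts as an ordinary differential
operator on `g`. -/
theorem explicitLaplacian_wave (A B : ℝ) (v : Fin 2 → ℝ) {g g' g'' : ℝ → ℂ} (hg : ContDiff ℝ ∞ g)
    (hg' : ContDiff ℝ ∞ g') (h : ∀ x, HasDerivAt g (g' x) x) (h' : ∀ x, HasDerivAt g' (g'' x) x)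
    (q : Fin 3 → ℝ) :
    explicitLaplacian A B (wave v g) q = wave v (fun x => A * g'' x -
      ((v 0 ^ 2 + v 1 ^ 2 + (B - 1) * (Real.cos x * v 0 - Real.sin x * v 1) ^ 2 : ℝ) : ℂ) * g x)
      q := by
  have g1 : ContDiff ℝ 1 g := hg.of_le (by simp)
  have s1 : ContDiff ℝ 1 fun x =>
      Complex.I * ((Real.cos x * v 0 - Real.sin x * v 1 : ℝ) : ℂ) * g x := by
    refine ContDiff.mul (contDiff_const.mul (Complex.ofRealCLM.contDiff.comp ?_)) g1
    exact (Real.contDiff_cos.mul contDiff_const).sub (Real.contDiff_sin.mul contDiff_const)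
  have w1 : Differentiable ℝ (wave v g) := (contDiff_wave v g1).differentiable (by simp)
  rw [explicitLaplacian, partialDeriv_zero_wave v g1 h,
    partialDeriv_zero_wave v (hg'.of_le (by simp)) h', fieldX1_wave v g1, fieldX1_wave v s1,
    funext (partialDeriv_one_wave v g1), funext (partialDeriv_two_wave v g1),
    partialDeriv_const_mul _ _ (w1 q), partialDeriv_const_mul _ _ (w1 q),
    partialDeriv_one_wave v g1, partialDeriv_two_wave v g1]
  simp only [wave]
  push_cast
  linear_combination ((v 0 : ℂ) ^ 2 + (v 1 : ℂ) ^ 2 +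
    (B - 1) * (Complex.cos (q 0) * v 0 - Complex.sin (q 0) * v 1) ^ 2) *
    Complex.exp (Complex.I * (v 0 * q 1 + v 1 * q 2)) * g (q 0) * Complex.I_sq

/-- The square of the symbol of `cos q_0 ∂_1 - sin q_0 ∂_2` at a dual vector, up to sign, in terms
of its polar coordinates. -/
theorem sq_symbol_fieldX1 (w : Fin 2 → Fin 2 → ℝ) (k : Fin 2 → ℤ) (x : ℝ) :
    (Real.cos x * dualVector w k 0 - Real.sin x * dualVector w k 1) ^ 2 =
      quadForm w k * Real.cos (x + shift w k) ^ 2 := by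
  set z : ℂ := ⟨dualVector w k 0, dualVector w k 1⟩ with hz
  have h0 : dualVector w k 0 = ‖z‖ * Real.cos (shift w k) := (Complex.norm_mul_cos_arg z).symm
  have h1 : dualVector w k 1 = ‖z‖ * Real.sin (shift w k) := (Complex.norm_mul_sin_arg z).symm
  have hQ : quadForm w k = ‖z‖ ^ 2 := by
    rw [Complex.sq_norm, Complex.normSq_apply, quadForm]; simp [hz, sq]
  rw [hQ, Real.cos_add, h0, h1]
  ring

theorem eigenfunction_inl (A B : ℝ) (w : Fin 2 → Fin 2 → ℝ) (φ : ℝ → ℕ → ℝ → ℝ) (m : ℤ) :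
    eigenfunction A B w φ (Sum.inl m) = wave 0 fun x => Complex.exp (Complex.I * m * x) := by
  ext q; simp [eigenfunction, wave]

theorem eigenfunction_inr (A B : ℝ) (w : Fin 2 → Fin 2 → ℝ) (φ : ℝ → ℕ → ℝ → ℝ)
    (k : {k : Fin 2 → ℤ // k ≠ 0}) (l : ℕ) :
    eigenfunction A B w φ (Sum.inr (k, l)) = wave (dualVector w k) fun x =>
      ((φ (mathieuParam A B w k) l (x + shift w k) : ℝ) : ℂ) := by
  ext q; rfl

theorem hasDerivAt_exp_I_mul (m : ℤ) (x : ℝ) :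
    HasDerivAt (fun x : ℝ => Complex.exp (Complex.I * m * x))
      (Complex.I * m * Complex.exp (Complex.I * m * x)) x := by
  have h2 := ((hasDerivAt_id x).ofReal_comp.const_mul (Complex.I * m)).cexp
  refine h2.congr_deriv ?_
  simp
  ring

theorem contDiff_exp_I_mul (m : ℤ) :
    ContDiff ℝ ∞ fun x : ℝ => Complex.exp (Complex.I * m * x) :=
  (contDiff_const.mul Complex.ofRealCLM.contDiff).cexp

theorem smooth_eigenfunction {A B : ℝ} {w : Fin 2 → Fin 2 → ℝ} {φ : ℝ → ℕ → ℝ → ℝ}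
    (hφ : ∀ μ, IsMathieuSystem μ (φ μ)) (i : Label) : Smooth (eigenfunction A B w φ i) := by
  rcases i with m | ⟨k, l⟩
  · rw [eigenfunction_inl]
    exact contDiff_wave _ (contDiff_exp_I_mul m)
  · rw [eigenfunction_inr]
    exact contDiff_wave _ (Complex.ofRealCLM.contDiff.comp
      (((hφ _).contDiff l).comp (contDiff_id.add contDiff_const)))

theorem explicitLaplacian_eigenfunction {A B : ℝ} (hA : 0 < A) {w : Fin 2 → Fin 2 → ℝ}
    {φ : ℝ → ℕ → ℝ → ℝ} (hφ : ∀ μ, IsMathieuSystem μ (φ μ)) (i : Label) (q : Fin 3 → ℝ) :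
    explicitLaplacian A B (eigenfunction A B w φ i) q =
      -((eigenvalue A B w i : ℂ) * eigenfunction A B w φ i q) := by
  rcases i with m | ⟨k, l⟩
  · rw [eigenfunction_inl, explicitLaplacian_wave A B 0 (contDiff_exp_I_mul m)
      (contDiff_const.mul (contDiff_exp_I_mul m)) (hasDerivAt_exp_I_mul m)
      (fun x => (hasDerivAt_exp_I_mul m x).const_mul _)]
    simp only [wave, eigenvalue]
    simp
    linear_combination (A * (m : ℂ) ^ 2 * Complex.exp (Complex.I * m * q 0)) * Complex.I_sq
  · set μ := mathieuParam A B w k with hμ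
    have hm := ((hφ μ).1 l).1
    have hc := (hφ μ).contDiff l
    have hc' : ContDiff ℝ ∞ (deriv (φ μ l)) := by
      rw [contDiff_infty_iff_deriv] at hc
      exact hc.2
    have sh : ContDiff ℝ ∞ fun x : ℝ => x + shift w k := contDiff_id.add contDiff_const
    rw [eigenfunction_inr, explicitLaplacian_wave A B _
      (g := fun x => ((φ μ l (x + shift w k) : ℝ) : ℂ))
      (g' := fun x => ((deriv (φ μ l) (x + shift w k) : ℝ) : ℂ))
      (g'' := fun x => (((μ * Real.cos (2 * (x + shift w k)) - mathieuEigenvalue μ l) *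
        φ μ l (x + shift w k) : ℝ) : ℂ))
      (Complex.ofRealCLM.contDiff.comp (hc.comp sh)) (Complex.ofRealCLM.contDiff.comp (hc'.comp sh))
      (fun x => ((hasDerivAt_of_mem_mathieuEigenspace hm _).comp_add_const x _).ofReal_comp)
      (fun x => ((hasDerivAt_deriv_of_mem_mathieuEigenspace hm _).comp_add_const x _).ofReal_comp)]
    simp only [wave, eigenvalue]
    rw [sq_symbol_fieldX1, ← quadForm, ← hμ, Real.cos_two_mul]
    have hAμ : A * μ = (B - 1) * quadForm w k / 2 := by
      rw [hμ, mathieuParam]; field_simp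
    have hAμ' : (A : ℂ) * μ = (B - 1) * quadForm w k / 2 := by exact_mod_cast hAμ
    push_cast
    linear_combination (Complex.exp (Complex.I *
      (dualVector w k 0 * q 1 + dualVector w k 1 * q 2)) * φ μ l (q 0 + shift w k) *
      (2 * Complex.cos (q 0 + shift w k) ^ 2 - 1)) * hAμ'

end

/-! ### The torus as a quotient -/

section

open scoped Pointwise

variable (b : Module.Basis (Fin 2) ℝ (Fin 2 → ℝ))

/-- The basis `(2π, 0, 0), (0, b_0), (0, b_1)` of `ℝ³`, which generates the group of periods; it is
given by its coordinate functions. -/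
def periodBasis : Module.Basis (Fin 3) ℝ (Fin 3 → ℝ) :=
  Module.Basis.ofEquivFun
    { toFun := fun q => ![q 0 / (2 * Real.pi), b.repr ![q 1, q 2] 0, b.repr ![q 1, q 2] 1]
      map_add' := fun p q => by
        have h : ![(p + q) 1, (p + q) 2] = ![p 1, p 2] + ![q 1, q 2] := by
          ext i; fin_cases i <;> simp
        rw [h, map_add]
        ext i; fin_cases i <;> simp [add_div]
      map_smul' := fun c q => by
        have h : ![(c • q) 1, (c • q) 2] = c • ![q 1, q 2] := by
          ext i; fin_cases i <;> simp
        rw [h, map_smul]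
        ext i; fin_cases i <;> simp [mul_div_assoc]
      invFun := fun x => ![2 * Real.pi * x 0, (b.equivFun.symm ![x 1, x 2]) 0,
        (b.equivFun.symm ![x 1, x 2]) 1]
      left_inv := fun q => by
        have h : b.equivFun.symm ![b.repr ![q 1, q 2] 0, b.repr ![q 1, q 2] 1] = ![q 1, q 2] := by
          rw [LinearEquiv.symm_apply_eq]
          ext i; fin_cases i <;> simp
        have := Real.pi_ne_zero
        ext i
        fin_cases i
        · simp; field_simp
        · simp [h]
        · simp [h]
      right_inv := fun x => by
        have h : ![(b.equivFun.symm ![x 1, x 2]) 0, (b.equivFun.symm ![x 1, x 2]) 1] =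
            b.equivFun.symm ![x 1, x 2] := by
          ext i; fin_cases i <;> rfl
        have h2 : ∀ i, b.repr (b.equivFun.symm ![x 1, x 2]) i = ![x 1, x 2] i := fun i => by
          rw [← Module.Basis.equivFun_apply, LinearEquiv.apply_symm_apply]
        ext i
        fin_cases i
        · simp [Real.pi_ne_zero]
        · exact (congrArg (fun v => b.repr v 0) h).trans (h2 0)
        · exact (congrArg (fun v => b.repr v 1) h).trans (h2 1) }

theorem periodBasis_repr (q : Fin 3 → ℝ) (i : Fin 3) : (periodBasis b).repr q i =
    ![q 0 / (2 * Real.pi), b.repr ![q 1, q 2] 0, b.repr ![q 1, q 2] 1] i := rfl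

theorem mem_lattice_iff (v : Fin 2 → ℝ) : v ∈ lattice b ↔ ∀ i, ∃ n : ℤ, b.repr v i = n := by
  rw [lattice, b.mem_span_iff_repr_mem ℤ]
  simp [Set.mem_range, eq_comm]

theorem periods_eq : periods b = (Submodule.span ℤ (Set.range (periodBasis b))).toAddSubgroup := by
  ext q
  rw [Submodule.mem_toAddSubgroup, (periodBasis b).mem_span_iff_repr_mem ℤ]
  change ((∃ n : ℤ, q 0 = 2 * Real.pi * n) ∧ ![q 1, q 2] ∈ lattice b) ↔ _
  rw [mem_lattice_iff, Fin.forall_fin_two, Fin.forall_fin_succ, Fin.forall_fin_two]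
  simp only [periodBasis_repr]
  refine and_congr ?_ (and_congr ?_ ?_)
  · simp only [Matrix.cons_val_zero, Set.mem_range, algebraMap_int_eq, eq_intCast]
    exact exists_congr fun n => by
      rw [eq_div_iff Real.two_pi_pos.ne', mul_comm, eq_comm]
  · simp [Set.mem_range, eq_comm]
  · simp [Set.mem_range, eq_comm]

theorem cell_eq : cell b = ZSpan.fundamentalDomain (periodBasis b) := by
  ext q
  rw [ZSpan.mem_fundamentalDomain, Fin.forall_fin_succ, Fin.forall_fin_two]
  change (q 0 ∈ Set.Ico 0 (2 * Real.pi) ∧ ![q 1, q 2] ∈ ZSpan.fundamentalDomain b) ↔ _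
  rw [ZSpan.mem_fundamentalDomain, Fin.forall_fin_two]
  simp only [periodBasis_repr]
  refine and_congr ?_ (and_congr Iff.rfl Iff.rfl)
  simp only [Matrix.cons_val_zero, Set.mem_Ico]
  rw [le_div_iff₀ Real.two_pi_pos, div_lt_one Real.two_pi_pos, zero_mul]

instance : DiscreteTopology (periods b) := by
  rw [periods_eq]; infer_instance

instance : Countable (periods b) := by
  rw [periods_eq]
  change Countable (Submodule.span ℤ (Set.range (periodBasis b)))
  infer_instance

theorem isBounded_cell : Bornology.IsBounded (cell b) := by
  rw [cell_eq]; exact ZSpan.fundamentalDomain_isBounded _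

theorem volume_cell_lt_top : volume (cell b) < ∞ := (isBounded_cell b).measure_lt_top

theorem isAddFundamentalDomain_cell : IsAddFundamentalDomain (periods b) (cell b) volume := by
  rw [cell_eq, periods_eq]
  exact ZSpan.isAddFundamentalDomain' _ _

theorem exists_mem_cell (q : Fin 3 → ℝ) : ∃ p ∈ cell b, proj b p = proj b q := by
  obtain ⟨v, hv, -⟩ := ZSpan.exist_unique_vadd_mem_fundamentalDomain (periodBasis b) q
  refine ⟨v +ᵥ q, by rwa [cell_eq], ?_⟩
  have hm : (v : Fin 3 → ℝ) ∈ periods b := by rw [periods_eq]; exact v.2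
  have : v +ᵥ q = q + v := add_comm _ _
  rw [this]
  exact QuotientAddGroup.mk_add_of_mem q hm

theorem continuous_proj : Continuous (proj b) := continuous_quot_mk

instance : CompactSpace (Torus b) := by
  have h : IsCompact (proj b '' closure (cell b)) :=
    (isBounded_cell b).isCompact_closure.image (continuous_proj b)
  refine ⟨h.of_isClosed_subset isClosed_univ fun x _ => ?_⟩
  obtain ⟨q, rfl⟩ := QuotientAddGroup.mk_surjective x
  obtain ⟨p, hp, hpq⟩ := exists_mem_cell b q
  exact ⟨p, subset_closure hp, hpq⟩

theorem torusVolume_eq {A B : ℝ} (hA : 0 < A) (hB : 0 < B) :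
    torusVolume A B b = ENNReal.ofReal √(A⁻¹ * B⁻¹) •
      Measure.map (proj b) (volume.restrict (cell b)) := by
  rw [torusVolume]
  simp_rw [volumeDensity_metric hA.ne' hB.ne']
  rw [withDensity_const, Measure.restrict_smul, Measure.map_smul]

theorem isFiniteMeasure_torusVolume {A B : ℝ} (hA : 0 < A) (hB : 0 < B) :
    IsFiniteMeasure (torusVolume A B b) := by
  rw [torusVolume_eq b hA hB]
  have : IsFiniteMeasure (volume.restrict (cell b)) :=
    isFiniteMeasure_restrict.2 (volume_cell_lt_top b).ne
  exact Measure.smul_finite _ ENNReal.ofReal_ne_top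

theorem integral_torusVolume {A B : ℝ} (hA : 0 < A) (hB : 0 < B) {F : Torus b → ℂ}
    (hF : Continuous F) : ∫ x, F x ∂(torusVolume A B b) =
      √(A⁻¹ * B⁻¹) * ∫ q in cell b, F (proj b q) := by
  rw [torusVolume_eq b hA hB, integral_smul_measure,
    integral_map (continuous_proj b).measurable.aemeasurable
      hF.measurable.aestronglyMeasurable, ENNReal.toReal_ofReal (by positivity)]
  simp

variable {b}

/-- The translate of the cell is another fundamental domain of the periods. -/
theorem setIntegral_cell_comp_add {F : (Fin 3 → ℝ) → ℂ} (hF : IsPeriodic b F) (t : Fin 3 → ℝ) :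
    ∫ q in cell b, F (q + t) = ∫ q in cell b, F q := by
  have h := isAddFundamentalDomain_cell b
  have h2 : IsAddFundamentalDomain (periods b) (t +ᵥ cell b) volume := h.vadd_of_comm t
  have h3 : ∫ q in t +ᵥ cell b, F q = ∫ q in cell b, F q :=
    h2.setIntegral_eq h fun g x => by
      rw [show g +ᵥ x = x + (g : Fin 3 → ℝ) from add_comm _ _]
      exact hF g g.2 x
  rw [← h3]
  have h4 : t +ᵥ cell b = (fun q => q + t) '' cell b := by
    ext q
    simp only [Set.mem_vadd_set, Set.mem_image, vadd_eq_add, add_comm]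
  rw [h4, (measurePreserving_add_right volume t).setIntegral_image_emb
    (measurableEmbedding_addRight t)]

/-- A function which some translation multiplies by a constant other than `1` has integral `0`. -/
theorem setIntegral_cell_eq_zero {F : (Fin 3 → ℝ) → ℂ} (hF : IsPeriodic b F) (t : Fin 3 → ℝ)
    {c : ℂ} (hc : c ≠ 1) (h : ∀ q, F (q + t) = c * F q) : ∫ q in cell b, F q = 0 := by
  have h1 := setIntegral_cell_comp_add hF t
  simp_rw [h] at h1
  rw [integral_const_mul] at h1
  have : (c - 1) * ∫ q in cell b, F q = 0 := by linear_combination h1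
  exact (mul_eq_zero.1 this).resolve_left (sub_ne_zero.2 hc)

variable (b) in
/-- The area of the fundamental parallelogram of the lattice. -/
def cellArea : ℝ := volume.real (ZSpan.fundamentalDomain b)

variable (b) in
theorem cellArea_pos : 0 < cellArea b := by
  refine ENNReal.toReal_pos (ZSpan.measure_fundamentalDomain_ne_zero b) ?_
  exact (ZSpan.fundamentalDomain_isBounded b).measure_lt_top.ne

/-- The integral over the cell of a function of `q_0` alone. -/
theorem setIntegral_cell_zero (g : ℝ → ℂ) :
    ∫ q in cell b, g (q 0) = cellArea b * ∫ x in (0 : ℝ)..(2 * Real.pi), g x := by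
  have hmp := volume_preserving_piFinSuccAbove (fun _ : Fin 3 => ℝ) 0
  set e := MeasurableEquiv.piFinSuccAbove (fun _ : Fin 3 => ℝ) 0 with he
  have hcell : cell b = e ⁻¹' (Set.Ico 0 (2 * Real.pi) ×ˢ ZSpan.fundamentalDomain b) := by
    ext q
    have h1 : (e q).1 = q 0 := rfl
    have h2 : (e q).2 = ![q 1, q 2] := by
      ext i; fin_cases i <;> rfl
    simp only [Set.mem_preimage, Set.mem_prod, h1, h2]
    rfl
  have h := hmp.setIntegral_preimage_emb e.measurableEmbedding (fun z => g z.1 * 1)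
    (Set.Ico 0 (2 * Real.pi) ×ˢ ZSpan.fundamentalDomain b)
  rw [← hcell] at h
  have h0 : ∫ q in cell b, g (q 0) = ∫ q in cell b, g (e q).1 * 1 := by
    simp_rw [mul_one]; rfl
  rw [h0, h, Measure.volume_eq_prod, setIntegral_prod_mul g (fun _ => (1 : ℂ)),
    intervalIntegral.integral_of_le Real.two_pi_pos.le, ← integral_Ico_eq_integral_Ioc, mul_comm]
  congr 1
  simp [cellArea]

end

/-! ### Symmetry of the Laplacian -/

section

variable {b : Module.Basis (Fin 2) ℝ (Fin 2 → ℝ)}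

theorem IsPeriodic.eq_of_proj_eq {f : (Fin 3 → ℝ) → ℂ} (hf : IsPeriodic b f) {p q : Fin 3 → ℝ}
    (h : proj b p = proj b q) : f p = f q := by
  have := hf _ (QuotientAddGroup.eq.1 h) p
  rw [← this, add_neg_cancel_left]

theorem IsPeriodic.exists_norm_le {f : (Fin 3 → ℝ) → ℂ} (hf : IsPeriodic b f)
    (hc : Continuous f) : ∃ C, ∀ q, ‖f q‖ ≤ C := by
  obtain ⟨C, hC⟩ := (isBounded_cell b).isCompact_closure.exists_bound_of_continuousOn
    hc.continuousOn
  refine ⟨C, fun q => ?_⟩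
  obtain ⟨p, hp, hpq⟩ := exists_mem_cell b q
  rw [← hf.eq_of_proj_eq hpq]
  exact hC p (subset_closure hp)

theorem integrableOn_cell {f : (Fin 3 → ℝ) → ℂ} (hc : Continuous f) :
    IntegrableOn f (cell b) :=
  (hc.continuousOn.integrableOn_compact (isBounded_cell b).isCompact_closure).mono_set
    subset_closure

/-- The integral of a partial derivative over the torus vanishes, because the integral of
`q ↦ f (q + t e_i)` does not depend on `t`. -/
theorem setIntegral_cell_partialDeriv {f : (Fin 3 → ℝ) → ℂ} (hf : Smooth f)
    (hp : IsPeriodic b f) (i : Fin 3) : ∫ q in cell b, partialDeriv i f q = 0 := by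
  obtain ⟨C, hC⟩ := (hp.partialDeriv i).exists_norm_le (hf.partialDeriv i).continuous
  have hcont : ∀ t : ℝ, Continuous fun q : Fin 3 → ℝ => q + t • (Pi.single i 1 : Fin 3 → ℝ) :=
    fun t => by fun_prop
  have hd : ∀ (q : Fin 3 → ℝ) (t : ℝ), HasDerivAt
      (fun s : ℝ => f (q + s • (Pi.single i 1 : Fin 3 → ℝ)))
      (partialDeriv i f (q + t • (Pi.single i 1 : Fin 3 → ℝ))) t := fun q t => by
    have h1 : HasDerivAt (fun s : ℝ => q + s • (Pi.single i 1 : Fin 3 → ℝ))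
        (Pi.single i 1 : Fin 3 → ℝ) t := by
      simpa using ((hasDerivAt_id t).smul_const (Pi.single i 1 : Fin 3 → ℝ)).const_add q
    exact (hf.differentiable _).hasFDerivAt.comp_hasDerivAt t h1
  have hfin : IsFiniteMeasure (volume.restrict (cell b)) :=
    isFiniteMeasure_restrict.2 (volume_cell_lt_top b).ne
  have h := (hasDerivAt_integral_of_dominated_loc_of_deriv_le (μ := volume.restrict (cell b))
    (F := fun (t : ℝ) q => f (q + t • (Pi.single i 1 : Fin 3 → ℝ)))
    (F' := fun (t : ℝ) q => partialDeriv i f (q + t • (Pi.single i 1 : Fin 3 → ℝ)))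
    (x₀ := (0 : ℝ)) (bound := fun _ => C) Filter.univ_mem
    (Eventually.of_forall fun t => (hf.continuous.comp (hcont t)).aestronglyMeasurable)
    (integrableOn_cell (hf.continuous.comp (hcont 0)))
    ((hf.partialDeriv i).continuous.comp (hcont 0)).aestronglyMeasurable
    (Eventually.of_forall fun q t _ => hC _) (integrable_const C)
    (Eventually.of_forall fun q t _ => hd q t)).2
  have h2 : (fun t : ℝ => ∫ q in cell b, f (q + t • (Pi.single i 1 : Fin 3 → ℝ))) =
      fun _ => ∫ q in cell b, f q := funext fun t => setIntegral_cell_comp_add hp _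
  rw [h2] at h
  simpa using h.unique (hasDerivAt_const _ _)

/-- The field `cos q_0 ∂_1 - sin q_0 ∂_2` is divergence-free. -/
theorem setIntegral_cell_fieldX1 {f : (Fin 3 → ℝ) → ℂ} (hf : Smooth f)
    (hp : IsPeriodic b f) : ∫ q in cell b, fieldX1 f q = 0 := by
  have hc := Real.differentiable_cos
  have hs := Real.differentiable_sin
  have s1 := (smooth_coef Real.contDiff_cos).mul hf
  have s2 := (smooth_coef Real.contDiff_sin).mul hf
  have e : ∀ q, fieldX1 f q = partialDeriv 1 (fun p => ((Real.cos (p 0) : ℝ) : ℂ) * f p) q -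
      partialDeriv 2 (fun p => ((Real.sin (p 0) : ℝ) : ℂ) * f p) q := fun q => by
    rw [partialDeriv_coef_mul hc hf.differentiable one_ne_zero,
      partialDeriv_coef_mul hs hf.differentiable (by decide)]
    rfl
  simp_rw [e]
  rw [integral_sub (integrableOn_cell (Smooth.partialDeriv s1 1).continuous)
    (integrableOn_cell (Smooth.partialDeriv s2 2).continuous),
    setIntegral_cell_partialDeriv s1 (isPeriodic_cos.mul hp),
    setIntegral_cell_partialDeriv s2 (isPeriodic_sin.mul hp), sub_zero]

/-- The square of a divergence-free derivation is symmetric. -/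
theorem setIntegral_cell_derivation_sq (D : ((Fin 3 → ℝ) → ℂ) → (Fin 3 → ℝ) → ℂ)
    (hs : ∀ f, Smooth f → Smooth (D f)) (hper : ∀ f, IsPeriodic b f → IsPeriodic b (D f))
    (hmul : ∀ f g, Smooth f → Smooth g → ∀ q, D (fun p => f p * g p) q = D f q * g q + f q * D g q)
    (hint : ∀ f, Smooth f → IsPeriodic b f → ∫ q in cell b, D f q = 0)
    {f g : (Fin 3 → ℝ) → ℂ} (hf : Smooth f) (hg : Smooth g) (pf : IsPeriodic b f)
    (pg : IsPeriodic b g) :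
    ∫ q in cell b, D (D f) q * g q = ∫ q in cell b, f q * D (D g) q := by
  have parts : ∀ {u v : (Fin 3 → ℝ) → ℂ}, Smooth u → Smooth v → IsPeriodic b u → IsPeriodic b v →
      (∫ q in cell b, D u q * v q) + ∫ q in cell b, u q * D v q = 0 := by
    intro u v su sv pu pv
    have h := hint _ (su.mul sv) (pu.mul pv)
    simp_rw [hmul u v su sv] at h
    have c₁ := (hs u su).continuous
    have c₂ := (hs v sv).continuous
    have c₃ := su.continuous
    have c₄ := sv.continuous
    rwa [integral_add (integrableOn_cell (by fun_prop)) (integrableOn_cell (by fun_prop))] at h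
  have h1 := parts (hs f hf) hg (hper f pf) pg
  have h2 := parts hf (hs g hg) pf (hper g pg)
  linear_combination h1 - h2

/-- The Laplacian is a combination of squares of the divergence-free derivations `∂_0`, `∂_1`, `∂_2`
and `cos q_0 ∂_1 - sin q_0 ∂_2`, hence symmetric. -/
theorem setIntegral_cell_explicitLaplacian_mul (A B : ℝ) {f g : (Fin 3 → ℝ) → ℂ} (hf : Smooth f)
    (hg : Smooth g) (pf : IsPeriodic b f) (pg : IsPeriodic b g) :
    ∫ q in cell b, explicitLaplacian A B f q * g q =
      ∫ q in cell b, f q * explicitLaplacian A B g q := by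
  have hpd := fun i => setIntegral_cell_derivation_sq (b := b) (partialDeriv i)
    (fun f hf => hf.partialDeriv i) (fun f hf => hf.partialDeriv i)
    (fun f g hf hg q => partialDeriv_mul i (hf.differentiable q) (hg.differentiable q))
    (fun f hf pf => setIntegral_cell_partialDeriv hf pf i) hf hg pf pg
  have hX := setIntegral_cell_derivation_sq (b := b) fieldX1
    (fun f hf => hf.fieldX1) (fun f hf => hf.fieldX1)
    (fun f g hf hg q => fieldX1_mul hf hg q)
    (fun f hf pf => setIntegral_cell_fieldX1 hf pf) hf hg pf pg
  have expand : ∀ {F₀ F₁ F₂ F₃ : (Fin 3 → ℝ) → ℂ}, Continuous F₀ → Continuous F₁ →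
      Continuous F₂ → Continuous F₃ →
      ∫ q in cell b, (A * F₀ q + F₁ q + F₂ q + (B - 1) * F₃ q : ℂ) =
      A * (∫ q in cell b, F₀ q) + (∫ q in cell b, F₁ q) + (∫ q in cell b, F₂ q) +
        (B - 1) * ∫ q in cell b, F₃ q := by
    intro F₀ F₁ F₂ F₃ h₀ h₁ h₂ h₃
    rw [integral_add (integrableOn_cell (by fun_prop)) (integrableOn_cell (by fun_prop)),
      integral_add (integrableOn_cell (by fun_prop)) (integrableOn_cell (by fun_prop)),
      integral_add (integrableOn_cell (by fun_prop)) (integrableOn_cell (by fun_prop)),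
      integral_const_mul, integral_const_mul]
  have el : ∀ q, explicitLaplacian A B f q * g q = A * (partialDeriv 0 (partialDeriv 0 f) q * g q) +
      partialDeriv 1 (partialDeriv 1 f) q * g q + partialDeriv 2 (partialDeriv 2 f) q * g q +
      (B - 1) * (fieldX1 (fieldX1 f) q * g q) := fun q => by rw [explicitLaplacian]; ring
  have er : ∀ q, f q * explicitLaplacian A B g q = A * (f q * partialDeriv 0 (partialDeriv 0 g) q) +
      f q * partialDeriv 1 (partialDeriv 1 g) q + f q * partialDeriv 2 (partialDeriv 2 g) q +
      (B - 1) * (f q * fieldX1 (fieldX1 g) q) := fun q => by rw [explicitLaplacian]; ring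
  simp_rw [el, er]
  have cf := hf.continuous
  have cg := hg.continuous
  have cf' := fun i => ((hf.partialDeriv i).partialDeriv i).continuous
  have cg' := fun i => ((hg.partialDeriv i).partialDeriv i).continuous
  have cfX := hf.fieldX1.fieldX1.continuous
  have cgX := hg.fieldX1.fieldX1.continuous
  rw [expand (by fun_prop) (by fun_prop) (by fun_prop) (by fun_prop),
    expand (by fun_prop) (by fun_prop) (by fun_prop) (by fun_prop), hpd 0, hpd 1, hpd 2, hX]

end

/-! ### Continuous functions and characters on the torus -/

section

variable {b : Module.Basis (Fin 2) ℝ (Fin 2 → ℝ)} {ω : Fin 2 → Fin 2 → ℝ}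

variable (b) in
/-- The continuous functions on `ℝ³` which descend to the torus. -/
def periodicContinuous : Submodule ℂ ((Fin 3 → ℝ) → ℂ) where
  carrier := {f | Continuous f ∧ IsPeriodic b f}
  zero_mem' := ⟨continuous_const, fun _ _ _ => rfl⟩
  add_mem' := fun {f g} hf hg => ⟨hf.1.add hg.1, fun t ht q => by
    simp only [Pi.add_apply, hf.2 t ht q, hg.2 t ht q]⟩
  smul_mem' := fun c f hf => ⟨continuous_const.smul hf.1, fun t ht q => by
    simp only [Pi.smul_apply, hf.2 t ht q]⟩

variable (b) in
/-- The function on the torus induced by a periodic function on `ℝ³`; without periodicity it depends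
on the chosen representatives. -/
def descend (f : (Fin 3 → ℝ) → ℂ) (x : Torus b) : ℂ := f (Quotient.out x)

theorem descend_proj {f : (Fin 3 → ℝ) → ℂ} (hf : IsPeriodic b f) (q : Fin 3 → ℝ) :
    descend b f (proj b q) = f q :=
  hf.eq_of_proj_eq (Quotient.out_eq (proj b q))

theorem descend_comp_proj {f : (Fin 3 → ℝ) → ℂ} (hf : IsPeriodic b f) :
    descend b f ∘ proj b = f := funext fun q => descend_proj hf q

theorem continuous_of_comp_proj {F : Torus b → ℂ} (h : Continuous (F ∘ proj b)) : Continuous F :=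
  (QuotientAddGroup.isQuotientMap_mk (periods b)).continuous_iff.2 h

variable (b) in
/-- Periodic continuous functions as continuous functions on the torus. -/
def descendLinear : periodicContinuous b →ₗ[ℂ] C(Torus b, ℂ) where
  toFun f := ⟨descend b f.1, continuous_of_comp_proj (by
    rw [descend_comp_proj f.2.2]; exact f.2.1)⟩
  map_add' _ _ := rfl
  map_smul' _ _ := rfl

theorem descendLinear_proj (f : periodicContinuous b) (q : Fin 3 → ℝ) :
    descendLinear b f (proj b q) = f.1 q := descend_proj f.2.2 q

theorem dualVector_eq (k : Fin 2 → ℤ) : dualVector ω k = ∑ i, k i • ω i := by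
  ext j; simp [dualVector]

theorem dualVector_mem (k : Fin 2 → ℤ) : dualVector ω k ∈ Submodule.span ℤ (Set.range ω) := by
  rw [dualVector_eq]
  exact Submodule.sum_mem _ fun i _ => Submodule.smul_mem _ _ (Submodule.subset_span ⟨i, rfl⟩)

theorem exists_dualVector_eq {v : Fin 2 → ℝ} (hv : v ∈ Submodule.span ℤ (Set.range ω)) :
    ∃ k, dualVector ω k = v := by
  obtain ⟨k, hk⟩ := (Submodule.mem_span_range_iff_exists_fun ℤ).1 hv
  exact ⟨k, by rw [dualVector_eq, hk]⟩

theorem dualVector_injective (hω : IsDualBasis b ω) : Function.Injective (dualVector ω) := by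
  intro k k' h
  have h' : ∑ i, k i • ω i = ∑ i, k' i • ω i := by rw [← dualVector_eq, ← dualVector_eq, h]
  have := Fintype.linearIndependent_iff.1 hω.1 (k - k') (by
    simp only [Pi.sub_apply, sub_smul, Finset.sum_sub_distrib, h', sub_self])
  ext i
  exact sub_eq_zero.1 (this i)

theorem dualVector_add (k k' : Fin 2 → ℤ) (j : Fin 2) :
    dualVector ω (k + k') j = dualVector ω k j + dualVector ω k' j := by
  simp only [dualVector, Pi.add_apply, Int.cast_add, add_mul, Finset.sum_add_distrib]

theorem dualVector_neg (k : Fin 2 → ℤ) (j : Fin 2) : dualVector ω (-k) j = -dualVector ω k j := by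
  simp [dualVector]

theorem dualVector_zero : dualVector ω 0 = 0 := by
  ext j; simp [dualVector]

theorem isPeriodic_wave (hω : IsDualBasis b ω) (k : Fin 2 → ℤ) {g : ℝ → ℂ}
    (hg : Function.Periodic g (2 * Real.pi)) : IsPeriodic b (wave (dualVector ω k) g) := by
  intro t ht q
  have h1 : g ((q + t) 0) = g (q 0) := isPeriodic_comp_zero (b := b) hg id t ht q
  obtain ⟨n, hn⟩ := (hω.2 _).1 (dualVector_mem k) _ ht.2
  rw [wave, wave, h1, Pi.add_apply, Pi.add_apply]
  congr 1
  rw [Complex.exp_eq_exp_iff_exists_int]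
  refine ⟨n, ?_⟩
  have hn' : dualVector ω k 0 * t 1 + dualVector ω k 1 * t 2 = 2 * Real.pi * n := by
    simpa [dotProduct, Fin.sum_univ_two] using hn
  have hn'' : (dualVector ω k 0 * t 1 + dualVector ω k 1 * t 2 : ℂ) = 2 * Real.pi * n := by
    exact_mod_cast hn'
  push_cast
  linear_combination Complex.I * hn''

/-- `e^{i (k, Ωq)} g(q_0)` for continuous `2π`-periodic `g`, as a function on the torus. -/
def torusWave (hω : IsDualBasis b ω) (k : Fin 2 → ℤ) (g : ℝ → ℂ) (hc : Continuous g)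
    (hg : Function.Periodic g (2 * Real.pi)) : periodicContinuous b :=
  ⟨wave (dualVector ω k) g, (contDiff_wave (n := 0) _ (contDiff_zero.2 hc)).continuous,
    isPeriodic_wave hω k hg⟩

theorem periodic_exp_I_mul (m : ℤ) :
    Function.Periodic (fun x : ℝ => Complex.exp (Complex.I * m * x)) (2 * Real.pi) := fun x => by
  rw [Complex.exp_eq_exp_iff_exists_int]
  exact ⟨m, by push_cast; ring⟩

/-- The characters `e^{i (k, Ωq)} e^{i m q_0}` of the torus. -/
def character (hω : IsDualBasis b ω) (a : (Fin 2 → ℤ) × ℤ) : periodicContinuous b :=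
  torusWave hω a.1 (fun x => Complex.exp (Complex.I * a.2 * x)) (by fun_prop)
    (periodic_exp_I_mul a.2)

theorem character_apply (hω : IsDualBasis b ω) (a : (Fin 2 → ℤ) × ℤ) (q : Fin 3 → ℝ) :
    (character hω a).1 q = Complex.exp (Complex.I *
      ((dualVector ω a.1 0 * q 1 + dualVector ω a.1 1 * q 2 + a.2 * q 0 : ℝ) : ℂ)) := by
  simp only [character, torusWave, wave]
  rw [← Complex.exp_add]
  congr 1
  push_cast
  ring

/-- The characters as continuous functions on the torus. -/
def torusCharacter (hω : IsDualBasis b ω) (a : (Fin 2 → ℤ) × ℤ) : C(Torus b, ℂ) :=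
  descendLinear b (character hω a)

theorem torusCharacter_proj (hω : IsDualBasis b ω) (a : (Fin 2 → ℤ) × ℤ) (q : Fin 3 → ℝ) :
    torusCharacter hω a (proj b q) = Complex.exp (Complex.I *
      ((dualVector ω a.1 0 * q 1 + dualVector ω a.1 1 * q 2 + a.2 * q 0 : ℝ) : ℂ)) := by
  rw [torusCharacter, descendLinear_proj, character_apply]

theorem torusCharacter_add (hω : IsDualBasis b ω) (a a' : (Fin 2 → ℤ) × ℤ) :
    torusCharacter hω (a + a') = torusCharacter hω a * torusCharacter hω a' := by
  ext x
  obtain ⟨q, rfl⟩ : ∃ q, proj b q = x := QuotientAddGroup.mk_surjective x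
  rw [ContinuousMap.mul_apply, torusCharacter_proj, torusCharacter_proj, torusCharacter_proj,
    ← Complex.exp_add]
  congr 1
  simp only [Prod.fst_add, Prod.snd_add, dualVector_add]
  push_cast
  ring

theorem torusCharacter_zero (hω : IsDualBasis b ω) : torusCharacter hω 0 = 1 := by
  ext x
  obtain ⟨q, rfl⟩ : ∃ q, proj b q = x := QuotientAddGroup.mk_surjective x
  rw [torusCharacter_proj]
  simp [dualVector_zero]

theorem torusCharacter_neg (hω : IsDualBasis b ω) (a : (Fin 2 → ℤ) × ℤ) :
    torusCharacter hω (-a) = star (torusCharacter hω a) := by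
  ext x
  obtain ⟨q, rfl⟩ : ∃ q, proj b q = x := QuotientAddGroup.mk_surjective x
  rw [ContinuousMap.star_apply, torusCharacter_proj, torusCharacter_proj, Complex.star_def,
    ← Complex.exp_conj]
  congr 1
  simp only [Prod.fst_neg, Prod.snd_neg, dualVector_neg, map_mul, Complex.conj_I,
    Complex.conj_ofReal]
  push_cast
  ring

/-- The star subalgebra of continuous functions generated by the characters. -/
def characterSubalgebra (hω : IsDualBasis b ω) : StarSubalgebra ℂ C(Torus b, ℂ) where
  toSubalgebra := Algebra.adjoin ℂ (Set.range (torusCharacter hω))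
  star_mem' := by
    change Algebra.adjoin ℂ (Set.range (torusCharacter hω)) ≤
      star (Algebra.adjoin ℂ (Set.range (torusCharacter hω)))
    refine Algebra.adjoin_le ?_
    rintro - ⟨a, rfl⟩
    exact Algebra.subset_adjoin ⟨-a, torusCharacter_neg hω a⟩

theorem characterSubalgebra_toSubmodule (hω : IsDualBasis b ω) :
    Subalgebra.toSubmodule (characterSubalgebra hω).toSubalgebra =
      Submodule.span ℂ (Set.range (torusCharacter hω)) := by
  apply Algebra.adjoin_eq_span_of_subset
  refine Set.Subset.trans ?_ Submodule.subset_span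
  intro x hx
  refine Submonoid.closure_induction (fun _ => id) ⟨0, torusCharacter_zero hω⟩ ?_ hx
  rintro - - - - ⟨a, rfl⟩ ⟨a', rfl⟩
  exact ⟨a + a', torusCharacter_add hω a a'⟩

/-- The vector `v` with `⟨v, x⟩ = 2π` times the `j`-th coordinate of `x`; these vectors belong to
the dual lattice, and their characters detect the coordinates modulo `ℤ`. -/
theorem exists_dualVector_dotProduct (hω : IsDualBasis b ω) (j : Fin 2) :
    ∃ k, ∀ x : Fin 2 → ℝ, dualVector ω k ⬝ᵥ x = 2 * Real.pi * b.repr x j := by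
  let v : Fin 2 → ℝ := fun i => 2 * Real.pi * b.repr (Pi.single i 1) j
  have hv : ∀ x : Fin 2 → ℝ, v ⬝ᵥ x = 2 * Real.pi * b.repr x j := fun x => by
    have hx : x = ∑ i, x i • (Pi.single i 1 : Fin 2 → ℝ) := by
      ext i; simp [Pi.single_apply]
    conv_rhs => rw [hx]
    simp only [dotProduct, v, map_sum, map_smul, Finsupp.coe_finsetSum, Finsupp.coe_smul,
      Finset.sum_apply, Pi.smul_apply, smul_eq_mul, Finset.mul_sum]
    exact Finset.sum_congr rfl fun i _ => by ring
  obtain ⟨k, hk⟩ := exists_dualVector_eq ((hω.2 v).2 fun ℓ hℓ => by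
    obtain ⟨n, hn⟩ := (mem_lattice_iff b ℓ).1 hℓ j
    exact ⟨n, by rw [hv, hn]⟩)
  exact ⟨k, fun x => by rw [hk, hv]⟩

theorem characterSubalgebra_separatesPoints (hω : IsDualBasis b ω) :
    (characterSubalgebra hω).SeparatesPoints := by
  intro x y hxy
  obtain ⟨p, rfl⟩ : ∃ q, proj b q = x := QuotientAddGroup.mk_surjective x
  obtain ⟨q, rfl⟩ : ∃ q, proj b q = y := QuotientAddGroup.mk_surjective y
  by_contra! hcon
  have key : ∀ a, torusCharacter hω a (proj b p) = torusCharacter hω a (proj b q) := fun a =>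
    hcon _ ⟨torusCharacter hω a, Algebra.subset_adjoin ⟨a, rfl⟩, rfl⟩
  have key2 : ∀ (k : Fin 2 → ℤ) (m : ℤ), ∃ n : ℤ,
      dualVector ω k ⬝ᵥ ![(-p + q) 1, (-p + q) 2] + m * (-p + q) 0 = 2 * Real.pi * n := by
    intro k m
    have h := (key (k, m)).symm
    rw [torusCharacter_proj, torusCharacter_proj, Complex.exp_eq_exp_iff_exists_int] at h
    obtain ⟨n, hn⟩ := h
    refine ⟨n, ?_⟩
    have hn2 : Complex.I * (((dualVector ω k 0 * q 1 + dualVector ω k 1 * q 2 + m * q 0) -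
        (dualVector ω k 0 * p 1 + dualVector ω k 1 * p 2 + m * p 0) : ℝ) : ℂ) =
        Complex.I * ((2 * Real.pi * n : ℝ) : ℂ) := by
      push_cast at hn ⊢
      linear_combination hn
    have hn3 := Complex.ofReal_injective (mul_left_cancel₀ Complex.I_ne_zero hn2)
    simp only [dotProduct, Fin.sum_univ_two, Matrix.cons_val_zero, Matrix.cons_val_one,
      Pi.add_apply, Pi.neg_apply]
    linear_combination hn3
  refine hxy (QuotientAddGroup.eq.2 ⟨?_, ?_⟩)
  · obtain ⟨n, hn⟩ := key2 0 1
    exact ⟨n, by simpa [dualVector_zero] using hn⟩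
  · rw [mem_lattice_iff]
    intro j
    obtain ⟨k, hk⟩ := exists_dualVector_dotProduct hω j
    obtain ⟨n, hn⟩ := key2 k 0
    refine ⟨n, ?_⟩
    rw [hk, Int.cast_zero, zero_mul, add_zero] at hn
    exact mul_left_cancel₀ Real.two_pi_pos.ne' hn

/-- The Stone-Weierstrass theorem for the characters of the torus. -/
theorem span_torusCharacter_closure_eq_top (hω : IsDualBasis b ω) :
    (Submodule.span ℂ (Set.range (torusCharacter hω))).topologicalClosure = ⊤ := by
  rw [← characterSubalgebra_toSubmodule]
  exact congr_arg (Subalgebra.toSubmodule <| StarSubalgebra.toSubalgebra ·)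
    (ContinuousMap.starSubalgebra_topologicalClosure_eq_top_of_separatesPoints _
      (characterSubalgebra_separatesPoints hω))

/-! ### The Hilbert space -/

variable {A B : ℝ} [hA : Fact (0 < A)] [hB : Fact (0 < B)]

/-! The positivity of `A` and `B` is carried by `Fact` instances, so that finiteness of the volume
is found by instance search. -/

instance : IsFiniteMeasure (torusVolume A B b) := isFiniteMeasure_torusVolume b hA.out hB.out

variable (A B b) in
/-- Periodic continuous functions as elements of `L²` of the torus. -/
def toL2 : periodicContinuous b →ₗ[ℂ] TorusL2 A B b :=
  (ContinuousMap.toLp 2 (torusVolume A B b) ℂ).toLinearMap ∘ₗ descendLinear b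

theorem coeFn_toL2 (f : periodicContinuous b) :
    toL2 b A B f =ᵐ[torusVolume A B b] descend b f.1 :=
  ContinuousMap.coeFn_toLp _ _

theorem inner_toL2 (f g : periodicContinuous b) : inner ℂ (toL2 b A B f) (toL2 b A B g) =
    √(A⁻¹ * B⁻¹) * ∫ q in cell b, starRingEnd ℂ (f.1 q) * g.1 q := by
  have h := ContinuousMap.inner_toLp (𝕜 := ℂ) (torusVolume A B b) (descendLinear b f)
    (descendLinear b g)
  rw [integral_torusVolume b hA.out hB.out (by fun_prop)] at h
  refine h.trans ?_
  simp_rw [descendLinear_proj, mul_comm]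

/-- The characters are complete in `L²` of the torus. -/
theorem eq_zero_of_inner_character_eq_zero (hω : IsDualBasis b ω) {u : TorusL2 A B b}
    (h : ∀ a, inner ℂ (toL2 b A B (character hω a)) u = 0) : u = 0 := by
  have hd := (ContinuousMap.toLp_denseRange ℂ (torusVolume A B b) ℂ
    (p := 2) (by simp)).topologicalClosure_map_submodule (span_torusCharacter_closure_eq_top hω)
  rw [Submodule.map_span] at hd
  have hperp : u ∈ (Submodule.span ℂ (((ContinuousMap.toLp 2 (torusVolume A B b) ℂ :
      C(Torus b, ℂ) →L[ℂ] TorusL2 A B b) : C(Torus b, ℂ) →ₗ[ℂ] TorusL2 A B b) ''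
      Set.range (torusCharacter hω)))ᗮ := by
    rw [Submodule.mem_orthogonal]
    intro v hv
    induction hv using Submodule.span_induction with
    | mem v hv => obtain ⟨_, ⟨a, rfl⟩, rfl⟩ := hv; exact h a
    | zero => simp
    | add v w _ _ hv hw => rw [inner_add_left, hv, hw, add_zero]
    | smul c v _ hv => rw [inner_smul_left, hv, mul_zero]
  rw [← Submodule.orthogonal_closure] at hperp
  rw [hd, Submodule.top_orthogonal_eq_bot] at hperp
  exact hperp

end

/-! ### The eigenfunctions form a basis -/

section

variable {b : Module.Basis (Fin 2) ℝ (Fin 2 → ℝ)} {ω : Fin 2 → Fin 2 → ℝ}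
  {A B : ℝ} [hA : Fact (0 < A)] [hB : Fact (0 < B)]

theorem IsPeriodic.conj {f : (Fin 3 → ℝ) → ℂ} (hf : IsPeriodic b f) :
    IsPeriodic b fun q => starRingEnd ℂ (f q) := fun t ht q => by simp only [hf t ht q]

/-- Waves of different frequencies are orthogonal: the translation by `π v / |v|²` in the plane,
where `v` is the difference of the frequencies, multiplies the integrand by `-1`. -/
theorem inner_wave_of_ne (hω : IsDualBasis b ω) {k k' : Fin 2 → ℤ} (hk : k ≠ k')
    {g g' : ℝ → ℂ} {F F' : periodicContinuous b} (hF : F.1 = wave (dualVector ω k) g)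
    (hF' : F'.1 = wave (dualVector ω k') g') : inner ℂ (toL2 b A B F) (toL2 b A B F') = 0 := by
  rw [inner_toL2]
  refine mul_eq_zero_of_right _ ?_
  set v : Fin 2 → ℝ := dualVector ω k' - dualVector ω k with hv
  have hv0 : v ≠ 0 := fun h => hk (dualVector_injective hω (sub_eq_zero.1 h)).symm
  have hN : v 0 * v 0 + v 1 * v 1 ≠ 0 := by
    intro h
    rw [mul_self_add_mul_self_eq_zero] at h
    exact hv0 (by ext i; fin_cases i; exacts [h.1, h.2])
  set s : ℝ := Real.pi / (v 0 * v 0 + v 1 * v 1) with hs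
  refine setIntegral_cell_eq_zero (F.2.2.conj.mul F'.2.2)
    ![0, s * v 0, s * v 1] (c := -1) (by norm_num) fun q => ?_
  have hsv : s * (v 0 * v 0 + v 1 * v 1) = Real.pi := div_mul_cancel₀ _ hN
  have e : ∀ q : Fin 3 → ℝ, starRingEnd ℂ (F.1 q) * F'.1 q =
      Complex.exp (Complex.I * ((v 0 * q 1 + v 1 * q 2 : ℝ) : ℂ)) *
      (starRingEnd ℂ (g (q 0)) * g' (q 0)) := fun q => by
    have : Complex.exp (Complex.I * ((v 0 * q 1 + v 1 * q 2 : ℝ) : ℂ)) =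
        starRingEnd ℂ (Complex.exp (Complex.I *
          ((dualVector ω k 0 * q 1 + dualVector ω k 1 * q 2 : ℝ) : ℂ))) *
        Complex.exp (Complex.I *
          ((dualVector ω k' 0 * q 1 + dualVector ω k' 1 * q 2 : ℝ) : ℂ)) := by
      rw [← Complex.exp_conj, ← Complex.exp_add, map_mul, Complex.conj_I, Complex.conj_ofReal]
      congr 1
      simp only [hv, Pi.sub_apply]
      push_cast
      ring
    rw [this, hF, hF']
    simp only [wave, map_mul]
    ring
  have h0 : (q + ![0, s * v 0, s * v 1]) 0 = q 0 := by simp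
  have h1 : (v 0 * (q + ![0, s * v 0, s * v 1]) 1 + v 1 * (q + ![0, s * v 0, s * v 1]) 2 : ℝ) =
      (v 0 * q 1 + v 1 * q 2) + Real.pi := by
    simp
    linear_combination hsv
  rw [e, e, h0, h1, Complex.ofReal_add, mul_add, Complex.exp_add,
    mul_comm Complex.I (Real.pi : ℂ), Complex.exp_pi_mul_I]
  ring

/-- The constant relating the norms of waves in `L²` of the torus and of the circle. -/
def waveConst (A B : ℝ) (b : Module.Basis (Fin 2) ℝ (Fin 2 → ℝ)) : ℝ :=
  √(A⁻¹ * B⁻¹) * cellArea b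

theorem waveConst_pos : 0 < waveConst A B b :=
  mul_pos (Real.sqrt_pos.2 (mul_pos (inv_pos.2 hA.out) (inv_pos.2 hB.out))) (cellArea_pos b)

theorem inner_wave {v : Fin 2 → ℝ} {g g' : ℝ → ℂ} {F F' : periodicContinuous b}
    (hF : F.1 = wave v g) (hF' : F'.1 = wave v g') :
    inner ℂ (toL2 b A B F) (toL2 b A B F') = (waveConst A B b : ℂ) *
        ∫ x in (0 : ℝ)..(2 * Real.pi), starRingEnd ℂ (g x) * g' x := by
  rw [inner_toL2]
  have e : ∀ q : Fin 3 → ℝ, starRingEnd ℂ (F.1 q) * F'.1 q =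
      starRingEnd ℂ (g (q 0)) * g' (q 0) := fun q => by
    have : starRingEnd ℂ (Complex.exp (Complex.I * ((v 0 * q 1 + v 1 * q 2 : ℝ) : ℂ))) *
        Complex.exp (Complex.I * ((v 0 * q 1 + v 1 * q 2 : ℝ) : ℂ)) = 1 := by
      rw [← Complex.exp_conj, ← Complex.exp_add, map_mul, Complex.conj_I, Complex.conj_ofReal]
      simp
    rw [hF, hF']
    simp only [wave, map_mul]
    linear_combination (starRingEnd ℂ (g (q 0)) * g' (q 0)) * this
  simp_rw [e]
  rw [setIntegral_cell_zero fun x => starRingEnd ℂ (g x) * g' x, waveConst]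
  push_cast
  ring

/-- The functions `e^{i (k, Ωq)} h(q_0 + α)` with `h` real, depending linearly on `h`. -/
def shiftedWave (hω : IsDualBasis b ω) (k : Fin 2 → ℤ) (α : ℝ) :
    continuousPeriodic →ₗ[ℝ] periodicContinuous b where
  toFun h := torusWave hω k (fun x => ((h.1 (x + α) : ℝ) : ℂ))
    (Complex.continuous_ofReal.comp (h.2.1.comp (continuous_add_const α)))
    fun x => by simp only [add_right_comm, h.2.2 _]
  map_add' h h' := by
    ext q
    simp [torusWave, wave, mul_add]
  map_smul' c h := by
    ext q
    simp [torusWave, wave, mul_left_comm]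

theorem inner_shiftedWave (hω : IsDualBasis b ω) (k : Fin 2 → ℤ) (α : ℝ)
    (h h' : continuousPeriodic) :
    inner ℂ (toL2 b A B (shiftedWave hω k α h)) (toL2 b A B (shiftedWave hω k α h')) =
      ((waveConst A B b * ∫ x in (0 : ℝ)..(2 * Real.pi), h.1 x * h'.1 x : ℝ) : ℂ) := by
  have hp : Function.Periodic (fun x => h.1 x * h'.1 x) (2 * Real.pi) := h.2.2.mul h'.2.2
  have e := intervalIntegral.integral_comp_add_right (a := 0) (b := 2 * Real.pi)
    (fun x => h.1 x * h'.1 x) α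
  rw [zero_add, add_comm (2 * Real.pi) α, hp.intervalIntegral_add_eq α 0, zero_add] at e
  refine (inner_wave (g := fun x => ((h.1 (x + α) : ℝ) : ℂ))
    (g' := fun x => ((h'.1 (x + α) : ℝ) : ℂ)) rfl rfl).trans ?_
  simp only [Complex.conj_ofReal]
  rw [← e, Complex.ofReal_mul, ← intervalIntegral.integral_ofReal]
  simp only [Complex.ofReal_mul]

theorem norm_sq_shiftedWave (hω : IsDualBasis b ω) (k : Fin 2 → ℤ) (α : ℝ)
    (h : continuousPeriodic) : ‖toL2 b A B (shiftedWave hω k α h)‖ ^ 2 =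
      waveConst A B b * ∫ x in (0 : ℝ)..(2 * Real.pi), h.1 x ^ 2 := by
  have := inner_shiftedWave (A := A) (B := B) hω k α h h
  rw [inner_self_eq_norm_sq_to_K] at this
  simp_rw [sq (h.1 _)]
  exact Complex.ofReal_injective ((Complex.ofReal_pow _ _).trans this)

variable {φ : ℝ → ℕ → ℝ → ℝ}

variable (A B) in
/-- The eigenfunctions as periodic continuous functions. -/
def eigenElement (hω : IsDualBasis b ω) (hφ : ∀ μ, IsMathieuSystem μ (φ μ)) :
    Label → periodicContinuous b
  | Sum.inl m => character hω (0, m)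
  | Sum.inr (k, l) => shiftedWave hω k (shift ω k)
      ⟨φ (mathieuParam A B ω k) l, (hφ _).mem_continuousPeriodic l⟩

omit hA hB in
theorem coe_eigenElement (hω : IsDualBasis b ω) (hφ : ∀ μ, IsMathieuSystem μ (φ μ)) (i : Label) :
    (eigenElement A B hω hφ i).1 = eigenfunction A B ω φ i := by
  rcases i with m | ⟨k, l⟩
  · rw [eigenfunction_inl, ← dualVector_zero (ω := ω)]
    rfl
  · rw [eigenfunction_inr]
    rfl

omit hA hB in
theorem coe_eigenElement_inl (hω : IsDualBasis b ω) (hφ : ∀ μ, IsMathieuSystem μ (φ μ)) (m : ℤ) :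
    (eigenElement A B hω hφ (Sum.inl m)).1 =
      wave (dualVector ω 0) fun x => Complex.exp (Complex.I * m * x) := rfl

omit hA hB in
theorem coe_eigenElement_inr (hω : IsDualBasis b ω) (hφ : ∀ μ, IsMathieuSystem μ (φ μ))
    (k : {k : Fin 2 → ℤ // k ≠ 0}) (l : ℕ) :
    (eigenElement A B hω hφ (Sum.inr (k, l))).1 = wave (dualVector ω k) fun x =>
      ((φ (mathieuParam A B ω k) l (x + shift ω k) : ℝ) : ℂ) := rfl

theorem integral_exp_I_mul {m : ℤ} (hm : m ≠ 0) :
    ∫ x in (0 : ℝ)..(2 * Real.pi), Complex.exp (Complex.I * m * x) = 0 := by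
  rw [integral_exp_mul_complex (by simpa using hm)]
  have := periodic_exp_I_mul m 0
  simp only [zero_add] at this
  rw [this, sub_self, zero_div]

theorem inner_character_zero (hω : IsDualBasis b ω) (m m' : ℤ) :
    inner ℂ (toL2 b A B (character hω (0, m))) (toL2 b A B (character hω (0, m'))) =
      if m = m' then ((waveConst A B b * (2 * Real.pi) : ℝ) : ℂ) else 0 := by
  refine (inner_wave (g := fun x => Complex.exp (Complex.I * m * x))
    (g' := fun x => Complex.exp (Complex.I * m' * x)) rfl rfl).trans ?_
  have e : ∀ x : ℝ, starRingEnd ℂ (Complex.exp (Complex.I * m * x)) *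
      Complex.exp (Complex.I * m' * x) = Complex.exp (Complex.I * ((m' - m : ℤ) : ℂ) * x) := by
    intro x
    rw [← Complex.exp_conj, ← Complex.exp_add]
    congr 1
    simp only [map_mul, Complex.conj_I, Complex.conj_ofReal, map_intCast]
    push_cast
    ring
  simp_rw [e]
  split_ifs with h
  · subst h
    simp [waveConst]
  · rw [integral_exp_I_mul (sub_ne_zero.2 (Ne.symm h)), mul_zero]

theorem inner_eigenElement_of_ne (hω : IsDualBasis b ω) (hφ : ∀ μ, IsMathieuSystem μ (φ μ))
    {i j : Label} (hij : i ≠ j) :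
    inner ℂ (toL2 b A B (eigenElement A B hω hφ i))
      (toL2 b A B (eigenElement A B hω hφ j)) = 0 := by
  rcases i with m | ⟨k, l⟩ <;> rcases j with m' | ⟨k', l'⟩
  · rw [eigenElement, eigenElement, inner_character_zero, if_neg fun h => hij (by rw [h])]
  · exact inner_wave_of_ne hω k'.2.symm (coe_eigenElement_inl hω hφ m)
      (coe_eigenElement_inr hω hφ k' l')
  · exact inner_wave_of_ne hω k.2 (coe_eigenElement_inr hω hφ k l)
      (coe_eigenElement_inl hω hφ m')
  · by_cases hk : k = k'
    · subst hk
      refine (inner_shiftedWave hω k (shift ω k) _ _).trans ?_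
      rw [(hφ _).2 l l' fun h => hij (by rw [h])]
      simp
    · exact inner_wave_of_ne hω (fun h => hk (Subtype.ext h)) (coe_eigenElement_inr hω hφ k l)
        (coe_eigenElement_inr hω hφ k' l')

theorem toL2_eigenElement_ne_zero (hω : IsDualBasis b ω) (hφ : ∀ μ, IsMathieuSystem μ (φ μ))
    (i : Label) : toL2 b A B (eigenElement A B hω hφ i) ≠ 0 := by
  have hC := waveConst_pos (A := A) (B := B) (b := b)
  rcases i with m | ⟨k, l⟩
  · intro h
    have h2 := inner_character_zero (A := A) (B := B) hω m m
    rw [if_pos rfl, show character hω (0, m) = eigenElement A B hω hφ (Sum.inl m) from rfl, h,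
      inner_zero_left] at h2
    exact (mul_pos hC Real.two_pi_pos).ne (by exact_mod_cast h2)
  · intro h
    have h2 := norm_sq_shiftedWave (A := A) (B := B) hω k (shift ω k)
      ⟨φ (mathieuParam A B ω k) l, (hφ _).mem_continuousPeriodic l⟩
    rw [show shiftedWave hω k (shift ω k) ⟨φ (mathieuParam A B ω k) l,
      (hφ _).mem_continuousPeriodic l⟩ = eigenElement A B hω hφ (Sum.inr (k, l)) from rfl, h,
      norm_zero] at h2
    have hm := (hφ (mathieuParam A B ω k)).mem_continuousPeriodic l
    have h3 := integral_sq_pos hm.1 hm.2 ((hφ _).1 l).2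
    simp only [sq, mul_zero] at h2
    exact (mul_pos hC h3).ne h2

/-- Within one frequency `k`, the Mathieu functions approximate every `cas(mx)`, so what is
orthogonal to the former is orthogonal to the latter. -/
theorem inner_shiftedWave_cas_eq_zero (hω : IsDualBasis b ω) {μ : ℝ} {y : ℕ → ℝ → ℝ}
    (hy : IsMathieuSystem μ y) (k : Fin 2 → ℤ) (α : ℝ) {u : TorusL2 A B b}
    (hu : ∀ l, inner ℂ (toL2 b A B (shiftedWave hω k α ⟨y l, hy.mem_continuousPeriodic l⟩)) u = 0)
    (m : ℤ) : inner ℂ (toL2 b A B (shiftedWave hω k α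
      ⟨cas m, continuous_cas m, periodic_cas m⟩)) u = 0 := by
  have hspan : ∀ p ∈ Submodule.span ℝ (Set.range y), ∃ hp : p ∈ continuousPeriodic,
      inner ℂ (toL2 b A B (shiftedWave hω k α ⟨p, hp⟩)) u = 0 := by
    intro p hp
    induction hp using Submodule.span_induction with
    | mem p hp => obtain ⟨l, rfl⟩ := hp; exact ⟨_, hu l⟩
    | zero =>
      refine ⟨Submodule.zero_mem _, ?_⟩
      rw [show (⟨0, Submodule.zero_mem _⟩ : continuousPeriodic) = 0 from rfl, map_zero, map_zero,
        inner_zero_left]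
    | add p p' _ _ hp hp' =>
      obtain ⟨h, e⟩ := hp
      obtain ⟨h', e'⟩ := hp'
      refine ⟨Submodule.add_mem _ h h', ?_⟩
      rw [show (⟨p + p', Submodule.add_mem _ h h'⟩ : continuousPeriodic) = ⟨p, h⟩ + ⟨p', h'⟩ from
        rfl, map_add, map_add, inner_add_left, e, e', add_zero]
    | smul c p _ hp =>
      obtain ⟨h, e⟩ := hp
      refine ⟨Submodule.smul_mem _ c h, ?_⟩
      rw [show (⟨c • p, Submodule.smul_mem _ c h⟩ : continuousPeriodic) = c • ⟨p, h⟩ from rfl,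
        map_smul, LinearMap.map_smul_of_tower, RCLike.real_smul_eq_coe_smul (K := ℂ),
        inner_smul_left, e, mul_zero]
  set a := toL2 b A B (shiftedWave hω k α ⟨cas m, continuous_cas m, periodic_cas m⟩) with ha
  have hC := waveConst_pos (A := A) (B := B) (b := b)
  -- replacing `cas(mx)` by a combination of the `y_l` with squared error `ε` changes the inner
  -- product with `u` by at most `√(ε K)`
  set K := waveConst A B b * ‖u‖ ^ 2 with hK
  have hK0 : 0 ≤ K := by positivity
  have bound : ∀ ε : ℝ, 0 < ε → ‖inner ℂ a u‖ ^ 2 ≤ ε * K := by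
    intro ε hε
    obtain ⟨p, hp, hpε⟩ := hy.exists_span_near m hε
    obtain ⟨hp', hpu⟩ := hspan p hp
    set a' := toL2 b A B (shiftedWave hω k α ⟨p, hp'⟩) with ha'
    have h1 : inner ℂ a u = inner ℂ (a - a') u := by rw [inner_sub_left, hpu, sub_zero]
    have h2 : ‖a - a'‖ ^ 2 ≤ waveConst A B b * ε := by
      rw [ha, ha', ← map_sub, ← map_sub, norm_sq_shiftedWave]
      exact mul_le_mul_of_nonneg_left hpε.le hC.le
    rw [h1]
    calc ‖inner ℂ (a - a') u‖ ^ 2 ≤ (‖a - a'‖ * ‖u‖) ^ 2 := by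
          gcongr; exact norm_inner_le_norm _ _
      _ = ‖a - a'‖ ^ 2 * ‖u‖ ^ 2 := mul_pow _ _ _
      _ ≤ (waveConst A B b * ε) * ‖u‖ ^ 2 := by gcongr
      _ = ε * K := by rw [hK]; ring
  by_contra h
  have hpos : 0 < ‖inner ℂ a u‖ ^ 2 := by positivity
  have h3 := bound (‖inner ℂ a u‖ ^ 2 / (K + 1)) (by positivity)
  rw [div_mul_eq_mul_div, le_div_iff₀ (by positivity)] at h3
  nlinarith

theorem exp_I_mul_eq_cas (m : ℤ) (x : ℝ) : Complex.exp (Complex.I * m * x) =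
    (1 + Complex.I) / 2 * cas m x + (1 - Complex.I) / 2 * cas (-m) x := by
  rw [show Complex.I * m * x = ((m * x : ℝ) : ℂ) * Complex.I by push_cast; ring,
    Complex.exp_mul_I, ← Complex.ofReal_cos, ← Complex.ofReal_sin]
  simp only [cas, Int.cast_neg, neg_mul, Real.cos_neg, Real.sin_neg]
  push_cast
  ring

/-- The eigenfunctions are complete in `L²` of the torus. -/
theorem eq_zero_of_inner_eigenElement_eq_zero (hω : IsDualBasis b ω)
    (hφ : ∀ μ, IsMathieuSystem μ (φ μ)) {u : TorusL2 A B b}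
    (hu : ∀ i, inner ℂ (toL2 b A B (eigenElement A B hω hφ i)) u = 0) : u = 0 := by
  refine eq_zero_of_inner_character_eq_zero hω ?_
  rintro ⟨k, m⟩
  by_cases hk : k = 0
  · subst hk
    exact hu (Sum.inl m)
  · set α := shift ω k with hα
    have hcas := inner_shiftedWave_cas_eq_zero hω (hφ (mathieuParam A B ω k)) k α
      (fun l => hu (Sum.inr (⟨k, hk⟩, l)))
    -- a character is a combination of two shifted Hartley waves of the same frequency
    have e : character hω (k, m) = Complex.exp (-(Complex.I * m * α)) •
        (((1 + Complex.I) / 2) • shiftedWave hω k α ⟨cas m, continuous_cas m, periodic_cas m⟩ +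
        ((1 - Complex.I) / 2) • shiftedWave hω k α
          ⟨cas (-m), continuous_cas (-m), periodic_cas (-m)⟩) := by
      ext q
      have h1 := exp_I_mul_eq_cas m (q 0 + α)
      have h2 : Complex.exp (Complex.I * m * (q 0 : ℝ)) = Complex.exp (-(Complex.I * m * α)) *
          Complex.exp (Complex.I * m * (q 0 + α : ℝ)) := by
        rw [← Complex.exp_add]
        congr 1
        push_cast
        ring
      simp only [character, torusWave, wave, shiftedWave, LinearMap.coe_mk, AddHom.coe_mk,
        Submodule.coe_smul, Submodule.coe_add, Pi.smul_apply, Pi.add_apply, smul_eq_mul]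
      rw [h2, h1]
      ring
    rw [e, map_smul, map_add, map_smul, map_smul, inner_smul_left, inner_add_left,
      inner_smul_left, inner_smul_left, hcas m, hcas (-m)]
    simp

/-- The normalised eigenfunctions. -/
def unitEigenvector (hω : IsDualBasis b ω) (hφ : ∀ μ, IsMathieuSystem μ (φ μ)) (i : Label) :
    TorusL2 A B b :=
  ((‖toL2 b A B (eigenElement A B hω hφ i)‖⁻¹ : ℝ) : ℂ) • toL2 b A B (eigenElement A B hω hφ i)

theorem orthonormal_unitEigenvector (hω : IsDualBasis b ω) (hφ : ∀ μ, IsMathieuSystem μ (φ μ)) :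
    Orthonormal ℂ (unitEigenvector (A := A) (B := B) hω hφ) := by
  refine ⟨fun i => ?_, fun i j hij => ?_⟩
  · have := norm_ne_zero_iff.2 (toL2_eigenElement_ne_zero (A := A) (B := B) hω hφ i)
    rw [unitEigenvector, norm_smul, Complex.norm_real, norm_inv, norm_norm, inv_mul_cancel₀ this]
  · change inner ℂ (((‖toL2 b A B (eigenElement A B hω hφ i)‖⁻¹ : ℝ) : ℂ) • _)
      (((‖toL2 b A B (eigenElement A B hω hφ j)‖⁻¹ : ℝ) : ℂ) • _) = 0
    rw [inner_smul_left, inner_smul_right, inner_eigenElement_of_ne hω hφ hij, mul_zero, mul_zero]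

/-- The Hilbert basis of normalised eigenfunctions. -/
def eigenBasis (hω : IsDualBasis b ω) (hφ : ∀ μ, IsMathieuSystem μ (φ μ)) :
    HilbertBasis Label ℂ (TorusL2 A B b) :=
  HilbertBasis.mkOfOrthogonalEqBot (orthonormal_unitEigenvector hω hφ) <| by
    rw [Submodule.eq_bot_iff]
    intro u hu
    refine eq_zero_of_inner_eigenElement_eq_zero hω hφ fun i => ?_
    have h := (Submodule.mem_orthogonal _ _).1 hu _ (Submodule.subset_span ⟨i, rfl⟩)
    rw [unitEigenvector, inner_smul_left] at h
    refine (mul_eq_zero.1 h).resolve_left ?_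
    have := toL2_eigenElement_ne_zero (A := A) (B := B) hω hφ i
    simpa using this

theorem eigenBasis_apply (hω : IsDualBasis b ω) (hφ : ∀ μ, IsMathieuSystem μ (φ μ)) (i : Label) :
    eigenBasis (A := A) (B := B) hω hφ i =
      ((‖toL2 b A B (eigenElement A B hω hφ i)‖⁻¹ : ℝ) : ℂ) •
        toL2 b A B (eigenElement A B hω hφ i) := by
  rw [eigenBasis, HilbertBasis.coe_mkOfOrthogonalEqBot]
  rfl

end

/-! ### The spectrum -/

section

/-- The spectrum of an operator which is diagonal in a Hilbert basis, with eigenvalues that do not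
accumulate. -/
theorem graphSpectrum_eq_image_range {ι H : Type*} [NormedAddCommGroup H] [InnerProductSpace ℂ H]
    (e : HilbertBasis ι ℂ H) {E : ι → ℝ} (hE : ∀ c, {i | E i ≤ c}.Finite) {G : H → H → Prop}
    (hG : ∀ u v, G u v ↔ ∀ i, (E i : ℂ) * e.repr u i = e.repr v i) :
    graphSpectrum G = Complex.ofReal '' Set.range E := by
  classical
  ext z
  rw [graphSpectrum, Set.mem_ofPred_eq, not_iff_comm]
  constructor
  · intro hz
    -- the distances `|E i - z|` are bounded below, so `(E i - z)⁻¹` defines a bounded inverse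
    have hz' : ∀ i, (E i : ℂ) - z ≠ 0 := fun i h => hz ⟨E i, ⟨i, rfl⟩, sub_eq_zero.1 h⟩
    obtain ⟨δ, hδ, hδ1, hδE⟩ : ∃ δ : ℝ, 0 < δ ∧ δ ≤ 1 ∧
        ∀ i ∈ {i | E i ≤ z.re + 1}, δ ≤ ‖(E i : ℂ) - z‖ := by
      have h : ∀ᶠ δ : ℝ in 𝓝[>] 0, ∀ i ∈ {i | E i ≤ z.re + 1}, δ ≤ ‖(E i : ℂ) - z‖ :=
        (eventually_all_finite (hE _)).2 fun i _ =>
          (eventually_le_nhds (norm_pos_iff.2 (hz' i))).filter_mono nhdsWithin_le_nhds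
      have h1 : ∀ᶠ δ : ℝ in 𝓝[>] 0, δ ≤ 1 :=
        (eventually_le_nhds one_pos).filter_mono nhdsWithin_le_nhds
      have h0 : ∀ᶠ δ : ℝ in 𝓝[>] 0, 0 < δ := self_mem_nhdsWithin
      obtain ⟨δ, h2, h3, h4⟩ := (h0.and (h1.and h)).exists
      exact ⟨δ, h2, h3, h4⟩
    have hδ' : ∀ i, δ ≤ ‖(E i : ℂ) - z‖ := fun i => by
      by_cases hi : E i ≤ z.re + 1
      · exact hδE i hi
      · have := Complex.re_le_norm ((E i : ℂ) - z)
        rw [Complex.sub_re, Complex.ofReal_re] at this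
        linarith
    have hw : ∀ i, ‖((E i : ℂ) - z)⁻¹‖ ≤ δ⁻¹ := fun i => by
      rw [norm_inv]
      exact inv_anti₀ hδ (hδ' i)
    set R : H →L[ℂ] H := (e.repr.symm.toContinuousLinearEquiv : _ →L[ℂ] H) ∘L
      (diagOp (fun i => ((E i : ℂ) - z)⁻¹) δ⁻¹ (inv_pos.2 hδ).le hw) ∘L
      (e.repr.toContinuousLinearEquiv : H →L[ℂ] _) with hR
    have hRe : ∀ u i, e.repr (R u) i = ((E i : ℂ) - z)⁻¹ * e.repr u i := fun u i => by
      simp [hR]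
    refine ⟨R, fun u => (hG _ _).2 fun i => ?_, fun u v h => e.repr.injective ?_⟩
    · rw [map_add, map_smul, lp.coeFn_add, lp.coeFn_smul, Pi.add_apply, Pi.smul_apply, hRe,
        smul_eq_mul]
      field_simp [hz' i]
      ring
    · ext i
      rw [hRe, map_sub, map_smul, lp.coeFn_sub, lp.coeFn_smul, Pi.sub_apply, Pi.smul_apply,
        smul_eq_mul, ← (hG _ _).1 h i]
      field_simp [hz' i]
  · rintro ⟨R, -, hR⟩ ⟨_, ⟨i, rfl⟩, rfl⟩
    -- an inverse of `G - E i` would map `0` to the eigenvector `e i`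
    have h := hR (e i) ((E i : ℂ) • e i) ((hG _ _).2 fun j => by
      rw [map_smul, lp.coeFn_smul, Pi.smul_apply, smul_eq_mul, e.repr_self]
      by_cases hij : j = i
      · rw [hij]
      · rw [lp.single_apply, Pi.single_apply, if_neg hij, mul_zero, mul_zero])
    rw [sub_self, map_zero] at h
    exact e.orthonormal.ne_zero i h.symm

variable {b : Module.Basis (Fin 2) ℝ (Fin 2 → ℝ)} {ω : Fin 2 → Fin 2 → ℝ} {A B : ℝ}

theorem abs_int_le_sq (n : ℤ) : |(n : ℝ)| ≤ (n : ℝ) ^ 2 := by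
  rw [← sq_abs]
  exact_mod_cast Int.le_self_sq |n|

theorem finite_setOf_intCast_sq_le (c : ℝ) : {n : ℤ | (n : ℝ) ^ 2 ≤ c}.Finite := by
  refine (Set.finite_Icc (-⌈c⌉) ⌈c⌉).subset fun n hn => ?_
  have h := abs_le.1 (((abs_int_le_sq n).trans hn).trans (Int.le_ceil c))
  exact ⟨by exact_mod_cast h.1, by exact_mod_cast h.2⟩

/-- The quadratic form of the dual lattice is proper: the pairings of a dual vector with the basis
`b` are `2π` times integers which determine it. -/
theorem finite_quadForm_le (hω : IsDualBasis b ω) (c : ℝ) : {k | quadForm ω k ≤ c}.Finite := by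
  have h : ∀ k j, ∃ n : ℤ, dualVector ω k ⬝ᵥ b j = 2 * Real.pi * n := fun k j =>
    (hω.2 _).1 (dualVector_mem k) _ (Submodule.subset_span ⟨j, rfl⟩)
  choose n hn using h
  have hinj : Function.Injective n := fun k k' hk => by
    refine dualVector_injective hω (dotProduct_eq _ _ fun x => ?_)
    refine LinearMap.congr_fun (b.ext (f₁ := dotProductBilin ℝ ℝ (dualVector ω k))
      (f₂ := dotProductBilin ℝ ℝ (dualVector ω k')) fun j => ?_) x
    simp [hn, hk]
  refine ((Set.Finite.pi' fun j => finite_setOf_intCast_sq_le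
    (c * (b j 0 ^ 2 + b j 1 ^ 2))).preimage hinj.injOn).subset fun k hk j => ?_
  have h1 : (n k j : ℝ) ^ 2 ≤ (2 * Real.pi * n k j) ^ 2 := by
    rw [mul_pow]
    refine le_mul_of_one_le_left (sq_nonneg _) (one_le_pow₀ ?_)
    linarith [Real.pi_gt_three]
  refine h1.trans ?_
  rw [← hn, dotProduct, Fin.sum_univ_two]
  calc (dualVector ω k 0 * b j 0 + dualVector ω k 1 * b j 1) ^ 2
      ≤ quadForm ω k * (b j 0 ^ 2 + b j 1 ^ 2) := by
        rw [quadForm]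
        linarith [sq_nonneg (dualVector ω k 0 * b j 1 - dualVector ω k 1 * b j 0)]
    _ ≤ c * (b j 0 ^ 2 + b j 1 ^ 2) := mul_le_mul_of_nonneg_right hk (by positivity)

theorem quadForm_nonneg (k : Fin 2 → ℤ) : 0 ≤ quadForm ω k := by unfold quadForm; positivity

/-- This follows from `λ_l(μ) ≥ -|μ|` and `A |μ(k)| = |B - 1| Q(k) / 2`. -/
theorem min_mul_quadForm_le_eigenvalue (hA : 0 < A) (k : {k : Fin 2 → ℤ // k ≠ 0}) (l : ℕ) :
    min B 1 * quadForm ω k ≤ eigenvalue A B ω (Sum.inr (k, l)) := by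
  have h := mul_le_mul_of_nonneg_left
    (neg_abs_le_mathieuEigenvalue (mathieuParam A B ω k) l) hA.le
  have hμ : A * |mathieuParam A B ω k| = |B - 1| * quadForm ω k / 2 := by
    rw [mathieuParam, abs_div, abs_mul, abs_of_nonneg (quadForm_nonneg _),
      abs_of_pos (by positivity : 0 < 2 * A)]
    field_simp
  have hm : min B 1 = (B + 1 - |B - 1|) / 2 := by
    rcases le_total B 1 with h | h
    · rw [min_eq_left h, abs_of_nonpos (by linarith)]; ring
    · rw [min_eq_right h, abs_of_nonneg (by linarith)]; ring
  rw [eigenvalue, hm]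
  linarith

theorem finite_eigenvalue_le (hA : 0 < A) (hB : 0 < B) (hω : IsDualBasis b ω) (c : ℝ) :
    {i | eigenvalue A B ω i ≤ c}.Finite := by
  have hm : 0 < min B 1 := lt_min hB one_pos
  have h0 := (finite_setOf_intCast_sq_le (c / A)).image (Sum.inl : ℤ → Label)
  have hK : {k : {k : Fin 2 → ℤ // k ≠ 0} | quadForm ω k ≤ c / min B 1}.Finite :=
    (finite_quadForm_le hω (c / min B 1)).preimage Subtype.val_injective.injOn
  have h1 := hK.biUnion fun k _ => (finite_mathieuEigenvalue_le (mathieuParam A B ω k)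
    ((c - (B + 1) * quadForm ω k / 2) / A)).image fun l => (Sum.inr (k, l) : Label)
  refine (h0.union h1).subset ?_
  rintro (m | ⟨k, l⟩) hi
  · refine Or.inl ⟨m, ?_, rfl⟩
    rw [Set.mem_ofPred_eq, le_div_iff₀' hA]
    exact hi
  · refine Or.inr (Set.mem_biUnion (x := k) ?_ ⟨l, ?_, rfl⟩)
    · rw [Set.mem_ofPred_eq, le_div_iff₀' hm]
      exact (min_mul_quadForm_le_eigenvalue hA k l).trans hi
    · rw [Set.mem_ofPred_eq, le_div_iff₀' hA, le_sub_iff_add_le]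
      exact hi

theorem range_eigenvalue : Set.range (eigenvalue A B ω) = spec0 A ∪ specM A B ω := by
  ext x
  constructor
  · rintro ⟨m | ⟨k, l⟩, rfl⟩
    · refine Or.inl ⟨m.natAbs, ?_⟩
      rw [eigenvalue, Nat.cast_natAbs, Int.cast_abs, sq_abs]
    · exact Or.inr ⟨k, k.2, l, rfl⟩
  · rintro (⟨m, rfl⟩ | ⟨k, hk, l, rfl⟩)
    · exact ⟨Sum.inl m, by simp [eigenvalue]⟩
    · exact ⟨Sum.inr (⟨k, hk⟩, l), rfl⟩

variable [hA : Fact (0 < A)] [hB : Fact (0 < B)]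

theorem integral_conj_mul (F : periodicContinuous b) {f : Torus b → ℂ} (hf : f ∘ proj b = F.1)
    (u : TorusL2 A B b) :
    ∫ x, starRingEnd ℂ (f x) * u x ∂(torusVolume A B b) = inner ℂ (toL2 b A B F) u := by
  rw [L2.inner_def]
  refine integral_congr_ae ?_
  filter_upwards [coeFn_toL2 (A := A) (B := B) F] with x hx
  obtain ⟨q, rfl⟩ : ∃ q, proj b q = x := QuotientAddGroup.mk_surjective x
  rw [hx, descend_proj F.2.2, ← hf, RCLike.inner_apply, mul_comm, Function.comp_apply]

/-- The graph of `-Δ` in terms of periodic test functions on `ℝ³`. -/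
theorem negLaplacianGraph_iff (u v : TorusL2 A B b) : NegLaplacianGraph A B b u v ↔
    ∀ F F' : periodicContinuous b, Smooth F.1 → (∀ q, F'.1 q = -explicitLaplacian A B F.1 q) →
      inner ℂ (toL2 b A B F') u = inner ℂ (toL2 b A B F) v := by
  constructor
  · intro h F F' hF hF'
    have hs : IsSmooth b (descend b F.1) := by
      rw [IsSmooth, descend_comp_proj F.2.2]; exact hF
    have := h _ hs
    rw [integral_conj_mul F (descend_comp_proj F.2.2)] at this
    rw [← this]
    refine (integral_conj_mul F' ?_ u).symm
    ext q
    rw [Function.comp_apply, torusLaplacian_proj hA.out hB.out hs, descend_comp_proj F.2.2, hF']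
  · intro h f hf
    have hp := isPeriodic_comp_proj f
    let F : periodicContinuous b := ⟨f ∘ proj b, hf.continuous, hp⟩
    let F' : periodicContinuous b := ⟨explicitLaplacian A B (f ∘ proj b),
      (Smooth.explicitLaplacian hf A B).continuous, hp.explicitLaplacian A B⟩
    rw [integral_conj_mul F rfl, ← h F (-F') hf fun _ => rfl]
    refine integral_conj_mul (-F') ?_ u
    ext q
    rw [Function.comp_apply, torusLaplacian_proj hA.out hB.out hf]
    rfl

variable {φ : ℝ → ℕ → ℝ → ℝ}

/-- Symmetry of `-Δ`, tested against an eigenfunction; `F'` stands for `-Δ F`. -/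
theorem inner_toL2_eigenElement (hω : IsDualBasis b ω) (hφ : ∀ μ, IsMathieuSystem μ (φ μ))
    (i : Label) {F F' : periodicContinuous b} (hF : Smooth F.1)
    (hF' : ∀ q, F'.1 q = -explicitLaplacian A B F.1 q) :
    inner ℂ (toL2 b A B F') (toL2 b A B (eigenElement A B hω hφ i)) =
      eigenvalue A B ω i * inner ℂ (toL2 b A B F) (toL2 b A B (eigenElement A B hω hφ i)) := by
  have hψ := smooth_eigenfunction (A := A) (B := B) (w := ω) hφ i
  have hpψ : IsPeriodic b (eigenfunction A B ω φ i) := by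
    rw [← coe_eigenElement hω hφ i]; exact (eigenElement A B hω hφ i).2.2
  have hc : Smooth fun q => starRingEnd ℂ (F.1 q) := Complex.conjCLE.contDiff.comp hF
  have key := setIntegral_cell_explicitLaplacian_mul A B hc hψ F.2.2.conj hpψ
  rw [inner_toL2, inner_toL2, coe_eigenElement]
  simp_rw [hF', map_neg, neg_mul, ← explicitLaplacian_conj]
  rw [integral_neg, key, ← integral_neg]
  simp_rw [explicitLaplacian_eigenfunction hA.out hφ i]
  have e : ∀ q, -(starRingEnd ℂ (F.1 q) *
      -((eigenvalue A B ω i : ℂ) * eigenfunction A B ω φ i q)) =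
      eigenvalue A B ω i * (starRingEnd ℂ (F.1 q) * eigenfunction A B ω φ i q) := fun q => by ring
  simp_rw [e]
  rw [integral_const_mul, mul_left_comm]

/-- `-Δ`, in the sense of distributions and with its maximal domain, is diagonal in the basis of
eigenfunctions. -/
theorem negLaplacianGraph_iff_repr (hω : IsDualBasis b ω) (hφ : ∀ μ, IsMathieuSystem μ (φ μ))
    (u v : TorusL2 A B b) : NegLaplacianGraph A B b u v ↔
      ∀ i, (eigenvalue A B ω i : ℂ) * (eigenBasis hω hφ).repr u i =
        (eigenBasis hω hφ).repr v i := by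
  rw [negLaplacianGraph_iff]
  simp_rw [HilbertBasis.repr_apply_apply]
  constructor
  · intro h i
    have := h (eigenElement A B hω hφ i) ((eigenvalue A B ω i : ℂ) • eigenElement A B hω hφ i)
      (by rw [coe_eigenElement]; exact smooth_eigenfunction hφ i) fun q => by
        rw [coe_eigenElement, explicitLaplacian_eigenfunction hA.out hφ i, neg_neg,
          ← coe_eigenElement hω hφ i]
        rfl
    rw [map_smul, inner_smul_left, Complex.conj_ofReal] at this
    rw [eigenBasis_apply, inner_smul_left, inner_smul_left, ← this]
    ring
  · intro h F F' hF hF'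
    -- expand both inner products by Parseval's identity
    rw [← (eigenBasis hω hφ).tsum_inner_mul_inner, ← (eigenBasis hω hφ).tsum_inner_mul_inner]
    refine tsum_congr fun i => ?_
    rw [← h i, eigenBasis_apply, inner_smul_right, inner_smul_right,
      inner_toL2_eigenElement hω hφ i hF hF']
    ring

theorem graphSpectrum_negLaplacianGraph (hω : IsDualBasis b ω) :
    graphSpectrum (NegLaplacianGraph A B b) = Complex.ofReal '' (spec0 A ∪ specM A B ω) := by
  choose φ hφ using exists_isMathieuSystem
  rw [← range_eigenvalue]
  exact graphSpectrum_eq_image_range (eigenBasis hω hφ)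
    (finite_eigenvalue_le hA.out hB.out hω) (negLaplacianGraph_iff_repr hω hφ)

/-- The basis vectors are positive multiples of the eigenfunctions. -/
theorem eigenBasis_ae_eq (hω : IsDualBasis b ω) (hφ : ∀ μ, IsMathieuSystem μ (φ μ)) (i : Label) :
    ∃ c : ℝ, 0 < c ∧ ∀ᵐ x ∂(torusVolume A B b),
      (eigenBasis (A := A) (B := B) hω hφ i) x = c * descend b (eigenfunction A B ω φ i) x := by
  refine ⟨‖toL2 b A B (eigenElement A B hω hφ i)‖⁻¹,
    inv_pos.2 (norm_pos_iff.2 (toL2_eigenElement_ne_zero hω hφ i)), ?_⟩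
  rw [eigenBasis_apply]
  filter_upwards [Lp.coeFn_smul ((‖toL2 b A B (eigenElement A B hω hφ i)‖⁻¹ : ℝ) : ℂ)
    (toL2 b A B (eigenElement A B hω hφ i)), coeFn_toL2 (eigenElement A B hω hφ i)] with x h1 h2
  rw [h1, Pi.smul_apply, h2, coe_eigenElement, smul_eq_mul]

end

end Bianchi

end

theorem mainTheorem1 (A B : ℝ) (hA : 0 < A) (hB : 0 < B)
    (b : Module.Basis (Fin 2) ℝ (Fin 2 → ℝ)) (ω : Fin 2 → Fin 2 → ℝ)
    (hω : Bianchi.IsDualBasis b ω) :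
    -- the explicit form of the Laplace-Beltrami operator
    (∀ f : Bianchi.Torus b → ℂ, Bianchi.IsSmooth b f → ∀ q : Fin 3 → ℝ,
      Bianchi.torusLaplacian A B b f (Bianchi.proj b q) =
        A * Bianchi.partialDeriv 0 (Bianchi.partialDeriv 0 (f ∘ Bianchi.proj b)) q +
        Bianchi.partialDeriv 1 (Bianchi.partialDeriv 1 (f ∘ Bianchi.proj b)) q +
        Bianchi.partialDeriv 2 (Bianchi.partialDeriv 2 (f ∘ Bianchi.proj b)) q +
        (B - 1) * Bianchi.fieldX1 (Bianchi.fieldX1 (f ∘ Bianchi.proj b)) q) ∧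
    -- the periodic Mathieu functions exist for every parameter
    (∀ μ : ℝ, ∃ φ : ℕ → ℝ → ℝ, Bianchi.IsMathieuSystem μ φ) ∧
    -- for every choice of them the functions of the theorem are well defined on the torus, smooth,
    -- eigenfunctions, and after normalisation an orthonormal basis
    (∀ φ : ℝ → ℕ → ℝ → ℝ, (∀ μ, Bianchi.IsMathieuSystem μ (φ μ)) →
      ∃ Ψ : Bianchi.Label → Bianchi.Torus b → ℂ,
        (∀ i q, Ψ i (Bianchi.proj b q) = Bianchi.eigenfunction A B ω φ i q) ∧
        (∀ i, Bianchi.IsSmooth b (Ψ i)) ∧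
        (∀ i x, -(Bianchi.torusLaplacian A B b (Ψ i) x) =
          (Bianchi.eigenvalue A B ω i : ℂ) * Ψ i x) ∧
        ∃ e : HilbertBasis Bianchi.Label ℂ (Bianchi.TorusL2 A B b), ∀ i, ∃ c : ℝ, 0 < c ∧
          ∀ᵐ x ∂(Bianchi.torusVolume A B b), (e i) x = (c : ℂ) * Ψ i x) ∧
    -- the spectrum
    (B ≠ 1 → Bianchi.graphSpectrum (Bianchi.NegLaplacianGraph A B b) =
      Complex.ofReal '' (Bianchi.spec0 A ∪ Bianchi.specM A B ω)) := by
  have := Fact.mk hA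
  have := Fact.mk hB
  refine ⟨fun f hf q => Bianchi.torusLaplacian_proj hA hB hf q, Bianchi.exists_isMathieuSystem,
    fun φ hφ => ?_, fun _ => Bianchi.graphSpectrum_negLaplacianGraph hω⟩
  have hp : ∀ i, Bianchi.IsPeriodic b (Bianchi.eigenfunction A B ω φ i) := fun i => by
    rw [← Bianchi.coe_eigenElement hω hφ i]
    exact (Bianchi.eigenElement A B hω hφ i).2.2
  have hs : ∀ i, Bianchi.IsSmooth b (Bianchi.descend b (Bianchi.eigenfunction A B ω φ i)) :=
    fun i => by
      rw [Bianchi.IsSmooth, Bianchi.descend_comp_proj (hp i)]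
      exact Bianchi.smooth_eigenfunction hφ i
  refine ⟨fun i => Bianchi.descend b (Bianchi.eigenfunction A B ω φ i),
    fun i q => Bianchi.descend_proj (hp i) q, hs, fun i x => ?_, Bianchi.eigenBasis hω hφ,
    Bianchi.eigenBasis_ae_eq hω hφ⟩
  obtain ⟨q, rfl⟩ : ∃ q, Bianchi.proj b q = x := QuotientAddGroup.mk_surjective x
  rw [Bianchi.torusLaplacian_proj hA hB (hs i), Bianchi.descend_comp_proj (hp i),
    Bianchi.explicitLaplacian_eigenfunction hA hφ, neg_neg]
  exact congrArg _ (Bianchi.descend_proj (hp i) q).symm
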